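/- **Conventions.** An algebraic space is a sheaf of sets on the category of schemes with the étale topology whose diagonal is representable by schemes and which admits an étale surjective morphism from a scheme. For a commutative ring $A$ and a commutative $A$-algebra $B$, let $\Gamma_A(B)=\bigoplus_{d\ge 0}\Gamma^d_A(B)$ be the algebra of divided powers of the $A$-module $B$, with product $\times$ and divided powers $\gamma^n$. The module $\Gamma^d_A(B)$, spanned by the elements $\gamma^{k_1}(x_1)\times\dots\times\gamma^{k_n}(x_n)$ with $k_1+\dots+k_n=d$, is an $A$-algebra with unit $\gamma^d(1)$ under the bilinear multiplication $$\Bigl(\prod_i\gamma^{k_i}(x_i)\Bigr)\cdot\Bigl(\prod_j\gamma^{l_j}(y_j)\Bigr)=\sum_{\xi}\prod_{i,j}\gamma^{\xi_{ij}}(x_iy_j),$$ where the products of divided powers are taken with respect to $\times$, and $\xi$ runs over the matrices of non-negative integers with row sums $k_i$ and column sums $l_j$; in particular $\gamma^d(x)\gamma^d(y)=\gamma^d(xy)$. For an algebraic space $S$ and an affine morphism $f:X\to S$, let $\Gamma^d(X/S)\to S$ be the $S$-space $\operatorname{Spec}\Gamma^d_{\mathcal O_S}(f_*\mathcal O_X)$: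 for a scheme $T$, a $T$-point is a morphism $T\to S$ together with, for every morphism $\operatorname{Spec}A\to T$, with $X\times_S\operatorname{Spec}A=\operatorname{Spec}B$, an $A$-algebra homomorphism $\Gamma^d_A(B)\to A$, compatibly with base change in $A$. It is functorial in commutative squares $(X'\to S')\to(X\to S)$. **Families.** Let $S$ be an algebraic space, $f:X\to S$ an affine morphism, $d\ge 0$ an integer and $T$ an $S$-scheme. A family of zero cycles of degree $d$ on $X\times_ST/T$ is a pair $(Z,\alpha)$ of a closed subscheme $Z\hookrightarrow X\times_ST$ which is integral over $T$ and a $T$-morphism $\alpha:T\to\Gamma^d(Z/T)$. Two families $(Z_1,\alpha_1)$ and $(Z_2,\alpha_2)$ are equivalent if there are a closed subscheme $Z$ of both $Z_1$ and $Z_2$ and a $T$-morphism $\alpha:T\to\Gamma^d(Z/T)$ such that $\alpha_i$ is the composite of $\alpha$ and $\Gamma^d(Z/T)\to\Gamma^d(Z_i/T)$ for $i=1,2$. Let $\underline\Gamma^d_{X/S}$ be the contravariant functor from $S$-schemes to sets which sends $T$ to the set of equivalence classes of families of zero cycles of degree $d$ on $X\times_ST/T$, and a morphism of $S$-schemes $g:T'\to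 T$ to the pull-back $(Z,\alpha)\mapsto(Z\times_TT',\,g^*\alpha)$. **Proposition.** Let $S$ be an algebraic space, $f:X\to S$ an affine morphism and $d\ge 0$ an integer. Then $\Gamma^d(X/S)$ is an algebraic space which is affine over $S$, and for every morphism $\operatorname{Spec}A\to S$, with $X\times_S\operatorname{Spec}A=\operatorname{Spec}B$, there is an isomorphism of $\operatorname{Spec} A$-schemes $\Gamma^d(X/S)\times_S\operatorname{Spec}A\cong\operatorname{Spec}\Gamma^d_A(B)$ under which the projection $\operatorname{Spec}\Gamma^d_A(B)\to\Gamma^d(X/S)$ is the tautological point. The functor $\underline\Gamma^d_{X/S}$ is represented by $\Gamma^d(X/S)$: sending the class of a family $(Z,\alpha)$ on $X\times_ST/T$ to the composite $$T\xrightarrow{\ \alpha\ }\Gamma^d(Z/T)\longrightarrow\Gamma^d(X/S),$$ where the second morphism is induced by $Z\hookrightarrow X\times_ST\to X$ and $T\to S$, is a well-defined isomorphism of functors on $S$-schemes $\underline\Gamma^d_{X/S}\cong\operatorname{Hom}_S(-,\Gamma^d(X/S))$. -/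

import Mathlib

universe u
set_option linter.unusedSectionVars false
noncomputable section
open scoped TensorProduct
open Finset.HasAntidiagonal (antidiagonal mem_antidiagonal)

namespace GammaAlgebra

lemma sum_antidiagonal_mul_choose {A : Type*} [CommRing A] (F : ℕ → ℕ → A) (n p : ℕ) :
    ∑ a ∈ antidiagonal n, ∑ b ∈ antidiagonal p,
      (((a.1 + b.1).choose a.1 * (a.2 + b.2).choose a.2 : ℕ) : A) * F (a.1 + b.1) (a.2 + b.2) =
    ((n + p).choose n : A) * ∑ c ∈ antidiagonal (n + p), F c.1 c.2 := by
  have h : ∀ c ∈ antidiagonal (n + p), (((n + p).choose n : ℕ) : A) * F c.1 c.2 =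
      ∑ a ∈ antidiagonal n, ((c.1.choose a.1 * c.2.choose a.2 : ℕ) : A) * F c.1 c.2 := by
    intro c hc
    rw [← mem_antidiagonal.1 hc, Nat.add_choose_eq]
    push_cast
    rw [Finset.sum_mul]
  rw [Finset.mul_sum (antidiagonal (n + p)), Finset.sum_congr (s₁ := antidiagonal (n + p)) rfl h,
    Finset.sum_comm (s := antidiagonal (n + p))]
  refine Finset.sum_congr rfl fun a ha => ?_
  rw [mem_antidiagonal] at ha
  refine Finset.sum_of_injOn (fun b => (a.1 + b.1, a.2 + b.2)) ?_ ?_ ?_ ?_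
  · rintro ⟨x, y⟩ _ ⟨x', y'⟩ _ h
    simpa using h
  · rintro ⟨x, y⟩ h
    simp at h ⊢
    omega
  · rintro ⟨x, y⟩ h h'
    simp only [mem_antidiagonal, Set.mem_image, Finset.mem_coe, Prod.mk.injEq, Prod.exists, not_exists,
      not_and] at h h'
    have : x < a.1 ∨ y < a.2 := by
      by_contra hcon
      push Not at hcon
      exact h' (x - a.1) (y - a.2) (by omega) (by omega) (by omega)
    rcases this with h | h
    · simp [Nat.choose_eq_zero_of_lt h]
    · simp [Nat.choose_eq_zero_of_lt h]
  · intro b hb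
    rfl

section Basic
variable (R : Type*) [CommRing R] (M : Type*) [AddCommGroup M] [Module R M]

/-- The algebra of divided powers `Γ_R(M)`: the commutative `R`-algebra generated by the symbols
`γⁿ(m)` subject to `γ⁰(m) = 1`, `γⁿ(rm) = rⁿγⁿ(m)`, `γⁿ(m)γᵖ(m) = ((n,p)) γⁿ⁺ᵖ(m)` and
`γⁿ(x + y) = ∑ γⁱ(x)γʲ(y)`. Its product is written `×` in the comments. -/
def DivPow : Type _ := DividedPowerAlgebra R M

instance : CommRing (DivPow R M) := inferInstanceAs (CommRing (DividedPowerAlgebra R M))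

instance : Algebra R (DivPow R M) := inferInstanceAs (Algebra R (DividedPowerAlgebra R M))

variable {M}

/-- The divided power `γⁿ(m)`. -/
def dp (n : ℕ) (m : M) : DivPow R M := DividedPowerAlgebra.dp R n m

variable {R}

lemma dp_zero (m : M) : dp R 0 m = 1 := DividedPowerAlgebra.dp_zero

lemma dp_smul (n : ℕ) (r : R) (m : M) : dp R n (r • m) = r ^ n • dp R n m :=
  DividedPowerAlgebra.dp_smul

lemma dp_mul (n p : ℕ) (m : M) : dp R n m * dp R p m = (n + p).choose n • dp R (n + p) m :=
  DividedPowerAlgebra.dp_mul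

lemma dp_add (n : ℕ) (x y : M) :
    dp R n (x + y) = ∑ k ∈ antidiagonal n, dp R k.1 x * dp R k.2 y :=
  DividedPowerAlgebra.dp_add

@[elab_as_elim]
lemma DivPow.induction_on {P : DivPow R M → Prop} (f : DivPow R M)
    (C : ∀ a, P (algebraMap R _ a)) (add : ∀ f g, P f → P g → P (f + g))
    (dp : ∀ (f : DivPow R M) (n : ℕ) (m : M), P f → P (f * dp R n m)) : P f :=
  DividedPowerAlgebra.induction_on f C add dp

/-- Algebra homomorphisms out of `Γ_R(M)` from its presentation. -/
def DivPow.lift {A : Type*} [CommRing A] [Algebra R A] (f : ℕ → M → A) (h_zero : ∀ m, f 0 m = 1)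
    (h_smul : ∀ (n : ℕ) (r : R) (m : M), f n (r • m) = r ^ n • f n m)
    (h_mul : ∀ n p m, f n m * f p m = (n + p).choose n • f (n + p) m)
    (h_add : ∀ n x y, f n (x + y) = ∑ k ∈ antidiagonal n, f k.1 x * f k.2 y) :
    DivPow R M →ₐ[R] A :=
  DividedPowerAlgebra.lift' (f := fun z => f z.1 z.2) h_zero h_smul h_mul h_add

lemma DivPow.lift_dp {A : Type*} [CommRing A] [Algebra R A] (f : ℕ → M → A) (h_zero h_smul h_mul h_add)
    (n : ℕ) (m : M) : DivPow.lift (R := R) f h_zero h_smul h_mul h_add (dp R n m) = f n m :=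
  DividedPowerAlgebra.lift'_apply_dp (f := fun z => f z.1 z.2) h_zero h_smul h_mul h_add n m

end Basic

section Coalg
variable (R : Type*) [CommRing R] (M : Type*) [AddCommGroup M] [Module R M]

variable {R M} in
lemma hom_ext {A : Type*} [Semiring A] [Algebra R A] {f g : DivPow R M →ₐ[R] A}
    (h : ∀ n m, f (dp R n m) = g (dp R n m)) : f = g := by
  refine AlgHom.ext fun x => ?_
  induction x using DivPow.induction_on with
  | C a => simp
  | add p q hp hq => simp [hp, hq]
  | dp p n m hp => simp [hp, h]

/-- The comultiplication `γⁿ(x) ↦ ∑ γⁱ(x) ⊗ γʲ(x)`, induced by `x ↦ (x, x)`. -/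
def comulHom : DivPow R M →ₐ[R]
    DivPow R M ⊗[R] DivPow R M :=
  DivPow.lift (fun n m => ∑ a ∈ antidiagonal n, dp R a.1 m ⊗ₜ[R] dp R a.2 m)
    (fun m => by simp [dp_zero, Algebra.TensorProduct.one_def])
    (fun n r m => by
      simp only [Finset.smul_sum]
      refine Finset.sum_congr rfl fun a ha => ?_
      rw [dp_smul, dp_smul, ← mem_antidiagonal.1 ha,
        TensorProduct.smul_tmul_smul, pow_add])
    (fun n p m => by
      have := sum_antidiagonal_mul_choose
        (A := DivPow R M ⊗[R] DivPow R M)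
        (fun i j => dp R i m ⊗ₜ[R] dp R j m) n p
      simp only [nsmul_eq_mul]
      rw [← this, Finset.sum_mul_sum]
      refine Finset.sum_congr rfl fun a ha => Finset.sum_congr rfl fun b hb => ?_
      rw [Algebra.TensorProduct.tmul_mul_tmul, dp_mul,
        dp_mul, ← nsmul_eq_mul, mul_nsmul, TensorProduct.tmul_smul,
        ← TensorProduct.smul_tmul'])
    (fun n x y => by
      let E : M → PowerSeries (DivPow R M ⊗[R] DivPow R M) :=
        fun m => PowerSeries.mk fun n => dp R n m ⊗ₜ[R] 1
      let F : M → PowerSeries (DivPow R M ⊗[R] DivPow R M) :=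
        fun m => PowerSeries.mk fun n => 1 ⊗ₜ[R] dp R n m
      have hE : E (x + y) = E x * E y := by
        ext n
        simp [E, PowerSeries.coeff_mul, dp_add, TensorProduct.sum_tmul]
      have hF : F (x + y) = F x * F y := by
        ext n
        simp [F, PowerSeries.coeff_mul, dp_add, TensorProduct.tmul_sum]
      have hEF : ∀ m n, ∑ a ∈ antidiagonal n, dp R a.1 m ⊗ₜ[R] dp R a.2 m =
          PowerSeries.coeff n (E m * F m) := by
        intro m n
        simp [E, F, PowerSeries.coeff_mul]
      simp only [hEF]
      rw [← PowerSeries.coeff_mul, hE, hF]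
      congr 1
      ring)

@[simp] lemma comulHom_dp (n : ℕ) (x : M) : comulHom R M (dp R n x) =
    ∑ a ∈ antidiagonal n, dp R a.1 x ⊗ₜ[R] dp R a.2 x := by
  simp [comulHom, DivPow.lift_dp]

/-- The counit `Γ_R(M) → Γ⁰_R(M) = R`. -/
def counitHom : DivPow R M →ₐ[R] R :=
  DivPow.lift (fun n m => if n = 0 then 1 else 0)
    (fun m => by simp)
    (fun n r m => by by_cases h : n = 0 <;> simp [h])
    (fun n p m => by by_cases h : n = 0 <;> by_cases h' : p = 0 <;> simp [h, h'])
    (fun n x y => by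
      rcases n with _ | n
      · simp
      · rw [Finset.sum_eq_zero]
        · simp
        · rintro ⟨a, b⟩ h
          rw [mem_antidiagonal] at h
          by_cases ha : a = 0
          · have : b ≠ 0 := by simp at h; omega
            simp [this]
          · simp [ha])

@[simp] lemma counitHom_dp (n : ℕ) (x : M) : counitHom R M (dp R n x) =
    if n = 0 then 1 else 0 := by
  simp [counitHom, DivPow.lift_dp]

instance : Bialgebra R (DivPow R M) :=
  Bialgebra.ofAlgHom (comulHom R M) (counitHom R M)
    (by
      apply hom_ext
      intro n m
      simp [TensorProduct.sum_tmul, TensorProduct.tmul_sum]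
      rw [Finset.sum_sigma', Finset.sum_sigma']
      exact Finset.sum_nbij' (fun x => ⟨(x.2.1, x.2.2 + x.1.2), (x.2.2, x.1.2)⟩)
        (fun x => ⟨(x.1.1 + x.2.1, x.2.2), (x.1.1, x.2.1)⟩)
        (by rintro ⟨⟨a, b⟩, ⟨c, e⟩⟩; simp; omega)
        (by rintro ⟨⟨a, b⟩, ⟨c, e⟩⟩; simp; omega)
        (by rintro ⟨⟨a, b⟩, ⟨c, e⟩⟩; simp)
        (by rintro ⟨⟨a, b⟩, ⟨c, e⟩⟩; simp)
        (by rintro ⟨⟨a, b⟩, ⟨c, e⟩⟩; simp))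
    (by
      apply hom_ext
      intro n m
      simp only [AlgHom.comp_apply, comulHom_dp, map_sum, Algebra.TensorProduct.map_tmul]
      rw [Finset.sum_eq_single (0, n)]
      · simp
      · rintro ⟨a, b⟩ h h'
        have : a ≠ 0 := by rintro rfl; simp at h; simp [h] at h'
        simp [this]
      · simp)
    (by
      apply hom_ext
      intro n m
      simp only [AlgHom.comp_apply, comulHom_dp, map_sum, Algebra.TensorProduct.map_tmul]
      rw [Finset.sum_eq_single (n, 0)]
      · simp
      · rintro ⟨a, b⟩ h h'
        have : b ≠ 0 := by rintro rfl; simp at h; simp [h] at h'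
        simp [this]
      · simp)

lemma comul_eq (z : DivPow R M) :
    Coalgebra.comul (R := R) z = comulHom R M z := rfl

lemma counit_eq (z : DivPow R M) :
    Coalgebra.counit (R := R) z = counitHom R M z := rfl

instance : Coalgebra.IsCocomm R (DivPow R M) where
  comm_comp_comul := by
    have : ((Algebra.TensorProduct.comm R (DivPow R M)
        (DivPow R M)).toAlgHom).comp (comulHom R M) = comulHom R M := by
      apply hom_ext
      intro n m
      simp only [AlgHom.comp_apply, comulHom_dp, map_sum]
      exact Finset.sum_nbij' Prod.swap Prod.swap (by simp [add_comm]) (by simp [add_comm])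
        (by simp) (by simp) (by simp)
    exact congr(($this).toLinearMap)

end Coalg

section Mul
variable (R : Type*) [CommRing R] (B : Type*) [CommRing B] [Algebra R B]

open Polynomial in
/-- The algebra homomorphism `γⁿ(y) ↦ γⁿ(xy) tⁿ`. -/
def scale (x : B) : DivPow R B →ₐ[R] (DivPow R B)[X] :=
  DivPow.lift (fun n m => monomial n (dp R n (x * m)))
    (fun m => by simp [dp_zero])
    (fun n r m => by
      rw [mul_smul_comm, dp_smul, Polynomial.smul_monomial])
    (fun n p m => by
      rw [monomial_mul_monomial, dp_mul, Polynomial.smul_monomial])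
    (fun n y z => by
      rw [mul_add, dp_add, map_sum]
      refine Finset.sum_congr rfl fun a ha => ?_
      simp only [monomial_mul_monomial, mem_antidiagonal.1 ha])

open Polynomial in
@[simp] lemma scale_dp (x : B) (n : ℕ) (y : B) :
    scale R B x (dp R n y) = monomial n (dp R n (x * y)) := by
  simp [scale, DivPow.lift_dp]

open Polynomial in
/-- Multiplication by `γⁿ(x)`: the map that is `∏ γ^{lⱼ}(yⱼ) ↦ ∏ γ^{lⱼ}(x yⱼ)` in degree `n` and
zero in the other degrees. -/
def mulDp (n : ℕ) (x : B) : DivPow R B →ₗ[R] DivPow R B where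
  toFun c := (scale R B x c).coeff n
  map_add' := by simp
  map_smul' := by simp

lemma mulDp_apply (n : ℕ) (x : B) (c : DivPow R B) :
    mulDp R B n x c = (scale R B x c).coeff n := rfl

lemma mulDp_dp (n : ℕ) (x : B) (m : ℕ) (y : B) :
    mulDp R B n x (dp R m y) = if m = n then dp R n (x * y) else 0 := by
  rw [mulDp_apply, scale_dp, Polynomial.coeff_monomial]
  split_ifs with h
  · rw [h]
  · rfl

lemma mulDp_mul (n : ℕ) (x : B) (c c' : DivPow R B) :
    mulDp R B n x (c * c') =
      ∑ a ∈ antidiagonal n, mulDp R B a.1 x c * mulDp R B a.2 x c' := by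
  simp only [mulDp_apply, map_mul, Polynomial.coeff_mul]

lemma mulDp_zero (x : B) (c : DivPow R B) :
    mulDp R B 0 x c = algebraMap R _ (counitHom R B c) := by
  induction c using DivPow.induction_on with
  | C a => simp [mulDp_apply, Polynomial.algebraMap_apply]
  | add p q hp hq => rw [map_add, hp, hq]; simp
  | dp p n m hp =>
    rw [mulDp_mul]
    have h1 : mulDp R B 0 x 1 = 1 := by simp [mulDp_apply]
    by_cases h : n = 0 <;> simp [hp, mulDp_dp, h, dp_zero, h1]

lemma mulDp_smul (n : ℕ) (r : R) (x : B) (c : DivPow R B) :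
    mulDp R B n (r • x) c = r ^ n • mulDp R B n x c := by
  induction c using DivPow.induction_on generalizing n with
  | C a =>
    rcases n with _ | n <;> simp [mulDp_apply, Polynomial.algebraMap_apply, Polynomial.coeff_C]
  | add p q hp hq => rw [map_add, hp, hq, map_add, smul_add]
  | dp p k m hp =>
    rw [mulDp_mul, mulDp_mul, Finset.smul_sum]
    refine Finset.sum_congr rfl fun a ha => ?_
    rw [hp, mulDp_dp, mulDp_dp, smul_mul_assoc r x m, dp_smul,
      ← mem_antidiagonal.1 ha]
    split_ifs
    · rw [smul_mul_smul_comm, pow_add]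
    · simp

/-- The map `c ⊗ e ↦ (γⁿ(x) · c) × (γᵖ(y) · e)`. -/
def tmulDp (n p : ℕ) (x y : B) :
    DivPow R B ⊗[R] DivPow R B →ₗ[R] DivPow R B :=
  LinearMap.mul' R _ ∘ₗ TensorProduct.map (mulDp R B n x) (mulDp R B p y)

lemma tmulDp_tmul (n p : ℕ) (x y : B) (c e : DivPow R B) :
    tmulDp R B n p x y (c ⊗ₜ[R] e) = mulDp R B n x c * mulDp R B p y e := by
  simp [tmulDp]

lemma tmulDp_mul (n p : ℕ) (x y : B)
    (t t' : DivPow R B ⊗[R] DivPow R B) :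
    tmulDp R B n p x y (t * t') = ∑ a ∈ antidiagonal n, ∑ b ∈ antidiagonal p,
      tmulDp R B a.1 b.1 x y t * tmulDp R B a.2 b.2 x y t' := by
  induction t using TensorProduct.induction_on with
  | zero => simp
  | add t₁ t₂ h₁ h₂ => simp only [add_mul, map_add, h₁, h₂, Finset.sum_add_distrib]
  | tmul c e =>
    induction t' using TensorProduct.induction_on with
    | zero => simp
    | add t₁ t₂ h₁ h₂ => simp only [mul_add, map_add, h₁, h₂, Finset.sum_add_distrib]
    | tmul c' e' =>
      rw [Algebra.TensorProduct.tmul_mul_tmul, tmulDp_tmul, mulDp_mul, mulDp_mul,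
        Finset.sum_mul_sum]
      refine Finset.sum_congr rfl fun a ha => Finset.sum_congr rfl fun b hb => ?_
      rw [tmulDp_tmul, tmulDp_tmul]
      ring

lemma tmulDp_comul (n p : ℕ) (x : B) (c : DivPow R B) :
    tmulDp R B n p x x (comulHom R B c) = (n + p).choose n • mulDp R B (n + p) x c := by
  induction c using DivPow.induction_on generalizing n p with
  | C a =>
    rw [AlgHom.commutes, Algebra.TensorProduct.algebraMap_apply, tmulDp_tmul]
    rcases n with _ | n <;> rcases p with _ | p <;>
      simp [mulDp_apply, Polynomial.algebraMap_apply, Polynomial.coeff_C, Polynomial.coeff_one]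
  | add c c' h h' => simp only [map_add, h, h', smul_add]
  | dp c m y h =>
    have key : ∀ n p, tmulDp R B n p x x (comulHom R B (dp R m y)) =
        (n + p).choose n • mulDp R B (n + p) x (dp R m y) := by
      intro n p
      rw [comulHom_dp, map_sum]
      simp only [tmulDp_tmul, mulDp_dp]
      by_cases hm : m = n + p
      · rw [Finset.sum_eq_single (n, p)]
        · simp [hm, dp_mul]
        · rintro ⟨a, b⟩ _ hab
          by_cases ha : a = n
          · have : b ≠ p := by rintro rfl; exact hab (by rw [ha])
            simp [this]
          · simp [ha]
        · simp [hm]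
      · rw [if_neg hm, smul_zero]
        refine Finset.sum_eq_zero ?_
        rintro ⟨a, b⟩ hab
        rw [mem_antidiagonal] at hab
        by_cases ha : a = n
        · have : b ≠ p := by rintro rfl; apply hm; simp at hab; omega
          simp [this]
        · simp [ha]
    rw [map_mul, tmulDp_mul, mulDp_mul]
    simp only [h, key, nsmul_eq_mul]
    rw [← sum_antidiagonal_mul_choose (fun i j => mulDp R B i x c * mulDp R B j x (dp R m y))]
    refine Finset.sum_congr rfl fun a ha => Finset.sum_congr rfl fun b hb => ?_
    push_cast
    ring

lemma mulDp_add (n : ℕ) (x y : B) (c : DivPow R B) :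
    mulDp R B n (x + y) c =
      ∑ a ∈ antidiagonal n, tmulDp R B a.1 a.2 x y (comulHom R B c) := by
  have h1 : ∀ t, (Algebra.TensorProduct.lift (scale R B x) (scale R B y)
      (fun _ _ => Commute.all _ _) t).coeff n =
      ∑ a ∈ antidiagonal n, tmulDp R B a.1 a.2 x y t := by
    intro t
    induction t using TensorProduct.induction_on with
    | zero => simp
    | add t₁ t₂ h₁ h₂ => simp only [map_add, Polynomial.coeff_add, h₁, h₂, Finset.sum_add_distrib]
    | tmul c e =>
      simp only [Algebra.TensorProduct.lift_tmul, Polynomial.coeff_mul, tmulDp_tmul, mulDp_apply]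
  have h2 : scale R B (x + y) = (Algebra.TensorProduct.lift (scale R B x) (scale R B y)
      (fun _ _ => Commute.all _ _)).comp (comulHom R B) := by
    apply hom_ext
    intro m z
    simp only [AlgHom.comp_apply, comulHom_dp, map_sum, Algebra.TensorProduct.lift_tmul, scale_dp,
      Polynomial.monomial_mul_monomial]
    rw [add_mul, dp_add, map_sum]
    refine Finset.sum_congr rfl fun a ha => ?_
    rw [mem_antidiagonal.1 ha]
  rw [mulDp_apply, h2, AlgHom.comp_apply, h1]

open WithConv in
/-- The multiplication of `Γ_R(B)` induced by that of `B`, as an algebra homomorphism to the linear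
endomorphisms with the convolution product. -/
def pairing : DivPow R B →ₐ[R]
    WithConv (DivPow R B →ₗ[R] DivPow R B) :=
  DivPow.lift (fun n m => toConv (mulDp R B n m))
    (fun m => WithConv.ext (LinearMap.ext fun c => mulDp_zero R B m c))
    (fun n r m => WithConv.ext (LinearMap.ext fun c => mulDp_smul R B n r m c))
    (fun n p m => WithConv.ext (LinearMap.ext fun c => tmulDp_comul R B n p m c))
    (fun n y z => WithConv.ext (LinearMap.ext fun c => by
      have h : ∀ (s : Finset (ℕ × ℕ)) (F : ℕ × ℕ → WithConv (DivPow R B →ₗ[R]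
          DivPow R B)), (∑ a ∈ s, F a).ofConv c = ∑ a ∈ s, (F a).ofConv c := by
        classical
        intro s F
        induction s using Finset.induction_on with
        | empty => rfl
        | insert a s ha ih => rw [Finset.sum_insert ha, Finset.sum_insert ha, ← ih]; rfl
      rw [h]
      exact mulDp_add R B n y z c))

@[simp] lemma pairing_dp (n : ℕ) (x : B) : pairing R B (dp R n x) = WithConv.toConv (mulDp R B n x) := by
  simp [pairing, DivPow.lift_dp]

/-- The multiplication `·` of `Γ_R(B)` induced by that of the `R`-algebra `B`: it is bilinear, and
`prod_mono_mono` below computes it on products of divided powers. Elements of different degrees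
multiply to zero. -/
def prod : DivPow R B →ₗ[R] DivPow R B →ₗ[R] DivPow R B :=
  (WithConv.linearEquiv R _).toLinearMap ∘ₗ (pairing R B).toLinearMap

lemma prod_dp (n : ℕ) (x : B) (c : DivPow R B) :
    prod R B (dp R n x) c = mulDp R B n x c := by
  simp [prod]

lemma prod_mul (a b c : DivPow R B) :
    prod R B (a * b) c =
      LinearMap.mul' R _ (TensorProduct.map (prod R B a) (prod R B b) (comulHom R B c)) := by
  simp [prod, comul_eq]

lemma prod_one (c : DivPow R B) :
    prod R B 1 c = algebraMap R _ (counitHom R B c) := by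
  simp [prod, counit_eq]

variable {B} in
/-- The monomial `∏ γ^{kᵢ}(xᵢ)`. -/
def mono {ι : Type*} [Fintype ι] (k : ι → ℕ) (x : ι → B) : DivPow R B :=
  ∏ i, dp R (k i) (x i)

variable {ι κ : Type*} [Fintype ι] [Fintype κ] [DecidableEq ι] [DecidableEq κ]

lemma comul_mono (l : κ → ℕ) (y : κ → B) : comulHom R B (mono R l y) =
    ∑ p ∈ Fintype.piFinset (fun j => antidiagonal (l j)),
      mono R (fun j => (p j).1) y ⊗ₜ[R] mono R (fun j => (p j).2) y := by
  have h : ∀ (s : Finset κ) (a b : κ → DivPow R B),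
      (∏ i ∈ s, a i) ⊗ₜ[R] (∏ i ∈ s, b i) = ∏ i ∈ s, (a i ⊗ₜ[R] b i) := by
    intro s a b
    induction s using Finset.induction_on with
    | empty => simp [Algebra.TensorProduct.one_def]
    | insert i s hi ih =>
      rw [Finset.prod_insert hi, Finset.prod_insert hi, Finset.prod_insert hi, ← ih,
        Algebra.TensorProduct.tmul_mul_tmul]
  simp only [mono, map_prod, comulHom_dp, h]
  rw [Finset.prod_univ_sum]

lemma mulDp_mono (n : ℕ) (x : B) (l : κ → ℕ) (y : κ → B) : mulDp R B n x (mono R l y) =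
    if ∑ j, l j = n then mono R l (fun j => x * y j) else 0 := by
  have h : ∀ s : Finset κ, scale R B x (∏ j ∈ s, dp R (l j) (y j)) =
      Polynomial.monomial (∑ j ∈ s, l j) (∏ j ∈ s, dp R (l j) (x * y j)) := by
    intro s
    induction s using Finset.induction_on with
    | empty => simp
    | insert i s hi ih =>
      rw [Finset.prod_insert hi, Finset.prod_insert hi, Finset.sum_insert hi, map_mul, ih,
        scale_dp, Polynomial.monomial_mul_monomial]
  rw [mulDp_apply, mono, h, Polynomial.coeff_monomial]
  rfl

lemma counit_mono (l : κ → ℕ) (y : κ → B) : counitHom R B (mono R l y) =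
    if ∀ j, l j = 0 then 1 else 0 := by
  simp only [mono, map_prod, counitHom_dp]
  rw [Finset.prod_ite_zero]
  simp

lemma prod_prod_mono (s : Finset ι) (a : ι → DivPow R B) (l : κ → ℕ) (y : κ → B) :
    prod R B (∏ i ∈ s, a i) (mono R l y) =
      ∑ ξ ∈ Fintype.piFinset (fun j => Finset.piAntidiag s (l j)),
        ∏ i ∈ s, prod R B (a i) (mono R (fun j => ξ j i) y) := by
  induction s using Finset.induction_on generalizing l with
  | empty =>
    rw [Finset.prod_empty, prod_one, counit_mono]
    simp only [Finset.prod_empty, Finset.sum_const, Fintype.card_piFinset, Finset.piAntidiag_empty]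
    by_cases h : ∀ j, l j = 0
    · simp [h]
    · rw [if_neg h, map_zero]
      push Not at h
      obtain ⟨j, hj⟩ := h
      rw [Finset.prod_eq_zero (Finset.mem_univ j)]
      · simp
      · simp [hj]
  | insert i₀ s hi ih =>
    rw [Finset.prod_insert hi, prod_mul, comul_mono]
    simp only [map_sum, TensorProduct.map_tmul, LinearMap.mul'_apply, ih, Finset.mul_sum]
    rw [Finset.sum_sigma']
    refine Finset.sum_bij' (fun z _ => fun j i => if i = i₀ then (z.1 j).1 else z.2 j i)
      (fun ξ _ => ⟨fun j => (ξ j i₀, l j - ξ j i₀), fun j i => if i = i₀ then 0 else ξ j i⟩)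
      ?_ ?_ ?_ ?_ ?_
    · rintro ⟨p, ξ⟩ h
      simp only [Finset.mem_sigma, Fintype.mem_piFinset, mem_antidiagonal,
        Finset.mem_piAntidiag] at h ⊢
      intro j
      refine ⟨?_, fun i hne => ?_⟩
      · rw [Finset.sum_insert hi, if_pos rfl, ← h.1 j, ← (h.2 j).1]
        congr 1
        refine Finset.sum_congr rfl fun i his => if_neg ?_
        rintro rfl
        exact hi his
      · by_cases hii : i = i₀
        · simp [hii]
        · rw [if_neg hii] at hne
          exact Finset.mem_insert_of_mem ((h.2 j).2 i hne)
    · intro ξ h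
      simp only [Finset.mem_sigma, Fintype.mem_piFinset, mem_antidiagonal,
        Finset.mem_piAntidiag] at h ⊢
      have h' : ∀ j, ξ j i₀ + ∑ i ∈ s, ξ j i = l j := fun j => by
        rw [← Finset.sum_insert hi, (h j).1]
      refine ⟨fun j => ?_, fun j => ⟨?_, fun i hne => ?_⟩⟩
      · have := h' j
        omega
      · rw [← h' j, Nat.add_sub_cancel_left]
        refine Finset.sum_congr rfl fun i his => if_neg ?_
        rintro rfl
        exact hi his
      · by_cases hii : i = i₀
        · simp [hii] at hne
        · rw [if_neg hii] at hne
          exact Finset.mem_of_mem_insert_of_ne ((h j).2 i hne) hii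
    · rintro ⟨p, ξ⟩ h
      simp only [Finset.mem_sigma, Fintype.mem_piFinset, mem_antidiagonal,
        Finset.mem_piAntidiag] at h
      simp only [if_true, Sigma.mk.injEq, heq_eq_eq]
      refine ⟨funext fun j => Prod.ext rfl ?_, funext fun j => funext fun i => ?_⟩
      · have := h.1 j
        simp only
        omega
      · by_cases hii : i = i₀
        · rw [if_pos hii, hii]
          by_contra hne
          exact hi ((h.2 j).2 i₀ (Ne.symm hne))
        · rw [if_neg hii, if_neg hii]
    · intro ξ h
      refine funext fun j => funext fun i => ?_
      by_cases hii : i = i₀ <;> simp [hii]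
    · rintro ⟨p, ξ⟩ h
      rw [Finset.prod_insert hi]
      simp only [if_true]
      congr 1
      refine Finset.prod_congr rfl fun i his => ?_
      have : i ≠ i₀ := by rintro rfl; exact hi his
      simp only [if_neg this]

/-- The matrices with nonnegative integer entries, row sums `k` and column sums `l`. -/
def margins (k : ι → ℕ) (l : κ → ℕ) : Finset (κ → ι → ℕ) :=
  (Fintype.piFinset fun j => Finset.piAntidiag Finset.univ (l j)).filter
    fun ξ => ∀ i, ∑ j, ξ j i = k i

lemma mem_margins {k : ι → ℕ} {l : κ → ℕ} {ξ : κ → ι → ℕ} :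
    ξ ∈ margins k l ↔ (∀ j, ∑ i, ξ j i = l j) ∧ ∀ i, ∑ j, ξ j i = k i := by
  simp [margins]

/-- The multiplication formula: the product of `∏ᵢ γ^{kᵢ}(xᵢ)` and `∏ⱼ γ^{lⱼ}(yⱼ)` is the sum of
`∏ γ^{ξⱼᵢ}(xᵢ yⱼ)` over all matrices `ξ` with margins `k` and `l`. -/
lemma prod_mono_mono (k : ι → ℕ) (x : ι → B) (l : κ → ℕ) (y : κ → B) :
    prod R B (mono R k x) (mono R l y) =
      ∑ ξ ∈ margins k l, mono R (fun z : κ × ι => ξ z.1 z.2) (fun z => x z.2 * y z.1) := by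
  rw [mono, prod_prod_mono, margins, Finset.sum_filter]
  refine Finset.sum_congr rfl fun ξ _ => ?_
  simp only [prod_dp, mulDp_mono]
  rw [Finset.prod_ite_zero]
  simp only [Finset.mem_univ, true_imp_iff, mono]
  rw [Fintype.prod_prod_type_right]

lemma prod_mono_comm (k : ι → ℕ) (x : ι → B) (l : κ → ℕ) (y : κ → B) :
    prod R B (mono R k x) (mono R l y) = prod R B (mono R l y) (mono R k x) := by
  rw [prod_mono_mono, prod_mono_mono]
  refine Finset.sum_nbij' (fun ξ i j => ξ j i) (fun ξ j i => ξ i j) ?_ ?_ ?_ ?_ ?_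
  · intro ξ h
    rw [mem_margins] at h ⊢
    exact h.symm
  · intro ξ h
    rw [mem_margins] at h ⊢
    exact h.symm
  · intro _ _; rfl
  · intro _ _; rfl
  · intro ξ _
    simp only [mono]
    rw [Fintype.prod_prod_type, Fintype.prod_prod_type_right]
    simp only [mul_comm]

lemma prod_mono_left_comm {μ : Type*} [Fintype μ] [DecidableEq μ] (k : ι → ℕ) (x : ι → B)
    (l : κ → ℕ) (y : κ → B) (m : μ → ℕ) (w : μ → B) :
    prod R B (mono R k x) (prod R B (mono R l y) (mono R m w)) =
      prod R B (mono R l y) (prod R B (mono R k x) (mono R m w)) := by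
  rw [prod_mono_mono, prod_mono_mono, map_sum, map_sum]
  simp only [prod_mono_mono]
  rw [Finset.sum_sigma', Finset.sum_sigma']
  refine Finset.sum_nbij'
    (fun z => ⟨fun c a => ∑ b, z.2 (c, b) a, fun p b => z.2 (p.1, b) p.2⟩)
    (fun z => ⟨fun c b => ∑ a, z.2 (c, a) b, fun p a => z.2 (p.1, a) p.2⟩) ?_ ?_ ?_ ?_ ?_
  · rintro ⟨ξ, η⟩ h
    simp only [Finset.mem_sigma, mem_margins, Prod.forall, Fintype.sum_prod_type] at h ⊢
    obtain ⟨⟨h1, h2⟩, h3, h4⟩ := h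
    refine ⟨⟨fun c => ?_, h4⟩, fun _ _ => trivial, fun b => ?_⟩
    · rw [Finset.sum_comm]; simp only [h3, h1]
    · simp only [h3, h2]
  · rintro ⟨ξ, η⟩ h
    simp only [Finset.mem_sigma, mem_margins, Prod.forall, Fintype.sum_prod_type] at h ⊢
    obtain ⟨⟨h1, h2⟩, h3, h4⟩ := h
    refine ⟨⟨fun c => ?_, h4⟩, fun _ _ => trivial, fun b => ?_⟩
    · rw [Finset.sum_comm]; simp only [h3, h1]
    · simp only [h3, h2]
  · rintro ⟨ξ, η⟩ h
    simp only [Finset.mem_sigma, mem_margins, Prod.forall] at h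
    simp only [h.2.1]
  · rintro ⟨ξ, η⟩ h
    simp only [Finset.mem_sigma, mem_margins, Prod.forall] at h
    simp only [h.2.1]
  · rintro ⟨ξ, η⟩ h
    simp only [mono, Fintype.prod_prod_type]
    refine Finset.prod_congr rfl fun c _ => ?_
    rw [Finset.prod_comm]
    simp only [mul_left_comm]

end Mul

section Piece
variable (R : Type*) [CommRing R]

/-- `Γᵈ_R(M)`, the degree `d` part of `Γ_R(M)`: it is spanned by the products
`γ^{k₁}(x₁) × ⋯ × γ^{kₙ}(xₙ)` with `k₁ + ⋯ + kₙ = d`. -/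
def piece (d : ℕ) (M : Type*) [AddCommGroup M] [Module R M] : Submodule R (DivPow R M) :=
  Submodule.span R {z | ∃ (n : ℕ) (k : Fin n → ℕ) (x : Fin n → M),
    ∑ i, k i = d ∧ z = ∏ i, dp R (k i) (x i)}

variable {R} (B : Type*) [CommRing B] [Algebra R B]

lemma mono_mem {ι : Type*} [Fintype ι] {d : ℕ} (k : ι → ℕ) (x : ι → B) (h : ∑ i, k i = d) :
    mono R k x ∈ piece R d B := by
  refine Submodule.subset_span ⟨Fintype.card ι, fun i => k ((Fintype.equivFin ι).symm i),
    fun i => x ((Fintype.equivFin ι).symm i), ?_, ?_⟩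
  · rw [← h, Equiv.sum_comp (Fintype.equivFin ι).symm k]
  · rw [Equiv.prod_comp (Fintype.equivFin ι).symm fun i => dp R (k i) (x i)]
    rfl

variable {B}

@[elab_as_elim]
lemma piece_induction {d : ℕ} {P : ∀ z ∈ piece R d B, Prop}
    (mono : ∀ (n : ℕ) (k : Fin n → ℕ) (x : Fin n → B) (h : ∑ i, k i = d),
      P (mono R k x) (mono_mem B k x h))
    (zero : P 0 (zero_mem _))
    (add : ∀ z z' hz hz', P z hz → P z' hz' → P (z + z') (add_mem hz hz'))
    (smul : ∀ (r : R) z hz, P z hz → P (r • z) (Submodule.smul_mem _ r hz))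
    {z : DivPow R B} (hz : z ∈ piece R d B) : P z hz := by
  induction hz using Submodule.span_induction with
  | mem z h =>
    obtain ⟨n, k, x, h, rfl⟩ := h
    exact mono n k x h
  | zero => exact zero
  | add z z' hz hz' h h' => exact add z z' hz hz' h h'
  | smul r z hz h => exact smul r z hz h

lemma prod_mem {d : ℕ} {a b : DivPow R B} (ha : a ∈ piece R d B) (hb : b ∈ piece R d B) :
    prod R B a b ∈ piece R d B := by
  induction ha using piece_induction with
  | zero => simp
  | add a a' _ _ h h' => simpa using Submodule.add_mem _ h h'
  | smul r a _ h => simpa using Submodule.smul_mem _ r h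
  | mono n k x hk =>
    induction hb using piece_induction with
    | zero => simp
    | add b b' _ _ h h' => simpa using Submodule.add_mem _ h h'
    | smul r b _ h => simpa using Submodule.smul_mem _ r h
    | mono m l y hl =>
      rw [prod_mono_mono]
      refine Submodule.sum_mem _ fun ξ hξ => mono_mem _ _ _ ?_
      rw [mem_margins] at hξ
      rw [Fintype.sum_prod_type]
      simp only [hξ.1, hl]

lemma prod_comm {d : ℕ} {a b : DivPow R B} (ha : a ∈ piece R d B) (hb : b ∈ piece R d B) :
    prod R B a b = prod R B b a := by
  induction ha using piece_induction with
  | zero => simp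
  | add a a' _ _ h h' => simp [h, h']
  | smul r a _ h => simp [h]
  | mono n k x hk =>
    induction hb using piece_induction with
    | zero => simp
    | add b b' _ _ h h' => simp [h, h']
    | smul r b _ h => simp [h]
    | mono m l y hl => exact prod_mono_comm R B k x l y

lemma prod_left_comm {d : ℕ} {a b c : DivPow R B} (ha : a ∈ piece R d B) (hb : b ∈ piece R d B)
    (hc : c ∈ piece R d B) : prod R B a (prod R B b c) = prod R B b (prod R B a c) := by
  induction ha using piece_induction with
  | zero => simp
  | add a a' _ _ h h' => simp [h, h']
  | smul r a _ h => simp [h]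
  | mono n k x hk =>
    induction hb using piece_induction with
    | zero => simp
    | add b b' _ _ h h' => simp [h, h']
    | smul r b _ h => simp [h]
    | mono m l y hl =>
      induction hc using piece_induction with
      | zero => simp
      | add b b' _ _ h h' => simp [h, h']
      | smul r b _ h => simp [h]
      | mono p j w hj => exact prod_mono_left_comm R B k x l y j w

lemma one_prod {d : ℕ} {a : DivPow R B} (ha : a ∈ piece R d B) : prod R B (dp R d 1) a = a := by
  induction ha using piece_induction with
  | zero => simp
  | add a a' _ _ h h' => simp [h, h']
  | smul r a _ h => simp [h]
  | mono n k x hk => simp [prod_dp, mulDp_mono, hk]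

lemma dp_mem (d : ℕ) (x : B) : dp R d x ∈ piece R d B :=
  Submodule.subset_span ⟨1, fun _ => d, fun _ => x, by simp, by simp⟩

end Piece

/-- The `R`-algebra `Γᵈ_R(B)`: the module `Γᵈ_R(B)`, multiplied by `prod`, with unit `γᵈ(1)`. -/
def Gam (d : ℕ) (R B : Type*) [CommRing R] [CommRing B] [Algebra R B] : Type _ := piece R d B

namespace Gam
variable (d : ℕ) (R B : Type*) [CommRing R] [CommRing B] [Algebra R B]

instance : AddCommGroup (Gam d R B) := inferInstanceAs (AddCommGroup (piece R d B))

instance : Module R (Gam d R B) := inferInstanceAs (Module R (piece R d B))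

instance : CommRing (Gam d R B) where
  __ := (inferInstance : AddCommGroup (Gam d R B))
  mul a b := ⟨prod R B a.1 b.1, prod_mem a.2 b.2⟩
  one := ⟨dp R d 1, dp_mem d 1⟩
  zero_mul a := Subtype.ext (show prod R B 0 a.1 = 0 by simp)
  mul_zero a := Subtype.ext (show prod R B a.1 0 = 0 by simp)
  left_distrib a b c := Subtype.ext (show prod R B a.1 (b.1 + c.1) = _ by rw [map_add]; rfl)
  right_distrib a b c := Subtype.ext (show prod R B (a.1 + b.1) c.1 = _ by
    rw [map_add, LinearMap.add_apply]; rfl)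
  mul_comm a b := Subtype.ext (prod_comm a.2 b.2)
  mul_assoc a b c := Subtype.ext (show prod R B (prod R B a.1 b.1) c.1 =
      prod R B a.1 (prod R B b.1 c.1) by
    rw [prod_comm (prod_mem a.2 b.2) c.2, prod_left_comm c.2 a.2 b.2, prod_comm c.2 b.2])
  one_mul a := Subtype.ext (one_prod a.2)
  mul_one a := Subtype.ext ((prod_comm a.2 (dp_mem d 1)).trans (one_prod a.2))

instance : Algebra R (Gam d R B) :=
  Algebra.ofModule
    (fun r a b => Subtype.ext (show prod R B (r • a.1) b.1 = r • prod R B a.1 b.1 by simp))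
    (fun r a b => Subtype.ext (show prod R B a.1 (r • b.1) = r • prod R B a.1 b.1 by simp))

variable {B}

/-- The multiplicative law `γᵈ : B → Γᵈ_R(B)`. -/
def gam (b : B) : Gam d R B := ⟨dp R d b, dp_mem d b⟩

lemma gam_mul (x y : B) : gam d R (x * y) = gam d R x * gam d R y :=
  Subtype.ext (show dp R d (x * y) = prod R B (dp R d x) (dp R d y) by simp [prod_dp, mulDp_dp])

lemma gam_one : gam d R (1 : B) = 1 := rfl

lemma gam_smul (r : R) (y : B) : gam d R (r • y) = r ^ d • gam d R y :=
  Subtype.ext (dp_smul d r y)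

end Gam

section Map
variable {R R' B B' : Type*} [CommRing R] [CommRing R'] [CommRing B] [CommRing B']
  [Algebra R B] [Algebra R' B'] (φ : R →+* R') (ψ : B →+* B')
  (h : ψ.comp (algebraMap R B) = (algebraMap R' B').comp φ)

lemma h_smul (h : ψ.comp (algebraMap R B) = (algebraMap R' B').comp φ) (r : R) (b : B) :
    ψ (r • b) = φ r • ψ b := by
  have := congr($h r)
  simp only [RingHom.comp_apply] at this
  rw [Algebra.smul_def, map_mul, this, Algebra.smul_def]

/-- The map `Γ_R(B) → Γ_R'(B')`, `γⁿ(b) ↦ γⁿ(ψ(b))`, for a commutative square. -/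
def mapAll : DivPow R B →+* DivPow R' B' :=
  letI : Algebra R (DivPow R' B') := ((algebraMap R' (DivPow R' B')).comp φ).toAlgebra
  (DivPow.lift (R := R) (fun n b => dp R' n (ψ b))
    (fun _ => dp_zero _)
    (fun n r m => by
      rw [h_smul φ ψ h, dp_smul, Algebra.smul_def, Algebra.smul_def, ← map_pow]
      rfl)
    (fun n p m => dp_mul _ _ _)
    (fun n x y => by rw [map_add, dp_add])).toRingHom

lemma mapAll_dp (n : ℕ) (b : B) : mapAll φ ψ h (dp R n b) = dp R' n (ψ b) := by
  let _ : Algebra R (DivPow R' B') := ((algebraMap R' (DivPow R' B')).comp φ).toAlgebra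
  exact DivPow.lift_dp _ _ _ _ _ n b

lemma mapAll_algebraMap (r : R) : mapAll φ ψ h (algebraMap R _ r) = algebraMap R' _ (φ r) := by
  let _ : Algebra R (DivPow R' B') := ((algebraMap R' (DivPow R' B')).comp φ).toAlgebra
  exact AlgHom.commutes _ r

lemma mapAll_smul (r : R) (z : DivPow R B) : mapAll φ ψ h (r • z) = φ r • mapAll φ ψ h z := by
  rw [Algebra.smul_def, map_mul, mapAll_algebraMap, Algebra.smul_def]

lemma mapAll_mono {ι : Type*} [Fintype ι] (k : ι → ℕ) (x : ι → B) :
    mapAll φ ψ h (mono R k x) = mono R' k (fun i => ψ (x i)) := by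
  simp [mono, mapAll_dp]

lemma mapAll_mem {d : ℕ} {z : DivPow R B} (hz : z ∈ piece R d B) :
    mapAll φ ψ h z ∈ piece R' d B' := by
  induction hz using piece_induction with
  | zero => simp
  | add a a' _ _ h h' => simpa using Submodule.add_mem _ h h'
  | smul r a _ h => rw [mapAll_smul]; exact Submodule.smul_mem _ _ h
  | mono n k x hk => rw [mapAll_mono]; exact mono_mem _ _ _ hk

lemma mapAll_prod {d : ℕ} {a b : DivPow R B} (ha : a ∈ piece R d B) (hb : b ∈ piece R d B) :
    mapAll φ ψ h (prod R B a b) = prod R' B' (mapAll φ ψ h a) (mapAll φ ψ h b) := by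
  induction ha using piece_induction with
  | zero => simp
  | add a a' _ _ h h' => simp [h, h']
  | smul r a _ h => simp [mapAll_smul, h]
  | mono n k x hk =>
    induction hb using piece_induction with
    | zero => simp
    | add b b' _ _ h h' => simp [h, h']
    | smul r b _ h => simp [mapAll_smul, h]
    | mono m l y hl => simp only [prod_mono_mono, mapAll_mono, map_sum, map_mul]

/-- The ring homomorphism `Γᵈ_R(B) → Γᵈ_R'(B')`, `γᵈ(b) ↦ γᵈ(ψ(b))`. -/
def Gam.map (d : ℕ) : Gam d R B →+* Gam d R' B' where
  toFun z := ⟨mapAll φ ψ h z.1, mapAll_mem φ ψ h z.2⟩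
  map_one' := Subtype.ext (show mapAll φ ψ h (dp R d 1) = dp R' d 1 by rw [mapAll_dp, map_one])
  map_mul' a b := Subtype.ext (mapAll_prod φ ψ h a.2 b.2)
  map_zero' := Subtype.ext (map_zero (mapAll φ ψ h))
  map_add' a b := Subtype.ext (map_add (mapAll φ ψ h) _ _)

end Map
end GammaAlgebra

open CategoryTheory Limits AlgebraicGeometry Opposite

namespace GammaAlgebra

section
variable {R R' R'' B B' B'' : Type*} [CommRing R] [CommRing R'] [CommRing R''] [CommRing B]
  [CommRing B'] [CommRing B''] [Algebra R B] [Algebra R' B'] [Algebra R'' B'']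

lemma mapAll_comp (φ : R →+* R') (ψ : B →+* B')
    (h : ψ.comp (algebraMap R B) = (algebraMap R' B').comp φ) (φ' : R' →+* R'') (ψ' : B' →+* B'')
    (h' : ψ'.comp (algebraMap R' B') = (algebraMap R'' B'').comp φ')
    (φ'' : R →+* R'') (ψ'' : B →+* B'')
    (h'' : ψ''.comp (algebraMap R B) = (algebraMap R'' B'').comp φ'')
    (hφ : φ'.comp φ = φ'') (hψ : ψ'.comp ψ = ψ'') (z : DivPow R B) :
    mapAll φ' ψ' h' (mapAll φ ψ h z) = mapAll φ'' ψ'' h'' z := by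
  subst hφ hψ
  induction z using DivPow.induction_on with
  | C r => simp [mapAll_algebraMap]
  | add a b ha hb => simp [ha, hb]
  | dp z n m h => simp [h, mapAll_dp]

lemma mapAll_id (φ : R →+* R) (ψ : B →+* B)
    (h : ψ.comp (algebraMap R B) = (algebraMap R B).comp φ)
    (hφ : φ = RingHom.id R) (hψ : ψ = RingHom.id B) (z : DivPow R B) :
    mapAll φ ψ h z = z := by
  subst hφ hψ
  induction z using DivPow.induction_on with
  | C r => simp [mapAll_algebraMap]
  | add a b ha hb => simp [ha, hb]
  | dp z n m h => simp [h, mapAll_dp]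

lemma Gam.map_algebraMap (φ : R →+* R') (ψ : B →+* B')
    (h : ψ.comp (algebraMap R B) = (algebraMap R' B').comp φ) (d : ℕ) (r : R) :
    Gam.map φ ψ h d (algebraMap R _ r) = algebraMap R' _ (φ r) := by
  rw [Algebra.algebraMap_eq_smul_one, Algebra.algebraMap_eq_smul_one,
    ← map_one (Gam.map φ ψ h d)]
  exact Subtype.ext (mapAll_smul φ ψ h r _)

end
end GammaAlgebra

namespace GammaSpace
open GammaAlgebra

/-- Presheaves of (large) sets on the category of schemes. -/
abbrev Presh : Type (u + 2) := Scheme.{u}ᵒᵖ ⥤ Type (u + 1)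

/-- The Yoneda embedding, viewing a scheme as a presheaf. -/
abbrev yon : Scheme.{u} ⥤ Presh.{u} := uliftYoneda.{u + 1}

/-- The class of étale surjective morphisms of schemes. -/
def etaleSurjective : MorphismProperty Scheme.{u} := fun _ _ p => Etale p ∧ Surjective p

/-- An algebraic space: an étale sheaf with representable diagonal and an étale surjection
from a scheme. -/
structure IsAlgebraicSpace (F : Presh.{u}) : Prop where
  isSheaf : Presheaf.IsSheaf Scheme.etaleTopology F
  diag : yon.relativelyRepresentable (Limits.diag F)
  atlas : ∃ (U : Scheme.{u}) (p : yon.obj U ⟶ F),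
    MorphismProperty.relative yon etaleSurjective p

/-- Affine morphisms of presheaves: those that are representable by affine morphisms of
schemes. -/
def IsAffineMor {X S : Presh.{u}} (f : X ⟶ S) : Prop :=
  MorphismProperty.relative yon (@IsAffineHom : MorphismProperty Scheme.{u}) f

lemma IsAffineMor.rep {X S : Presh.{u}} {f : X ⟶ S} (hf : IsAffineMor f) :
    yon.relativelyRepresentable f := hf.1

lemma isAffine_map {Z T : Scheme.{u}} (p : Z ⟶ T) [IsAffineHom p] : IsAffineMor (yon.map p) :=
  MorphismProperty.relative_map (P := @IsAffineHom) ‹_›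

section Rings

/-- The ring `Γ(P, 𝒪_P)` of global functions on a scheme `P` over `Spec R`. -/
def FunctionRing {R : CommRingCat.{u}} {P : Scheme.{u}} (_ : P ⟶ Spec R) : Type u := Γ(P, ⊤)

variable {R R' R'' : CommRingCat.{u}} {P P' P'' : Scheme.{u}}

instance (p : P ⟶ Spec R) : CommRing (FunctionRing p) := inferInstanceAs (CommRing Γ(P, ⊤))

instance (p : P ⟶ Spec R) : Algebra R (FunctionRing p) :=
  ((Scheme.ΓSpecIso R).inv ≫ p.appTop).hom.toAlgebra

/-- The pullback of functions along a morphism. -/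
def FunctionRing.map (p : P ⟶ Spec R) (p' : P' ⟶ Spec R') (m : P' ⟶ P) :
    FunctionRing p →+* FunctionRing p' := m.appTop.hom

lemma FunctionRing.map_comp_algebraMap {p : P ⟶ Spec R} {p' : P' ⟶ Spec R'} (φ : R ⟶ R')
    (m : P' ⟶ P) (h : m ≫ p = p' ≫ Spec.map φ) :
    (FunctionRing.map p p' m).comp (algebraMap R (FunctionRing p)) =
      (algebraMap R' (FunctionRing p')).comp φ.hom := by
  have : ((Scheme.ΓSpecIso R).inv ≫ p.appTop) ≫ m.appTop =
      φ ≫ (Scheme.ΓSpecIso R').inv ≫ p'.appTop := by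
    rw [Category.assoc, ← Scheme.Hom.comp_appTop, h, Scheme.Hom.comp_appTop,
      Scheme.ΓSpecIso_inv_naturality_assoc]
  exact congr(CommRingCat.Hom.hom $this)

variable (d : ℕ)

/-- The `R`-algebra `Γᵈ_R(B)` where `B` is the ring of functions on a scheme over `Spec R`. -/
abbrev GamRing (p : P ⟶ Spec R) : Type u := Gam d R (FunctionRing p)

/-- The homomorphism `Γᵈ_R(B) → Γᵈ_R'(B')` induced by a commutative square. -/
def gamMap {p : P ⟶ Spec R} {p' : P' ⟶ Spec R'} (φ : R ⟶ R')
    (m : P' ⟶ P) (h : m ≫ p = p' ≫ Spec.map φ) : GamRing d p →+* GamRing d p' :=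
  Gam.map φ.hom (FunctionRing.map p p' m) (FunctionRing.map_comp_algebraMap φ m h) d

lemma gamMap_algebraMap {p : P ⟶ Spec R} {p' : P' ⟶ Spec R'} (φ : R ⟶ R')
    (m : P' ⟶ P) (h : m ≫ p = p' ≫ Spec.map φ) (r : R) :
    gamMap d φ m h (algebraMap R _ r) = algebraMap R' _ (φ.hom r) :=
  Gam.map_algebraMap _ _ _ _ _

lemma gamMap_comp {p : P ⟶ Spec R} {p' : P' ⟶ Spec R'} {p'' : P'' ⟶ Spec R''} (φ : R ⟶ R')
    (m : P' ⟶ P) (h : m ≫ p = p' ≫ Spec.map φ) (φ' : R' ⟶ R'')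
    (m' : P'' ⟶ P') (h' : m' ≫ p' = p'' ≫ Spec.map φ') (φ'' : R ⟶ R'')
    (m'' : P'' ⟶ P) (h'' : m'' ≫ p = p'' ≫ Spec.map φ'') (hφ : φ ≫ φ' = φ'')
    (hm : m' ≫ m = m'') (z : GamRing d p) :
    gamMap d φ' m' h' (gamMap d φ m h z) = gamMap d φ'' m'' h'' z := by
  subst hφ hm
  refine Subtype.ext (mapAll_comp _ _ _ _ _ _ _ _ _ rfl ?_ z.1)
  exact congr(CommRingCat.Hom.hom $((Scheme.Hom.comp_appTop m' m).symm))

lemma gamMap_id {p : P ⟶ Spec R} (φ : R ⟶ R) (m : P ⟶ P) (h : m ≫ p = p ≫ Spec.map φ)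
    (hφ : φ = 𝟙 R) (hm : m = 𝟙 P) (z : GamRing d p) : gamMap d φ m h z = z := by
  subst hφ hm
  refine Subtype.ext (mapAll_id _ _ _ rfl ?_ z.1)
  exact congr(CommRingCat.Hom.hom $(Scheme.Hom.id_appTop (X := P)))

end Rings

section Squares
variable {X S X' S' : Presh.{u}} {f : X ⟶ S} {f' : X' ⟶ S'}

/-- The morphism `X' ×_{S'} T' ⟶ X ×_S T` induced by `X' ⟶ X`, `S' ⟶ S` and `T' ⟶ T`. -/
def prodMap (hf' : IsAffineMor f') (hf : IsAffineMor f) (a : X' ⟶ X) (b : S' ⟶ S) (w : a ≫ f = f' ≫ b)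
    {T' T : Scheme.{u}} (s' : yon.obj T' ⟶ S') (s : yon.obj T ⟶ S) (g : T' ⟶ T)
    (h : yon.map g ≫ s = s' ≫ b) : hf'.rep.pullback s' ⟶ hf.rep.pullback s :=
  hf.rep.lift (hf'.rep.fst s' ≫ a) (hf'.rep.snd s' ≫ g)
    (by rw [Category.assoc, w, hf'.rep.w_assoc, Functor.map_comp, Category.assoc, h])

variable (hf' : IsAffineMor f') (hf : IsAffineMor f) (a : X' ⟶ X) (b : S' ⟶ S) (w : a ≫ f = f' ≫ b)
    {T' T : Scheme.{u}} (s' : yon.obj T' ⟶ S') (s : yon.obj T ⟶ S) (g : T' ⟶ T)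
    (h : yon.map g ≫ s = s' ≫ b)

@[simp]
lemma prodMap_fst : yon.map (prodMap hf' hf a b w s' s g h) ≫ hf.rep.fst s =
    hf'.rep.fst s' ≫ a := by
  simp only [prodMap, Functor.relativelyRepresentable.lift_fst]

@[simp]
lemma prodMap_snd : prodMap hf' hf a b w s' s g h ≫ hf.rep.snd s =
    hf'.rep.snd s' ≫ g := by
  simp only [prodMap, Functor.relativelyRepresentable.lift_snd]

@[simp]
lemma prodMap_fst_assoc {W : Presh.{u}} (k : X ⟶ W) :
    yon.map (prodMap hf' hf a b w s' s g h) ≫ hf.rep.fst s ≫ k = hf'.rep.fst s' ≫ a ≫ k := by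
  rw [← Category.assoc, prodMap_fst, Category.assoc]

@[simp]
lemma prodMap_snd_assoc {W : Scheme.{u}} (k : T ⟶ W) :
    prodMap hf' hf a b w s' s g h ≫ hf.rep.snd s ≫ k = hf'.rep.snd s' ≫ g ≫ k := by
  rw [← Category.assoc, prodMap_snd, Category.assoc]

lemma prodMap_comp {X'' S'' : Presh.{u}} {f'' : X'' ⟶ S''} (hf'' : IsAffineMor f'')
    (a' : X'' ⟶ X') (b' : S'' ⟶ S') (w' : a' ≫ f' = f'' ≫ b')
    (a'' : X'' ⟶ X) (b'' : S'' ⟶ S) (w'' : a'' ≫ f = f'' ≫ b'')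
    {T'' : Scheme.{u}} (s'' : yon.obj T'' ⟶ S'') (g' : T'' ⟶ T')
    (h' : yon.map g' ≫ s' = s'' ≫ b') (g'' : T'' ⟶ T) (h'' : yon.map g'' ≫ s = s'' ≫ b'')
    (ha : a' ≫ a = a'') (hg : g' ≫ g = g'') :
    prodMap hf'' hf' a' b' w' s'' s' g' h' ≫ prodMap hf' hf a b w s' s g h =
      prodMap hf'' hf a'' b'' w'' s'' s g'' h'' := by
  subst ha hg
  apply hf.rep.hom_ext
  · simp only [Functor.map_comp, Category.assoc, prodMap_fst, prodMap_fst_assoc]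
  · simp only [Category.assoc, prodMap_snd, prodMap_snd_assoc]

end Squares

section Points
variable {X S : Presh.{u}} {f : X ⟶ S} (d : ℕ)

/-- The homomorphism `Γᵈ_R(B) → Γᵈ_R'(B')` for a homomorphism `R ⟶ R'` of `S`-rings, where
`Spec B = X ×_S Spec R` and `Spec B' = X ×_S Spec R'`. -/
def baseMap (hf : IsAffineMor f) {R R' : CommRingCat.{u}} (φ : R ⟶ R')
    (s : yon.obj (Spec R) ⟶ S) (s' : yon.obj (Spec R') ⟶ S)
    (hs : yon.map (Spec.map φ) ≫ s = s') :
    GamRing d (hf.rep.snd s) →+* GamRing d (hf.rep.snd s') :=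
  gamMap d φ (prodMap hf hf (𝟙 X) (𝟙 S) (by simp) s' s (Spec.map φ) (by simpa using hs))
    (prodMap_snd ..)

/-- For `X/S` affine, a morphism from a scheme `T` to the relative spectrum `Γᵈ(X/S)` of
`Γᵈ(f_* 𝒪_X)`: a morphism `T ⟶ S` and, for every morphism `g : Spec R ⟶ T`, with
`Spec B = X ×_S Spec R`, an `R`-algebra homomorphism `Γᵈ_R(B) → R`, compatible with changing `R`.
(The argument `s` of `app` is the composite `Spec R ⟶ T ⟶ S`.) -/
structure GammaPoint (hf : IsAffineMor f) (T : Scheme.{u}) where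
  base : yon.obj T ⟶ S
  app {R : CommRingCat.{u}} (s : yon.obj (Spec R) ⟶ S) (g : Spec R ⟶ T)
    (h : yon.map g ≫ base = s) : GamRing d (hf.rep.snd s) →+* R
  app_algebraMap {R : CommRingCat.{u}} (s : yon.obj (Spec R) ⟶ S) (g : Spec R ⟶ T)
    (h : yon.map g ≫ base = s) (r : R) : app s g h (algebraMap R _ r) = r
  app_baseMap {R R' : CommRingCat.{u}} (φ : R ⟶ R') (s : yon.obj (Spec R) ⟶ S)
    (s' : yon.obj (Spec R') ⟶ S) (hs : yon.map (Spec.map φ) ≫ s = s') (g : Spec R ⟶ T)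
    (h : yon.map g ≫ base = s) (g' : Spec R' ⟶ T) (h' : yon.map g' ≫ base = s')
    (hg : Spec.map φ ≫ g = g') (z : GamRing d (hf.rep.snd s)) :
    app s' g' h' (baseMap d hf φ s s' hs z) = φ.hom (app s g h z)

variable {d}

lemma GammaPoint.ext' {hf : IsAffineMor f} {T : Scheme.{u}} {x y : GammaPoint d hf T}
    (hb : x.base = y.base)
    (h : ∀ (R : CommRingCat.{u}) (s : yon.obj (Spec R) ⟶ S) (g : Spec R ⟶ T)
      (h₁ : yon.map g ≫ x.base = s) (h₂ : yon.map g ≫ y.base = s) (z),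
      x.app s g h₁ z = y.app s g h₂ z) : x = y := by
  obtain ⟨b, x, _, _⟩ := x
  obtain ⟨b', y, _, _⟩ := y
  obtain rfl : b = b' := hb
  congr
  funext R s g h₁
  exact RingHom.ext fun z => h R s g h₁ h₁ z

lemma GammaPoint.app_congr {hf : IsAffineMor f} {T : Scheme.{u}} (x : GammaPoint d hf T)
    {R : CommRingCat.{u}} {s : yon.obj (Spec R) ⟶ S} {g g' : Spec R ⟶ T} (hg : g = g')
    (h : yon.map g ≫ x.base = s) (h' : yon.map g' ≫ x.base = s) (z) :
    x.app s g h z = x.app s g' h' z := by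
  subst hg; rfl

/-- Restriction of points of `Γᵈ(X/S)` along `T' ⟶ T`. -/
def GammaPoint.restrict {hf : IsAffineMor f} {T T' : Scheme.{u}} (x : GammaPoint d hf T)
    (g₀ : T' ⟶ T) : GammaPoint d hf T' where
  base := yon.map g₀ ≫ x.base
  app s g h := x.app s (g ≫ g₀) (by simpa using h)
  app_algebraMap s g h r := x.app_algebraMap ..
  app_baseMap φ s s' hs g h g' h' hg z := x.app_baseMap _ _ _ _ _ _ _ _ (by simp [← hg]) _

variable (d)

/-- The `S`-space `Γᵈ(X/S)`, for `X/S` affine, given by its functor of points: it is the relative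
spectrum of the `𝒪_S`-algebra `Γᵈ(f_* 𝒪_X)`. -/
def gammaSpace (hf : IsAffineMor f) : Presh.{u} where
  obj T := GammaPoint d hf T.unop
  map g := ↾fun x => x.restrict g.unop
  map_id T := by
    ext x
    exact GammaPoint.ext' (show yon.map (𝟙 _) ≫ x.base = x.base by simp)
      (fun R s g h₁ h₂ z => x.app_congr (Category.comp_id g) ..)
  map_comp g g' := by
    ext x
    exact GammaPoint.ext'
      (show yon.map (g'.unop ≫ g.unop) ≫ x.base = yon.map g'.unop ≫ yon.map g.unop ≫ x.base by simp)
      (fun R s k h₁ h₂ z => x.app_congr (Category.assoc k g'.unop g.unop).symm ..)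

/-- The structure morphism `Γᵈ(X/S) ⟶ S`. -/
def gammaSpace.π (hf : IsAffineMor f) : gammaSpace d hf ⟶ S where
  app T := ↾fun x => uliftYonedaEquiv x.base
  naturality T T' g := by
    ext x
    exact (uliftYonedaEquiv_naturality _ _).symm

end Points

section Functoriality
variable {X S X' S' : Presh.{u}} {f : X ⟶ S} {f' : X' ⟶ S'} (d : ℕ)

/-- The homomorphism `Γᵈ_R(B) → Γᵈ_R(B')` where `Spec B = X ×_S Spec R` and
`Spec B' = X' ×_S' Spec R`. -/
def squareMap (hf' : IsAffineMor f') (hf : IsAffineMor f) (a : X' ⟶ X) (b : S' ⟶ S)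
    (w : a ≫ f = f' ≫ b) {R : CommRingCat.{u}} (s' : yon.obj (Spec R) ⟶ S')
    (s : yon.obj (Spec R) ⟶ S) (hs : s = s' ≫ b) :
    GamRing d (hf.rep.snd s) →+* GamRing d (hf'.rep.snd s') :=
  gamMap d (𝟙 R) (prodMap hf' hf a b w s' s (𝟙 _) (by simp [hs])) (by simp)

lemma squareMap_baseMap (hf' : IsAffineMor f') (hf : IsAffineMor f) (a : X' ⟶ X) (b : S' ⟶ S)
    (w : a ≫ f = f' ≫ b) {R R' : CommRingCat.{u}} (φ : R ⟶ R')
    (s : yon.obj (Spec R) ⟶ S) (s₁ : yon.obj (Spec R') ⟶ S) (s' : yon.obj (Spec R) ⟶ S')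
    (s₁' : yon.obj (Spec R') ⟶ S') (hs : s = s' ≫ b) (hs₁ : s₁ = s₁' ≫ b)
    (h : yon.map (Spec.map φ) ≫ s = s₁) (h' : yon.map (Spec.map φ) ≫ s' = s₁') (z) :
    squareMap d hf' hf a b w s₁' s₁ hs₁ (baseMap d hf φ s s₁ h z) =
      baseMap d hf' φ s' s₁' h' (squareMap d hf' hf a b w s' s hs z) := by
  simp only [squareMap, baseMap]
  rw [gamMap_comp d _ _ _ _ _ _ φ (prodMap hf' hf a b w s₁' s (Spec.map φ)
      (by simp [h, hs₁])) (by simp) (by simp)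
      (prodMap_comp _ _ _ _ _ _ _ _ _ _ _ _ _ _ _ _ _ _ _ _ _ (by simp) (by simp)),
    gamMap_comp d _ _ _ _ _ _ φ (prodMap hf' hf a b w s₁' s (Spec.map φ)
      (by simp [h, hs₁])) (by simp) (by simp)
      (prodMap_comp _ _ _ _ _ _ _ _ _ _ _ _ _ _ _ _ _ _ _ _ _ (by simp) (by simp))]

variable {d}

/-- The map on points induced by `Γᵈ(X'/S') ⟶ Γᵈ(X/S)`. -/
def GammaPoint.push {hf' : IsAffineMor f'} (hf : IsAffineMor f) (a : X' ⟶ X) (b : S' ⟶ S)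
    (w : a ≫ f = f' ≫ b) {T : Scheme.{u}} (x : GammaPoint d hf' T) : GammaPoint d hf T where
  base := x.base ≫ b
  app {R} s g h := (x.app (yon.map g ≫ x.base) g rfl).comp
    (squareMap d hf' hf a b w _ s (by simp [← h]))
  app_algebraMap s g h r := by
    simp only [squareMap, RingHom.comp_apply, gamMap_algebraMap]
    exact x.app_algebraMap ..
  app_baseMap {R R'} φ s s' hs g h g' h' hg z := by
    have e : yon.map (Spec.map φ) ≫ yon.map g ≫ x.base = yon.map g' ≫ x.base := by
      simp [← hg]
    simp only [RingHom.comp_apply]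
    rw [← x.app_baseMap φ _ _ e g rfl g' rfl hg, squareMap_baseMap]

lemma GammaPoint.push_app {hf' : IsAffineMor f'} (hf : IsAffineMor f) (a : X' ⟶ X) (b : S' ⟶ S)
    (w : a ≫ f = f' ≫ b) {T : Scheme.{u}} (x : GammaPoint d hf' T) {R : CommRingCat.{u}}
    (s : yon.obj (Spec R) ⟶ S) (g : Spec R ⟶ T) (h) (s' : yon.obj (Spec R) ⟶ S')
    (h' : yon.map g ≫ x.base = s') (hs : s = s' ≫ b) (z) :
    (x.push hf a b w).app s g h z = x.app s' g h' (squareMap d hf' hf a b w s' s hs z) := by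
  subst h'; rfl

lemma GammaPoint.push_restrict {hf' : IsAffineMor f'} (hf : IsAffineMor f) (a : X' ⟶ X) (b : S' ⟶ S)
    (w : a ≫ f = f' ≫ b) {T T' : Scheme.{u}} (x : GammaPoint d hf' T) (g : T' ⟶ T) :
    (x.restrict g).push hf a b w = (x.push hf a b w).restrict g := by
  refine GammaPoint.ext' (Category.assoc _ _ _) fun R s k h₁ h₂ z => ?_
  rw [push_app hf a b w _ s k h₁ (yon.map k ≫ yon.map g ≫ x.base) rfl (by rw [← h₁]; simp [push, restrict])]
  exact (push_app hf a b w x s (k ≫ g) (by rw [← h₂]; simp [push, restrict]) _ (by simp) _ z).symm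

lemma GammaPoint.push_push (hf' : IsAffineMor f') (hf : IsAffineMor f) (a : X' ⟶ X) (b : S' ⟶ S)
    (w : a ≫ f = f' ≫ b) {X'' S'' : Presh.{u}} {f'' : X'' ⟶ S''} (hf'' : IsAffineMor f'')
    (a' : X'' ⟶ X') (b' : S'' ⟶ S') (w' : a' ≫ f' = f'' ≫ b')
    (a'' : X'' ⟶ X) (b'' : S'' ⟶ S) (w'' : a'' ≫ f = f'' ≫ b'')
    (ha : a' ≫ a = a'') (hb : b' ≫ b = b'') {T : Scheme.{u}} (x : GammaPoint d hf'' T) :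
    (x.push hf' a' b' w').push hf a b w = x.push hf a'' b'' w'' := by
  subst ha hb
  refine ext' (Category.assoc _ _ _) fun R s g h₁ h₂ z => ?_
  have h₁' : yon.map g ≫ x.base ≫ b' ≫ b = s := by simpa [push] using h₁
  have e : yon.map g ≫ (x.push hf' a' b' w').base = (yon.map g ≫ x.base) ≫ b' := by simp [push]
  rw [push_app hf a b w _ s g h₁ ((yon.map g ≫ x.base) ≫ b') e (by simp [← h₁']),
    push_app hf' a' b' w' x _ g e _ rfl rfl,
    push_app hf _ _ w'' x s g _ _ rfl (by simp [← h₁'])]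
  congr 1
  exact gamMap_comp d _ _ _ _ _ _ _ _ _ (by simp)
    (prodMap_comp _ _ _ _ _ _ _ _ _ _ _ _ _ _ _ _ _ _ _ _ _ rfl (by simp)) _

variable (d)

/-- The morphism `Γᵈ(X'/S') ⟶ Γᵈ(X/S)` induced by a commutative square. -/
def gammaSpace.map (hf' : IsAffineMor f') (hf : IsAffineMor f) (a : X' ⟶ X) (b : S' ⟶ S)
    (w : a ≫ f = f' ≫ b) : gammaSpace d hf' ⟶ gammaSpace d hf where
  app T := ↾fun x => x.push hf a b w
  naturality T T' g := by
    ext x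
    exact GammaPoint.push_restrict ..

@[simp]
lemma gammaSpace.map_π (hf' : IsAffineMor f') (hf : IsAffineMor f) (a : X' ⟶ X) (b : S' ⟶ S)
    (w : a ≫ f = f' ≫ b) : map d hf' hf a b w ≫ π d hf = π d hf' ≫ b := by
  ext T x
  exact uliftYonedaEquiv_comp _ _

lemma gammaSpace.map_comp (hf' : IsAffineMor f') (hf : IsAffineMor f) (a : X' ⟶ X) (b : S' ⟶ S)
    (w : a ≫ f = f' ≫ b) {X'' S'' : Presh.{u}} {f'' : X'' ⟶ S''} (hf'' : IsAffineMor f'')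
    (a' : X'' ⟶ X') (b' : S'' ⟶ S') (w' : a' ≫ f' = f'' ≫ b')
    (a'' : X'' ⟶ X) (b'' : S'' ⟶ S) (w'' : a'' ≫ f = f'' ≫ b'')
    (ha : a' ≫ a = a'') (hb : b' ≫ b = b'') :
    map d hf'' hf' a' b' w' ≫ map d hf' hf a b w = map d hf'' hf a'' b'' w'' := by
  ext T x
  exact GammaPoint.push_push hf' hf a b w hf'' a' b' w' a'' b'' w'' ha hb x

variable {d}

section Cartesian
variable (hf' : IsAffineMor f') (hf : IsAffineMor f) {a : X' ⟶ X} {b : S' ⟶ S}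
    (hP : IsPullback a f' f b)

/-- For a cartesian square, the inverse of `X' ×_{S'} T ⟶ X ×_S T`. -/
def prodInv {T : Scheme.{u}} (s' : yon.obj T ⟶ S') (s : yon.obj T ⟶ S) (hs : s = s' ≫ b) :
    hf.rep.pullback s ⟶ hf'.rep.pullback s' :=
  hf'.rep.lift (hP.lift (hf.rep.fst s) (yon.map (hf.rep.snd s) ≫ s')
    (by rw [hf.rep.w, hs, Category.assoc])) (hf.rep.snd s) (by simp)

@[simp]
lemma prodInv_snd {T : Scheme.{u}} (s' : yon.obj T ⟶ S') (s : yon.obj T ⟶ S) (hs : s = s' ≫ b) :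
    prodInv hf' hf hP s' s hs ≫ hf'.rep.snd s' = hf.rep.snd s := by simp [prodInv]

@[simp]
lemma prodInv_fst {T : Scheme.{u}} (s' : yon.obj T ⟶ S') (s : yon.obj T ⟶ S) (hs : s = s' ≫ b) :
    yon.map (prodInv hf' hf hP s' s hs) ≫ hf'.rep.fst s' ≫ a = hf.rep.fst s := by
  simp [prodInv]

@[simp]
lemma prodInv_prodMap {T : Scheme.{u}} (s' : yon.obj T ⟶ S') (s : yon.obj T ⟶ S)
    (hs : s = s' ≫ b) (g : T ⟶ T) (hg : g = 𝟙 T) (h) :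
    prodInv hf' hf hP s' s hs ≫ prodMap hf' hf a b hP.w s' s g h = 𝟙 _ := by
  subst hg
  apply hf.rep.hom_ext
  · simp
  · simp

@[simp]
lemma prodMap_prodInv {T : Scheme.{u}} (s' : yon.obj T ⟶ S') (s : yon.obj T ⟶ S)
    (hs : s = s' ≫ b) (g : T ⟶ T) (hg : g = 𝟙 T) (h) :
    prodMap hf' hf a b hP.w s' s g h ≫ prodInv hf' hf hP s' s hs = 𝟙 _ := by
  subst hg
  apply hf'.rep.hom_ext
  · apply hP.hom_ext
    · simp
    · rw [Category.assoc, Category.assoc, hf'.rep.w, ← Functor.map_comp_assoc,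
        ← Functor.map_comp_assoc]
      simp
  · simp

/-- The homomorphism inverse to `squareMap`, for a cartesian square. -/
def squareInv {R : CommRingCat.{u}} (s' : yon.obj (Spec R) ⟶ S')
    (s : yon.obj (Spec R) ⟶ S) (hs : s = s' ≫ b) :
    GamRing d (hf'.rep.snd s') →+* GamRing d (hf.rep.snd s) :=
  gamMap d (𝟙 R) (prodInv hf' hf hP s' s hs) (by simp)

lemma squareMap_squareInv {R : CommRingCat.{u}} (s' : yon.obj (Spec R) ⟶ S')
    (s : yon.obj (Spec R) ⟶ S) (hs : s = s' ≫ b) (z) :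
    squareMap d hf' hf a b hP.w s' s hs (squareInv hf' hf hP s' s hs z) = z := by
  rw [squareMap, squareInv, gamMap_comp d _ _ _ _ _ _ (𝟙 R) (𝟙 _) (by simp) (by simp)
    (prodMap_prodInv _ _ _ _ _ _ _ rfl _), gamMap_id _ _ _ _ rfl rfl]

lemma squareInv_squareMap {R : CommRingCat.{u}} (s' : yon.obj (Spec R) ⟶ S')
    (s : yon.obj (Spec R) ⟶ S) (hs : s = s' ≫ b) (z) :
    squareInv hf' hf hP s' s hs (squareMap d hf' hf a b hP.w s' s hs z) = z := by
  rw [squareMap, squareInv, gamMap_comp d _ _ _ _ _ _ (𝟙 R) (𝟙 _) (by simp) (by simp)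
    (prodInv_prodMap _ _ _ _ _ _ _ rfl _), gamMap_id _ _ _ _ rfl rfl]

/-- The unique point of `Γᵈ(X'/S')` over given points of `Γᵈ(X/S)` and `S'`, for a cartesian
square. -/
def GammaPoint.lift {T : Scheme.{u}} (x : GammaPoint d hf T) (t : yon.obj T ⟶ S')
    (e : x.base = t ≫ b) : GammaPoint d hf' T where
  base := t
  app s g h := (x.app (s ≫ b) g (by rw [e, ← h, Category.assoc])).comp
    (squareInv hf' hf hP s (s ≫ b) rfl)
  app_algebraMap s g h r := by
    simp only [squareInv, RingHom.comp_apply, gamMap_algebraMap]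
    exact x.app_algebraMap ..
  app_baseMap {R R'} φ s s' hs g h g' h' hg z := by
    simp only [RingHom.comp_apply]
    rw [← x.app_baseMap φ _ (s' ≫ b) (by rw [← hs, Category.assoc]) g _ g'
      (by rw [e, ← h', Category.assoc]) hg]
    congr 1
    conv_lhs => rw [← squareMap_squareInv hf' hf hP s (s ≫ b) rfl z]
    rw [← squareMap_baseMap d hf' hf a b hP.w φ (s ≫ b) (s' ≫ b) s s' rfl rfl
      (by rw [← hs, Category.assoc]) hs, squareInv_squareMap]

lemma GammaPoint.push_lift {T : Scheme.{u}} (x : GammaPoint d hf T) (t : yon.obj T ⟶ S')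
    (e : x.base = t ≫ b) : (x.lift hf' hf hP t e).push hf a b hP.w = x := by
  refine GammaPoint.ext' e.symm fun R s g h₁ h₂ z => ?_
  obtain rfl : s = (yon.map g ≫ t) ≫ b := by rw [← h₂, e, Category.assoc]
  rw [push_app hf a b hP.w _ _ g _ (yon.map g ≫ t) rfl rfl]
  simp only [lift, RingHom.comp_apply, squareInv_squareMap]

lemma GammaPoint.ext_of_isPullback {T : Scheme.{u}} {x y : GammaPoint d hf' T}
    (hb : x.base = y.base) (h : x.push hf a b hP.w = y.push hf a b hP.w) : x = y := by
  refine ext' hb fun R s g h₁ h₂ z => ?_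
  rw [← squareMap_squareInv hf' hf hP s (s ≫ b) rfl z,
    ← push_app hf a b hP.w x (s ≫ b) g (by simp [push, ← h₁]),
    ← push_app hf a b hP.w y (s ≫ b) g (by simp [push, ← h₂])]
  have : ∀ (p q : GammaPoint d hf T) (_ : p = q) (h₁) (h₂) (z),
      p.app (s ≫ b) g h₁ z = q.app (s ≫ b) g h₂ z := by
    rintro p _ rfl _ _ _; rfl
  exact this _ _ h _ _ _

end Cartesian

end Functoriality

section Lift
variable {X S X' S' : Presh.{u}} {f : X ⟶ S} {f' : X' ⟶ S'} {d : ℕ}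
  (hf' : IsAffineMor f') (hf : IsAffineMor f) {a : X' ⟶ X} {b : S' ⟶ S}
  (hP : IsPullback a f' f b) {T : Scheme.{u}}

/-- The point of `Γᵈ(X/S)` corresponding to a morphism `T ⟶ Γᵈ(X/S)`. -/
def toPoint {hf : IsAffineMor f} (x : yon.obj T ⟶ gammaSpace d hf) : GammaPoint d hf T :=
  uliftYonedaEquiv x

lemma toPoint_base {hf : IsAffineMor f} (x : yon.obj T ⟶ gammaSpace d hf) :
    (toPoint x).base = x ≫ gammaSpace.π d hf :=
  uliftYonedaEquiv.injective (uliftYonedaEquiv_comp x (gammaSpace.π d hf)).symm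

lemma toPoint_comp_map (w : a ≫ f = f' ≫ b) {hf' : IsAffineMor f'}
    (x : yon.obj T ⟶ gammaSpace d hf') :
    toPoint (x ≫ gammaSpace.map d hf' hf a b w) = (toPoint x).push hf a b w :=
  uliftYonedaEquiv_comp x _

/-- For a cartesian square, the morphism to `Γᵈ(X'/S')` determined by morphisms to `Γᵈ(X/S)`
and `S'`. -/
def gammaSpace.lift (x : yon.obj T ⟶ gammaSpace d hf) (t : yon.obj T ⟶ S')
    (e : x ≫ π d hf = t ≫ b) : yon.obj T ⟶ gammaSpace d hf' :=
  uliftYonedaEquiv.symm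
    ((toPoint x).lift hf' hf hP t ((toPoint_base x).trans e) : GammaPoint d hf' T)

lemma toPoint_lift (x : yon.obj T ⟶ gammaSpace d hf) (t : yon.obj T ⟶ S')
    (e : x ≫ gammaSpace.π d hf = t ≫ b) :
    toPoint (gammaSpace.lift hf' hf hP x t e) =
      (toPoint x).lift hf' hf hP t ((toPoint_base x).trans e) :=
  Equiv.apply_symm_apply _ _

lemma toPoint_injective {hf : IsAffineMor f} :
    Function.Injective (toPoint : (yon.obj T ⟶ gammaSpace d hf) → _) :=
  uliftYonedaEquiv.injective

@[simp]
lemma gammaSpace.lift_map (x : yon.obj T ⟶ gammaSpace d hf) (t : yon.obj T ⟶ S')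
    (e : x ≫ π d hf = t ≫ b) : lift hf' hf hP x t e ≫ map d hf' hf a b hP.w = x := by
  apply toPoint_injective
  rw [toPoint_comp_map, toPoint_lift, GammaPoint.push_lift]

@[simp]
lemma gammaSpace.lift_π (x : yon.obj T ⟶ gammaSpace d hf) (t : yon.obj T ⟶ S')
    (e : x ≫ π d hf = t ≫ b) : lift hf' hf hP x t e ≫ π d hf' = t := by
  rw [← toPoint_base, toPoint_lift]
  rfl

lemma gammaSpace.hom_ext {x y : yon.obj T ⟶ gammaSpace d hf'}
    (h₁ : x ≫ map d hf' hf a b hP.w = y ≫ map d hf' hf a b hP.w)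
    (h₂ : x ≫ π d hf' = y ≫ π d hf') : x = y := by
  apply toPoint_injective
  refine GammaPoint.ext_of_isPullback hf' hf hP ?_ ?_
  · rw [toPoint_base, toPoint_base, h₂]
  · rw [← toPoint_comp_map, ← toPoint_comp_map, h₁]

end Lift

section Family
variable {X S : Presh.{u}} {f : X ⟶ S} (d : ℕ)

/-- A family of zero cycles of degree `d` on `X ×_S T` over an `S`-scheme `T`, for `X/S` affine:
a closed subscheme `Z` of `X ×_S T` (given by a closed immersion `i`) which is integral over `T`,
together with a morphism `α : T ⟶ Γᵈ(Z/T)` over `T`. -/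
structure Family (hf : IsAffineMor f) {T : Scheme.{u}} (t : yon.obj T ⟶ S) where
  Z : Scheme.{u}
  i : Z ⟶ hf.rep.pullback t
  isClosedImmersion : IsClosedImmersion i
  isIntegral : IsIntegralHom (i ≫ hf.rep.snd t)
  α : yon.obj T ⟶ gammaSpace d (isAffine_map (i ≫ hf.rep.snd t))
  α_π : α ≫ gammaSpace.π d _ = 𝟙 (yon.obj T)

namespace Family
attribute [instance] isClosedImmersion isIntegral
variable {d} {hf : IsAffineMor f} {T T' T'' : Scheme.{u}} {t : yon.obj T ⟶ S} {t' : yon.obj T' ⟶ S}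
  {t'' : yon.obj T'' ⟶ S}

/-- The structure morphism `Z ⟶ T`. -/
abbrev p (ξ : Family d hf t) : ξ.Z ⟶ T := ξ.i ≫ hf.rep.snd t

lemma isAffine_p (ξ : Family d hf t) : IsAffineMor (yon.map ξ.p) := isAffine_map ξ.p

/-- `ξ₀ ≤ ξ`: the closed subscheme `Z₀` of `X ×_S T` is contained in `Z`, and `α` is the composite
`T ⟶ Γᵈ(Z₀/T) ⟶ Γᵈ(Z/T)` of `α₀` and the induced morphism. -/
def IsRestriction (ξ₀ ξ : Family d hf t) : Prop :=
  ∃ (j : ξ₀.Z ⟶ ξ.Z) (hj : j ≫ ξ.i = ξ₀.i),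
    ξ₀.α ≫ gammaSpace.map d ξ₀.isAffine_p ξ.isAffine_p (yon.map j) (𝟙 _)
      (by simp [p, ← hj, ← Functor.map_comp]) = ξ.α

/-- Two families `(Z₁, α₁)` and `(Z₂, α₂)` are equivalent if `α₁` and `α₂` come from a common
closed subscheme of `Z₁` and `Z₂`. -/
def Equivalent (ξ₁ ξ₂ : Family d hf t) : Prop :=
  ∃ ξ₀ : Family d hf t, ξ₀.IsRestriction ξ₁ ∧ ξ₀.IsRestriction ξ₂

/-- The morphism `X ×_S T' ⟶ X ×_S T`. -/
def baseChange (hf : IsAffineMor f) (t : yon.obj T ⟶ S) (t' : yon.obj T' ⟶ S) (g : T' ⟶ T)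
    (hg : yon.map g ≫ t = t') : hf.rep.pullback t' ⟶ hf.rep.pullback t :=
  hf.rep.lift (hf.rep.fst t') (hf.rep.snd t' ≫ g) (by simp [hf.rep.w, hg])

@[simp]
lemma baseChange_snd (g : T' ⟶ T) (hg : yon.map g ≫ t = t') :
    baseChange hf t t' g hg ≫ hf.rep.snd t = hf.rep.snd t' ≫ g := by simp [baseChange]

@[simp]
lemma baseChange_fst (g : T' ⟶ T) (hg : yon.map g ≫ t = t') :
    yon.map (baseChange hf t t' g hg) ≫ hf.rep.fst t = hf.rep.fst t' := by simp [baseChange]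

@[simp]
lemma baseChange_snd_assoc (g : T' ⟶ T) (hg : yon.map g ≫ t = t') {W : Scheme.{u}} (k : T ⟶ W) :
    baseChange hf t t' g hg ≫ hf.rep.snd t ≫ k = hf.rep.snd t' ≫ g ≫ k := by
  rw [← Category.assoc, baseChange_snd, Category.assoc]

@[simp]
lemma baseChange_fst_assoc (g : T' ⟶ T) (hg : yon.map g ≫ t = t') {W : Presh.{u}} (k : X ⟶ W) :
    yon.map (baseChange hf t t' g hg) ≫ hf.rep.fst t ≫ k = hf.rep.fst t' ≫ k := by
  rw [← Category.assoc, baseChange_fst]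

lemma isPullback_baseChange (g : T' ⟶ T) (hg : yon.map g ≫ t = t') :
    IsPullback (baseChange hf t t' g hg) (hf.rep.snd t') (hf.rep.snd t) g := by
  refine IsPullback.of_map yon (baseChange_snd g hg) ?_
  refine IsPullback.of_right ?_ ?_ (hf.rep.isPullback t)
  · rw [baseChange_fst, hg]
    exact hf.rep.isPullback t'
  · rw [← Functor.map_comp, baseChange_snd, Functor.map_comp]

lemma isPullback_pullback (ξ : Family d hf t) (g : T' ⟶ T) (hg : yon.map g ≫ t = t') :
    IsPullback (pullback.fst ξ.i (baseChange hf t t' g hg))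
      (pullback.snd ξ.i (baseChange hf t t' g hg) ≫ hf.rep.snd t') ξ.p g :=
  (IsPullback.of_hasPullback _ _).paste_vert (isPullback_baseChange g hg)

/-- The pull-back of a family along a morphism `T' ⟶ T` of `S`-schemes: `Z' = Z ×_T T'` (computed
as the inverse image of `Z` in `X ×_S T'`), and `α'` is the base change of `α`. -/
def pullback (ξ : Family d hf t) (g : T' ⟶ T) (hg : yon.map g ≫ t = t') : Family d hf t' where
  Z := Limits.pullback ξ.i (baseChange hf t t' g hg)
  i := pullback.snd _ _
  isClosedImmersion := inferInstance
  isIntegral := MorphismProperty.of_isPullback (P := @IsIntegralHom)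
    (ξ.isPullback_pullback g hg) ξ.isIntegral
  α := gammaSpace.lift _ ξ.isAffine_p ((ξ.isPullback_pullback g hg).map yon) (yon.map g ≫ ξ.α) (𝟙 _)
    (by rw [Category.assoc, ξ.α_π, Category.comp_id, Category.id_comp])
  α_π := gammaSpace.lift_π ..

section
variable (ξ ξ₀ : Family d hf t) (g : T' ⟶ T) (hg : yon.map g ≫ t = t')

/-- The projection `Z ×_T T' ⟶ Z`. -/
def proj : (ξ.pullback g hg).Z ⟶ ξ.Z := pullback.fst _ _

lemma isPullback_proj : IsPullback (ξ.proj g hg) (ξ.pullback g hg).p ξ.p g :=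
  ξ.isPullback_pullback g hg

lemma isPullback_proj_i : IsPullback (ξ.proj g hg) (ξ.pullback g hg).i ξ.i
    (baseChange hf t t' g hg) := IsPullback.of_hasPullback _ _

lemma pullback_α_map (w) :
    (ξ.pullback g hg).α ≫ gammaSpace.map d (ξ.pullback g hg).isAffine_p ξ.isAffine_p
      (yon.map (ξ.proj g hg)) (yon.map g) w = yon.map g ≫ ξ.α :=
  gammaSpace.lift_map _ _ ((ξ.isPullback_pullback g hg).map yon) _ _
    (by rw [Category.assoc, ξ.α_π, Category.comp_id, Category.id_comp])

lemma pullback_α_map_assoc (w) {W : Presh.{u}} (k : gammaSpace d ξ.isAffine_p ⟶ W) :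
    (ξ.pullback g hg).α ≫ gammaSpace.map d (ξ.pullback g hg).isAffine_p ξ.isAffine_p
      (yon.map (ξ.proj g hg)) (yon.map g) w ≫ k = yon.map g ≫ ξ.α ≫ k := by
  rw [← Category.assoc, pullback_α_map, Category.assoc]

variable {ξ ξ₀ g hg}

/-- To recognize a pulled back family it suffices to map to the original one. -/
lemma isRestriction_pullback (ξ' : Family d hf t') (j : ξ'.Z ⟶ ξ.Z)
    (hj : j ≫ ξ.i = ξ'.i ≫ baseChange hf t t' g hg) (w)
    (hα : ξ'.α ≫ gammaSpace.map d ξ'.isAffine_p ξ.isAffine_p (yon.map j) (yon.map g) w =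
      yon.map g ≫ ξ.α) : ξ'.IsRestriction (ξ.pullback g hg) := by
  refine ⟨(ξ.isPullback_proj_i g hg).lift j ξ'.i hj, by simp, ?_⟩
  refine gammaSpace.hom_ext _ ξ.isAffine_p ((ξ.isPullback_proj g hg).map yon) ?_ ?_
  · rw [Category.assoc, gammaSpace.map_comp d _ _ _ _ _ _ _ _ _ (yon.map j) (yon.map g) w
      (by rw [← Functor.map_comp, IsPullback.lift_fst]) (by simp), hα]
    exact (ξ.pullback_α_map g hg _).symm
  · rw [Category.assoc, gammaSpace.map_π, Category.comp_id, ξ'.α_π, α_π]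

variable (g hg) in
lemma IsRestriction.pullback (h : ξ₀.IsRestriction ξ) :
    (ξ₀.pullback g hg).IsRestriction (ξ.pullback g hg) := by
  obtain ⟨j, hj, hα⟩ := h
  have e : (ξ₀.proj g hg ≫ j) ≫ ξ.i = (ξ₀.pullback g hg).i ≫ baseChange hf t t' g hg := by
    rw [Category.assoc, hj, (ξ₀.isPullback_proj_i g hg).w]
  have w : yon.map (ξ₀.proj g hg ≫ j) ≫ yon.map ξ.p = yon.map (ξ₀.pullback g hg).p ≫ yon.map g := by
    rw [← Functor.map_comp, ← Functor.map_comp, p, ← Category.assoc, e, Category.assoc,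
      baseChange_snd, p, Category.assoc]
  refine isRestriction_pullback _ _ e w ?_
  rw [← hα, ← ξ₀.pullback_α_map_assoc g hg, gammaSpace.map_comp]
  · simp
  · simp
  · rw [← Functor.map_comp, ← Functor.map_comp, (ξ₀.isPullback_proj _ _).w]

lemma Equivalent.pullback {ξ₁ ξ₂ : Family d hf t} (h : ξ₁.Equivalent ξ₂) (g : T' ⟶ T)
    (hg : yon.map g ≫ t = t') : (ξ₁.pullback g hg).Equivalent (ξ₂.pullback g hg) := by
  obtain ⟨ξ₀, h₁, h₂⟩ := h
  exact ⟨ξ₀.pullback g hg, h₁.pullback g hg, h₂.pullback g hg⟩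

lemma IsRestriction.refl (ξ : Family d hf t) : ξ.IsRestriction ξ := by
  refine ⟨𝟙 _, by simp, gammaSpace.hom_ext ξ.isAffine_p ξ.isAffine_p
    (a := yon.map (𝟙 _)) (b := 𝟙 _) (f := yon.map ξ.p) (f' := yon.map ξ.p)
    (by simpa using IsPullback.id_horiz (yon.map ξ.p)) ?_ ?_⟩
  · rw [Category.assoc, gammaSpace.map_comp] <;> simp
  · simp

lemma IsRestriction.equivalent (h : ξ₀.IsRestriction ξ) : ξ₀.Equivalent ξ :=
  ⟨ξ₀, .refl _, h⟩

end

lemma pullback_id (ξ : Family d hf t) (g : T ⟶ T) (h : g = 𝟙 T) (hg) :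
    (ξ.pullback g hg).Equivalent ξ := by
  subst h
  apply IsRestriction.equivalent
  refine ⟨ξ.proj _ _, ?_, ?_⟩
  · rw [(ξ.isPullback_proj_i _ _).w]
    have : baseChange hf t t (𝟙 T) hg = 𝟙 _ := hf.rep.hom_ext (by simp) (by simp)
    rw [this, Category.comp_id]
  · have := ξ.pullback_α_map (𝟙 T) hg (by
      rw [← Functor.map_comp, ← Functor.map_comp, (ξ.isPullback_proj _ _).w])
    simpa using this

lemma pullback_comp (ξ : Family d hf t) (g : T' ⟶ T) (hg : yon.map g ≫ t = t') (g' : T'' ⟶ T')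
    (hg' : yon.map g' ≫ t' = t'') (g'' : T'' ⟶ T) (h : g'' = g' ≫ g) (hg'' : yon.map g'' ≫ t = t'') :
    (ξ.pullback g'' hg'').Equivalent ((ξ.pullback g hg).pullback g' hg') := by
  subst h
  apply IsRestriction.equivalent
  have e : baseChange hf t' t'' g' hg' ≫ baseChange hf t t' g hg = baseChange hf t t'' (g' ≫ g) hg'' :=
    hf.rep.hom_ext (by simp) (by simp)
  have ej : (ξ.pullback (g' ≫ g) hg'').i ≫ baseChange hf t' t'' g' hg' ≫ baseChange hf t t' g hg =
      ξ.proj (g' ≫ g) hg'' ≫ ξ.i := by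
    rw [e, (ξ.isPullback_proj_i _ _).w]
  let j := (ξ.isPullback_proj_i g hg).lift (ξ.proj (g' ≫ g) hg'')
    ((ξ.pullback (g' ≫ g) hg'').i ≫ baseChange hf t' t'' g' hg') (by simp [ej])
  have hj : j ≫ ξ.proj g hg = ξ.proj (g' ≫ g) hg'' := IsPullback.lift_fst ..
  have hj' : j ≫ (ξ.pullback g hg).i =
    (ξ.pullback (g' ≫ g) hg'').i ≫ baseChange hf t' t'' g' hg' := IsPullback.lift_snd ..
  have w : yon.map j ≫ yon.map (ξ.pullback g hg).p =
      yon.map (ξ.pullback (g' ≫ g) hg'').p ≫ yon.map g' := by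
    rw [← Functor.map_comp, ← Functor.map_comp, p, ← Category.assoc, hj', Category.assoc,
      baseChange_snd, p, Category.assoc]
  have w₁ : yon.map (ξ.proj g hg) ≫ yon.map ξ.p = yon.map (ξ.pullback g hg).p ≫ yon.map g := by
    rw [← Functor.map_comp, ← Functor.map_comp, (ξ.isPullback_proj _ _).w]
  have w₂ : yon.map (ξ.proj (g' ≫ g) hg'') ≫ yon.map ξ.p =
      yon.map (ξ.pullback (g' ≫ g) hg'').p ≫ yon.map (g' ≫ g) := by
    rw [← Functor.map_comp, ← Functor.map_comp, (ξ.isPullback_proj _ _).w]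
  refine isRestriction_pullback _ j hj' w ?_
  refine gammaSpace.hom_ext _ ξ.isAffine_p ((ξ.isPullback_proj g hg).map yon) ?_ ?_
  · rw [Category.assoc, gammaSpace.map_comp d _ _ _ _ _ _ _ _ _ _ _ w₂
      (by rw [← Functor.map_comp, hj]) (by rw [Functor.map_comp]), pullback_α_map, Category.assoc,
      pullback_α_map, Functor.map_comp_assoc yon g' g]
  · rw [Category.assoc, gammaSpace.map_π, Category.assoc, α_π, reassoc_of% (ξ.pullback (g' ≫ g) hg'').α_π,
      Category.comp_id]

/-- The `T`-point of `Γᵈ(X/S)` given by a family of zero cycles: the composite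
`T ⟶ Γᵈ(Z/T) ⟶ Γᵈ(X/S)` of `α` with the morphism induced by `Z ⟶ X ×_S T ⟶ X` and `T ⟶ S`. -/
def toGamma (ξ : Family d hf t) : yon.obj T ⟶ gammaSpace d hf :=
  ξ.α ≫ gammaSpace.map d ξ.isAffine_p hf (yon.map ξ.i ≫ hf.rep.fst t) t
    (by rw [Category.assoc, hf.rep.w, p, Functor.map_comp, Category.assoc])

lemma toGamma_π (ξ : Family d hf t) : ξ.toGamma ≫ gammaSpace.π d hf = t := by
  rw [toGamma, Category.assoc, gammaSpace.map_π, reassoc_of% ξ.α_π]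

end Family

/-- The functor `Γᵈ_{X/S}` on `S`-schemes, for `X/S` affine: it sends `T` to the set of equivalence
classes of families of zero cycles of degree `d` on `X ×_S T` over `T`. -/
def familyFunctor (hf : IsAffineMor f) : (CostructuredArrow yon S)ᵒᵖ ⥤ Type (u + 1) where
  obj T := Quot (Family.Equivalent (d := d) (hf := hf) (t := T.unop.hom))
  map g := ↾Quot.map (fun ξ => ξ.pullback g.unop.left (CostructuredArrow.w g.unop))
    (fun _ _ h => h.pullback _ _)
  map_id T := by
    ext ⟨ξ⟩
    exact Quot.sound (ξ.pullback_id _ rfl _)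
  map_comp g g' := by
    ext ⟨ξ⟩
    exact Quot.sound (ξ.pullback_comp _ _ _ _ _ rfl _)

end Family

section Spec
variable {X S : Presh.{u}} {f : X ⟶ S} (d : ℕ)

/-- The ring `Γᵈ_R(B)` where `Spec B = X ×_S Spec R`. -/
abbrev gamOver (hf : IsAffineMor f) {R : CommRingCat.{u}} (t : yon.obj (Spec R) ⟶ S) :
    CommRingCat.{u} := .of (GamRing d (hf.rep.snd t))

/-- The structure homomorphism `R ⟶ Γᵈ_R(B)`. -/
def gamOver.ι (hf : IsAffineMor f) {R : CommRingCat.{u}} (t : yon.obj (Spec R) ⟶ S) :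
    R ⟶ gamOver d hf t := CommRingCat.ofHom (algebraMap R _)

end Spec
end GammaSpace

end

open CategoryTheory AlgebraicGeometry Opposite GammaSpace

/-! Two things carry the theorem: base change for `Γᵈ`, and a theory of supports for homomorphisms
out of `Γᵈ`.

Base change. Algebra homomorphisms `Γ_R(M) → A` are the same as `R`-linear maps from `M` to the
module `ExpSeq A` of sequences of exponential type. The universal property of `R' ⊗ B` therefore
gives `R' ⊗ Γ_R(B) ≅ Γ_R'(R' ⊗ B)`, and degree by degree a pushout square of rings
(`Gam.isPushout`). Hence over `Spec R ⟶ S` the functor of points of `Γᵈ(X/S)` is that of `Spec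
Γᵈ_R(B)` (`isPullback_taut`). These spectra glue over every scheme over `S`, so `gammaSpace.π` is
affine, and `Γᵈ(X/S)` inherits descent, the diagonal and the atlas from `S`.

Supports. For a ring homomorphism `γ` from `Γᵈ_R(B)`, the elements `x` such that `γ` kills every
`γᵏ(x) × c` with `k ≠ 0` form an ideal `kerIdeal γ`, and `γ` factors through `Γᵈ_R(B/I)` exactly
when `I` is contained in it (`ker_le_kerIdeal`, `Gam.exists_factorization`). If two families give
the same point, the ideals of `Z₁` and `Z₂` both lie in this ideal, hence so does their sum, and the
point comes from `Z₁ ∩ Z₂`. This is injectivity (`Family.equivalent_of_toGamma_eq`).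

For surjectivity, let `φ : Γᵈ_R(B) → R` be an algebra homomorphism. The norm `φ(γᵈ(t - b))` is a
monic polynomial `χ_b(t)`, and a Cayley–Hamilton theorem says that `χ_b(b)` lies in `kerIdeal φ`
(`charElem_mem_kerIdeal`). So `φ` factors through the quotient of `B` by the ideal of all `χ_b(b)`,
which is integral over `R` because `b` is a root of `χ_b` there. This ideal is compatible with
localization (`charIdeal_map`), so the quotients glue to a closed subscheme that is integral over
the base (`exists_closed_integral`).

Cayley–Hamilton itself has two steps. The norm of `χ_b(b)` vanishes, because after adjoining a root
`t` of `χ_b` it is a multiple of the norm of `t - b`, which is `χ_b(t) = 0` (`norm_charElem`). The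
vanishing of `φ(γᵏ(χ_b(b)) × c)` follows by applying this to the tautological law of degree `k` over
`Γᵏ ⊗ Γᵉ` with `k + e = d`, where the coproduct splits the characteristic polynomial into factors of
degrees `k` and `e`. -/

noncomputable section
open scoped TensorProduct
open Finset.HasAntidiagonal (antidiagonal mem_antidiagonal)

namespace GammaAlgebra

/-! ### Homomorphisms out of the divided power algebra as exponential sequences -/

section Exponential

/-- Sequences of exponential type: those that behave like the divided powers of an element. -/
def ExpSeq (A : Type*) [CommRing A] : Type _ :=
  {a : ℕ → A // a 0 = 1 ∧ ∀ n p, a n * a p = (n + p).choose n • a (n + p)}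

namespace ExpSeq
variable {A : Type*} [CommRing A]

lemma ext {a b : ExpSeq A} (h : ∀ n, a.1 n = b.1 n) : a = b := Subtype.ext (funext h)

/-- The generating series. -/
def series (a : ExpSeq A) : PowerSeries A := PowerSeries.mk a.1

lemma series_injective : Function.Injective (series : ExpSeq A → _) := fun a b h =>
  ext fun n => by simpa [series] using congr(PowerSeries.coeff n $h)

instance : Zero (ExpSeq A) :=
  ⟨⟨fun n => if n = 0 then 1 else 0, by simp, fun n p => by
    by_cases h : n = 0 <;> by_cases h' : p = 0 <;> simp [h, h']⟩⟩

instance : Add (ExpSeq A) :=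
  ⟨fun a b => ⟨fun n => ∑ k ∈ antidiagonal n, a.1 k.1 * b.1 k.2, by simp [a.2.1, b.2.1],
    fun n p => by
      have := sum_antidiagonal_mul_choose (fun i j => a.1 i * b.1 j) n p
      simp only [nsmul_eq_mul]
      rw [← this, Finset.sum_mul_sum]
      refine Finset.sum_congr rfl fun x _ => Finset.sum_congr rfl fun y _ => ?_
      rw [mul_mul_mul_comm, a.2.2, b.2.2, nsmul_eq_mul, nsmul_eq_mul, mul_mul_mul_comm]
      push_cast
      rfl⟩⟩

lemma add_val (a b : ExpSeq A) (n : ℕ) :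
    (a + b).1 n = ∑ k ∈ antidiagonal n, a.1 k.1 * b.1 k.2 := rfl

lemma zero_val (n : ℕ) : (0 : ExpSeq A).1 n = if n = 0 then 1 else 0 := rfl

/-- Addition of sequences is designed as multiplication of generating series, so that the group
axioms come from those of power series. -/
lemma series_add (a b : ExpSeq A) : (a + b).series = a.series * b.series := by
  ext n
  simp [series, PowerSeries.coeff_mul, add_val]

lemma series_zero : (0 : ExpSeq A).series = 1 := by
  ext n
  simp [series, PowerSeries.coeff_one, zero_val]

section
variable {R : Type*} [CommRing R] [Algebra R A]

instance : SMul R (ExpSeq A) :=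
  ⟨fun r a => ⟨fun n => r ^ n • a.1 n, by simp [a.2.1], fun n p => by
    rw [smul_mul_smul_comm, a.2.2, ← pow_add, smul_comm]⟩⟩

lemma smul_val (r : R) (a : ExpSeq A) (n : ℕ) : (r • a).1 n = r ^ n • a.1 n := rfl

end

/-- The binomial theorem: `(r + s)ⁿ aₙ` is the sum of the terms `C(n, i) rⁱ sʲ aₙ` with `i + j = n`,
and `C(n, i) aₙ = aᵢ aⱼ`. This is the module axiom that needs the multiplicative condition on the
sequence. -/
lemma add_smul' {R : Type*} [CommRing R] [Algebra R A] (r s : R) (a : ExpSeq A) :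
    (r + s) • a = r • a + s • a := by
  refine ext fun n => ?_
  rw [smul_val, add_val, add_pow, Finset.sum_smul, Finset.Nat.sum_antidiagonal_eq_sum_range_succ
    (fun i j => (r • a).1 i * (s • a).1 j)]
  refine Finset.sum_congr rfl fun i hi => ?_
  have hi : i + (n - i) = n := by
    have := Finset.mem_range.1 hi
    omega
  rw [smul_val, smul_val, smul_mul_smul_comm, a.2.2, hi, ← Nat.cast_smul_eq_nsmul R, smul_smul]

/-- The substitution `t ↦ -t` inverts the generating series, because `(-1) • a + 1 • a = 0 • a` is
the zero sequence. -/
instance : Neg (ExpSeq A) := ⟨fun a => (-1 : A) • a⟩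

instance : AddCommGroup (ExpSeq A) where
  add_assoc a b c := series_injective (by simp only [series_add, mul_assoc])
  zero_add a := series_injective (by simp only [series_add, series_zero, one_mul])
  add_zero a := series_injective (by simp only [series_add, series_zero, mul_one])
  add_comm a b := series_injective (by simp only [series_add, mul_comm])
  nsmul := nsmulRec
  zsmul := zsmulRec
  neg_add_cancel a := by
    have h : (1 : A) • a = a := ext fun n => by simp [smul_val]
    have h0 : (0 : A) • a = 0 := ext fun n => by
      rcases n with _ | n <;> simp [smul_val, zero_val, a.2.1]
    conv_lhs => rw [← h]
    change (-1 : A) • (1 : A) • a + _ = 0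
    rw [h, ← h0, ← neg_add_cancel (1 : A), add_smul', h]

instance {R : Type*} [CommRing R] [Algebra R A] : Module R (ExpSeq A) where
  one_smul a := ext fun n => by simp [smul_val]
  mul_smul r s a := ext fun n => by simp [smul_val, mul_pow, mul_smul]
  smul_zero r := ext fun n => by
    rcases n with _ | n <;> simp [smul_val, zero_val]
  zero_smul a := ext fun n => by
    rcases n with _ | n <;> simp [smul_val, zero_val, a.2.1]
  add_smul := add_smul'
  smul_add r a b := ext fun n => by
    simp only [smul_val, add_val, Finset.smul_sum]
    refine Finset.sum_congr rfl fun k hk => ?_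
    rw [smul_mul_smul_comm, ← pow_add, mem_antidiagonal.1 hk]

/-- Needed to lift an `R`-linear map into `ExpSeq A` along a base change to `R'`. -/
instance {R R' : Type*} [CommRing R] [CommRing R'] [Algebra R A] [Algebra R' A] [Algebra R R']
    [IsScalarTower R R' A] : IsScalarTower R R' (ExpSeq A) where
  smul_assoc r s a := ext fun n => by
    simp only [smul_val, _root_.smul_pow, smul_assoc]

end ExpSeq

variable {R : Type*} [CommRing R] {M : Type*} [AddCommGroup M] [Module R M]
  {A : Type*} [CommRing A] [Algebra R A]

/-- Algebra homomorphisms `Γ_R(M) → A` as linear maps to the sequences of exponential type. -/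
def toExpSeq (f : DivPow R M →ₐ[R] A) : M →ₗ[R] ExpSeq A where
  toFun m := ⟨fun n => f (dp R n m), by simp [dp_zero], fun n p => by
    rw [← map_mul, dp_mul, map_nsmul]⟩
  map_add' x y := ExpSeq.ext fun n => by
    change f (dp R n (x + y)) = ∑ k ∈ antidiagonal n, f (dp R k.1 x) * f (dp R k.2 y)
    rw [dp_add, map_sum]
    simp only [map_mul]
  map_smul' r x := ExpSeq.ext fun n => by
    change f (dp R n (r • x)) = r ^ n • f (dp R n x)
    rw [dp_smul, map_smul]

lemma toExpSeq_val (f : DivPow R M →ₐ[R] A) (m : M) (n : ℕ) :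
    (toExpSeq f m).1 n = f (dp R n m) := rfl

/-- The algebra homomorphism `Γ_R(M) → A` given by a linear map to the sequences of exponential
type. -/
def ofExpSeq (f : M →ₗ[R] ExpSeq A) : DivPow R M →ₐ[R] A :=
  DivPow.lift (fun n m => (f m).1 n) (fun m => (f m).2.1)
    (fun n r m => by rw [map_smul, ExpSeq.smul_val]) (fun n p m => (f m).2.2 n p)
    (fun n x y => by rw [map_add, ExpSeq.add_val])

lemma ofExpSeq_dp (f : M →ₗ[R] ExpSeq A) (n : ℕ) (m : M) :
    ofExpSeq f (dp R n m) = (f m).1 n := DivPow.lift_dp ..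

end Exponential

/-! ### Naturality of multiplication by a divided power -/

section BaseChange
variable (R R' : Type*) {B B' : Type*} [CommRing R] [CommRing R'] [CommRing B] [CommRing B']
  [Algebra R B] [Algebra R' B'] [Algebra R R'] [Algebra B B'] [Algebra R B'] [IsScalarTower R R' B']
  [IsScalarTower R B B']

lemma algebraMap_comp_tower : (algebraMap B B').comp (algebraMap R B) =
    (algebraMap R' B').comp (algebraMap R R') := by
  rw [← IsScalarTower.algebraMap_eq, ← IsScalarTower.algebraMap_eq]

/-- The projection to degree `d` is multiplication by `γᵈ(1)`; this compatibility makes it natural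
(`map_proj`). -/
lemma mapAll_mulDp {R R' B B' : Type*} [CommRing R] [CommRing R'] [CommRing B] [CommRing B']
    [Algebra R B] [Algebra R' B'] (φ : R →+* R') (ψ : B →+* B')
    (h : ψ.comp (algebraMap R B) = (algebraMap R' B').comp φ) (n : ℕ) (x : B) (c : DivPow R B) :
    mapAll φ ψ h (mulDp R B n x c) = mulDp R' B' n (ψ x) (mapAll φ ψ h c) := by
  induction c using DivPow.induction_on generalizing n with
  | C a =>
    rcases n with _ | n <;>
      simp [mulDp_apply, Polynomial.algebraMap_apply, mapAll_algebraMap]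
  | add p q hp hq => simp only [map_add, hp, hq]
  | dp p k m hp =>
    rw [mulDp_mul, map_sum, map_mul, mulDp_mul]
    refine Finset.sum_congr rfl fun a ha => ?_
    rw [map_mul, hp, mulDp_dp, mapAll_dp, mulDp_dp]
    split_ifs <;> simp [mapAll_dp]

end BaseChange

/-! ### The grading and its projections -/

section Projection
variable {R : Type*} [CommRing R] {B : Type*} [CommRing B] [Algebra R B]

lemma mul_mem {k l : ℕ} {a b : DivPow R B} (ha : a ∈ piece R k B) (hb : b ∈ piece R l B) :
    a * b ∈ piece R (k + l) B := by
  induction ha using piece_induction with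
  | zero => simp
  | add z z' _ _ h h' => rw [add_mul]; exact add_mem h h'
  | smul r z _ h => rw [smul_mul_assoc]; exact Submodule.smul_mem _ _ h
  | mono i k x hk =>
    induction hb using piece_induction with
    | zero => simp
    | add z z' _ _ h h' => rw [mul_add]; exact add_mem h h'
    | smul r z _ h => rw [mul_smul_comm]; exact Submodule.smul_mem _ _ h
    | mono j l y hl =>
      have : mono R k x * mono R l y = mono R (Sum.elim k l) (Sum.elim x y) := by
        simp [mono]
      rw [this]
      exact mono_mem _ _ _ (by simp [hk, hl])

lemma mulDp_mem (n : ℕ) (x : B) (c : DivPow R B) : mulDp R B n x c ∈ piece R n B := by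
  induction c using DivPow.induction_on generalizing n with
  | C a =>
    rcases n with _ | n
    · have : (1 : DivPow R B) ∈ piece R 0 B := by
        rw [← dp_zero (R := R) (0 : B)]; exact dp_mem 0 _
      simpa [mulDp_apply, Polynomial.algebraMap_apply, Algebra.algebraMap_eq_smul_one] using
        Submodule.smul_mem _ a this
    · simp [mulDp_apply, Polynomial.algebraMap_apply]
  | add p q hp hq => rw [map_add]; exact add_mem (hp n) (hq n)
  | dp p k m hp =>
    rw [mulDp_mul]
    refine Submodule.sum_mem _ fun a ha => ?_
    have h1 := hp a.1
    have h2 : mulDp R B a.2 x (dp R k m) ∈ piece R a.2 B := by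
      rw [mulDp_dp]; split_ifs
      · exact dp_mem _ _
      · exact zero_mem _
    rw [mem_antidiagonal] at ha
    rw [← ha]
    exact mul_mem h1 h2

variable (R B) in
/-- The projection `Γ_R(B) → Γᵈ_R(B)` to the component of degree `d`. -/
def proj (d : ℕ) : DivPow R B →ₗ[R] Gam d R B :=
  LinearMap.codRestrict (piece R d B) (mulDp R B d 1) (mulDp_mem d 1)

lemma proj_val (d : ℕ) (c : DivPow R B) : (proj R B d c).1 = mulDp R B d 1 c := rfl

/-- `γᵈ(1)` is the unit of `Γᵈ_R(B)` and annihilates the other degrees, which is why multiplication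
by it is the projection. -/
lemma proj_coe {d : ℕ} (c : Gam d R B) : proj R B d c.1 = c :=
  Subtype.ext ((prod_dp R B d 1 c.1).symm.trans (one_prod c.2))

/-- In the Leibniz-type formula `mulDp_mul` only the term of bidegree `(k, d)` survives, since
`γᵏ(x)` is homogeneous of degree `k`. -/
lemma proj_dp_mul (d k : ℕ) (x : B) (c : DivPow R B) :
    (proj R B (k + d) (dp R k x * c)).1 = dp R k x * (proj R B d c).1 := by
  simp only [proj_val, mulDp_mul, mulDp_dp, one_mul]
  rw [Finset.sum_eq_single (k, d)]
  · simp
  · rintro ⟨a, b⟩ h h'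
    have : k ≠ a := by
      rintro rfl
      rw [mem_antidiagonal] at h
      exact h' (by simp at h; simp [h])
    simp [this]
  · simp

lemma proj_dp_mul_of_lt {d k : ℕ} (h : d < k) (x : B) (c : DivPow R B) :
    proj R B d (dp R k x * c) = 0 := by
  refine Subtype.ext ?_
  simp only [proj_val, mulDp_mul, mulDp_dp, one_mul]
  refine Finset.sum_eq_zero ?_
  rintro ⟨a, b⟩ h'
  rw [mem_antidiagonal] at h'
  have : k ≠ a := by rintro rfl; simp at h'; omega
  simp [this]

lemma map_proj {R' B' : Type*} [CommRing R'] [CommRing B'] [Algebra R' B'] (φ : R →+* R')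
    (ψ : B →+* B') (h : ψ.comp (algebraMap R B) = (algebraMap R' B').comp φ) (d : ℕ)
    (c : DivPow R B) : Gam.map φ ψ h d (proj R B d c) = proj R' B' d (mapAll φ ψ h c) :=
  Subtype.ext ((mapAll_mulDp φ ψ h d 1 c).trans (by rw [map_one]; rfl))

end Projection

/-! ### Base change of the divided power algebra -/

section Pushout
variable {R R' B B' : Type*} [CommRing R] [CommRing R'] [CommRing B] [CommRing B']
  [Algebra R B] [Algebra R' B'] [Algebra R R'] [Algebra B B'] [Algebra R B'] [IsScalarTower R R' B']
  [IsScalarTower R B B']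

lemma isBaseChange_of_isPushout [h : Algebra.IsPushout R R' B B'] :
    IsBaseChange R' (IsScalarTower.toAlgHom R B B').toLinearMap := h.out

variable {A : Type*} [CommRing A] [Algebra R A] [Algebra R' A] [IsScalarTower R R' A]

/-- Such homomorphisms are `R'`-linear maps from `B' = R' ⊗ B` to `ExpSeq A`, and these are
determined by their restrictions to `B`. -/
lemma hom_ext_of_isPushout [Algebra.IsPushout R R' B B'] {f g : DivPow R' B' →ₐ[R'] A}
    (h : ∀ n b, f (dp R' n (algebraMap B B' b)) = g (dp R' n (algebraMap B B' b))) : f = g := by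
  have : toExpSeq f = toExpSeq g := by
    refine (isBaseChange_of_isPushout (R := R) (R' := R') (B := B) (B' := B')).algHom_ext _ _
      fun b => ExpSeq.ext fun n => h n b
  refine hom_ext fun n m => ?_
  rw [← toExpSeq_val, this, toExpSeq_val]

/-- The extension of an algebra homomorphism `Γ_R(B) → A` to `Γ_R'(B')`, for `B' = R' ⊗ B` and `A`
an `R'`-algebra. -/
def extend [Algebra.IsPushout R R' B B'] (f : DivPow R B →ₐ[R] A) : DivPow R' B' →ₐ[R'] A :=
  ofExpSeq ((isBaseChange_of_isPushout (R := R) (R' := R') (B := B) (B' := B')).lift (toExpSeq f))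

lemma extend_mapAll [Algebra.IsPushout R R' B B'] (f : DivPow R B →ₐ[R] A) (z : DivPow R B) :
    extend (R' := R') (B' := B') f
      (mapAll (algebraMap R R') (algebraMap B B') (algebraMap_comp_tower R R') z) = f z := by
  induction z using DivPow.induction_on with
  | C a =>
    rw [mapAll_algebraMap, AlgHom.commutes, AlgHom.commutes, ← IsScalarTower.algebraMap_apply]
  | add p q hp hq => simp only [map_add, hp, hq]
  | dp p k m hp =>
    rw [map_mul, map_mul, map_mul, hp, mapAll_dp, extend, ofExpSeq_dp]
    congr 1
    exact congr(($((isBaseChange_of_isPushout (R := R) (R' := R') (B := B) (B' := B')).lift_eq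
      (toExpSeq f) m)).1 k)

end Pushout
end GammaAlgebra
end

noncomputable section
open scoped TensorProduct
open Finset.HasAntidiagonal (antidiagonal mem_antidiagonal)

namespace GammaAlgebra
-- Base change of the degree `d` part
section GamPushout

variable (d : ℕ) (R R' B B' : Type*) [CommRing R] [CommRing R'] [CommRing B] [CommRing B']
  [Algebra R B] [Algebra R' B'] [Algebra R R'] [Algebra B B'] [Algebra R B'] [IsScalarTower R R' B']
  [IsScalarTower R B B']

/-- The map `Γᵈ_R(B) → Γᵈ_R'(B')` as a linear map. -/
def Gam.baseLin [Algebra R (Gam d R' B')] [IsScalarTower R R' (Gam d R' B')] :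
    Gam d R B →ₗ[R] Gam d R' B' where
  __ := Gam.map (algebraMap R R') (algebraMap B B') (algebraMap_comp_tower R R') d
  map_smul' r z := by
    refine Eq.trans ?_ (algebraMap_smul R' r
      (Gam.map (algebraMap R R') (algebraMap B B') (algebraMap_comp_tower R R') d z))
    exact Subtype.ext (mapAll_smul _ _ _ r z.1)

/-- The inverse of `R' ⊗ Γ_R(B) → Γ_R'(R' ⊗ B)`. -/
def toTensor [Algebra.IsPushout R R' B B'] : DivPow R' B' →ₐ[R'] R' ⊗[R] DivPow R B :=
  extend (R := R) (B := B) Algebra.TensorProduct.includeRight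

/-- The inverse of `R' ⊗ Γᵈ_R(B) → Γᵈ_R'(R' ⊗ B)`. -/
def Gam.toTensor [Algebra.IsPushout R R' B B'] : Gam d R' B' →ₗ[R'] R' ⊗[R] Gam d R B :=
  (proj R B d).baseChange R' ∘ₗ (GammaAlgebra.toTensor R R' B B').toLinearMap ∘ₗ
    (piece R' d B').subtype

/-- The composite `Γ_R'(B') → R' ⊗ Γ_R(B) → Γ_R'(B')` is the identity, because it fixes each `γⁿ(b)`
with `b` from `B`. Projecting to degree `d` is compatible with the second map. -/
lemma proj_eq_baseLin [Algebra.IsPushout R R' B B'] [Algebra R (Gam d R' B')]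
    [IsScalarTower R R' (Gam d R' B')] (z : DivPow R' B') :
    (TensorProduct.isBaseChange R (Gam d R B) R').lift (Gam.baseLin d R R' B B')
      ((proj R B d).baseChange R' (toTensor R R' B B' z)) = proj R' B' d z := by
  let _ : Algebra R (DivPow R' B') := ((algebraMap R' (DivPow R' B')).comp (algebraMap R R')).toAlgebra
  have _ : IsScalarTower R R' (DivPow R' B') := .of_algebraMap_eq fun _ => rfl
  let m : DivPow R B →ₐ[R] DivPow R' B' :=
    { __ := mapAll (algebraMap R R') (algebraMap B B') (algebraMap_comp_tower R R')
      commutes' r := mapAll_algebraMap _ _ _ r }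
  let F : R' ⊗[R] DivPow R B →ₐ[R'] DivPow R' B' :=
    Algebra.TensorProduct.lift (Algebra.ofId _ _) m fun _ _ => Commute.all _ _
  have hF : F.comp (toTensor R R' B B') = AlgHom.id _ _ := by
    refine hom_ext_of_isPushout (R := R) (B := B) fun n b => ?_
    rw [← mapAll_dp (algebraMap R R') _ (algebraMap_comp_tower R R')]
    simp only [AlgHom.comp_apply, toTensor, extend_mapAll]
    simp [F, m]
  -- Write `z` as the image under `F` of an element of the tensor product; it then suffices to
  -- compare on pure tensors.
  conv_rhs => rw [← AlgHom.id_apply (R := R') z, ← hF, AlgHom.comp_apply]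
  induction toTensor R R' B B' z using TensorProduct.induction_on with
  | zero => simp
  | add x y hx hy => simp only [map_add, hx, hy]
  | tmul r z =>
    have h1 : r ⊗ₜ[R] proj R B d z = r • TensorProduct.mk R R' _ 1 (proj R B d z) := by
      simp [TensorProduct.smul_tmul']
    rw [LinearMap.baseChange_tmul, h1, map_smul, IsBaseChange.lift_eq]
    simp only [F, Algebra.TensorProduct.lift_tmul, Algebra.ofId_apply, ← Algebra.smul_def, map_smul]
    congr 1
    exact map_proj _ _ _ d z

/-- The degree `d` part of the isomorphism for the whole algebra. The inverse first includes `Γᵈ` in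
`Γ`, where homomorphisms can be defined by the presentation, and projects to degree `d` afterwards.
-/
lemma Gam.isBaseChange [Algebra.IsPushout R R' B B'] [Algebra R (Gam d R' B')]
    [IsScalarTower R R' (Gam d R' B')] : IsBaseChange R' (Gam.baseLin d R R' B B') := by
  refine IsBaseChange.of_equiv (LinearEquiv.ofLinearMap
    ((TensorProduct.isBaseChange R (Gam d R B) R').lift (Gam.baseLin d R R' B B'))
    (Gam.toTensor d R R' B B') ?_ ?_) fun z => ?_
  · exact LinearMap.ext fun z => (proj_eq_baseLin d R R' B B' z.1).trans (proj_coe z)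
  · refine (TensorProduct.isBaseChange R (Gam d R B) R').algHom_ext _ _ fun z => ?_
    rw [LinearMap.comp_apply, IsBaseChange.lift_eq]
    change (proj R B d).baseChange R' (GammaAlgebra.toTensor R R' B B' (mapAll _ _ (algebraMap_comp_tower R R') z.1)) = _
    rw [GammaAlgebra.toTensor, extend_mapAll]
    simp [proj_coe]
  · exact (TensorProduct.isBaseChange R (Gam d R B) R').lift_eq _ z

lemma Gam.isPushout_map [Algebra.IsPushout R R' B B'] :
    letI := (Gam.map (algebraMap R R') (algebraMap B B') (algebraMap_comp_tower R R') d).toAlgebra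
    letI := ((algebraMap R' (Gam d R' B')).comp (algebraMap R R')).toAlgebra
    letI : IsScalarTower R R' (Gam d R' B') := .of_algebraMap_eq fun _ => rfl
    letI : IsScalarTower R (Gam d R B) (Gam d R' B') :=
      .of_algebraMap_eq fun r => (Gam.map_algebraMap _ _ _ d r).symm
    Algebra.IsPushout R R' (Gam d R B) (Gam d R' B') := by
  let := (Gam.map (algebraMap R R') (algebraMap B B') (algebraMap_comp_tower R R') d).toAlgebra
  let := ((algebraMap R' (Gam d R' B')).comp (algebraMap R R')).toAlgebra
  let : IsScalarTower R R' (Gam d R' B') := .of_algebraMap_eq fun _ => rfl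
  let : IsScalarTower R (Gam d R B) (Gam d R' B') :=
    .of_algebraMap_eq fun r => (Gam.map_algebraMap _ _ _ d r).symm
  exact ⟨Gam.isBaseChange d R R' B B'⟩

end GamPushout
end GammaAlgebra
end

noncomputable section
open scoped TensorProduct
open Finset.HasAntidiagonal (antidiagonal mem_antidiagonal)

namespace GammaAlgebra
-- The base change square as a pushout of rings
section Cat
variable {R R' B B' : Type u} [CommRing R] [CommRing R'] [CommRing B] [CommRing B']
  [Algebra R B] [Algebra R' B']

lemma Gam.isPushout (d : ℕ) (φ : R →+* R') (ψ : B →+* B')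
    (h : ψ.comp (algebraMap R B) = (algebraMap R' B').comp φ)
    (hP : IsPushout (CommRingCat.ofHom φ) (CommRingCat.ofHom (algebraMap R B))
      (CommRingCat.ofHom (algebraMap R' B')) (CommRingCat.ofHom ψ)) :
    IsPushout (CommRingCat.ofHom φ) (CommRingCat.ofHom (algebraMap R (Gam d R B)))
      (CommRingCat.ofHom (algebraMap R' (Gam d R' B'))) (CommRingCat.ofHom (Gam.map φ ψ h d)) := by
  let := φ.toAlgebra
  let := ψ.toAlgebra
  let := ((algebraMap R' B').comp φ).toAlgebra
  have : IsScalarTower R R' B' := .of_algebraMap_eq fun _ => rfl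
  have : IsScalarTower R B B' := .of_algebraMap_eq fun r => congr($h r).symm
  have : Algebra.IsPushout R R' B B' := (CommRingCat.isPushout_iff_isPushout ..).1 hP
  have := Gam.isPushout_map d R R' B B'
  let := (Gam.map (algebraMap R R') (algebraMap B B') (algebraMap_comp_tower R R') d).toAlgebra
  let := ((algebraMap R' (Gam d R' B')).comp (algebraMap R R')).toAlgebra
  have : IsScalarTower R R' (Gam d R' B') := .of_algebraMap_eq fun _ => rfl
  have : IsScalarTower R (Gam d R B) (Gam d R' B') :=
    .of_algebraMap_eq fun r => (Gam.map_algebraMap _ _ _ d r).symm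
  exact CommRingCat.isPushout_of_isPushout R R' (Gam d R B) (Gam d R' B')

lemma includeRight_comp (R R' B : Type*) [CommRing R] [CommRing R'] [CommRing B] [Algebra R B]
    [Algebra R R'] :
    (Algebra.TensorProduct.includeRight (R := R) (A := R') (B := B)).toRingHom.comp (algebraMap R B) =
      (algebraMap R' (R' ⊗[R] B)).comp (algebraMap R R') := by
  ext r
  simp [Algebra.algebraMap_eq_smul_one]

variable [Algebra R R']

/-- Allows a law to be evaluated on elements with coefficients in `R'`, for instance at an adjoined
root. The extension is glued from `φ` and the identity of `R'` by the pushout property. -/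
lemma Gam.exists_extension (d : ℕ) (φ : Gam d R B →ₐ[R] R') :
    ∃ φ' : Gam d R' (R' ⊗[R] B) →ₐ[R'] R', ∀ z,
      φ' (Gam.map (algebraMap R R') Algebra.TensorProduct.includeRight.toRingHom
        (includeRight_comp R R' B) d z) = φ z := by
  have hP := Gam.isPushout d (algebraMap R R') _ (includeRight_comp R R' B)
    (CommRingCat.isPushout_tensorProduct R R' B)
  have w : CommRingCat.ofHom (algebraMap R R') ≫ 𝟙 _ =
      CommRingCat.ofHom (algebraMap R (Gam d R B)) ≫ CommRingCat.ofHom φ.toRingHom := by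
    ext r
    simp
  refine ⟨⟨(hP.desc (𝟙 _) (CommRingCat.ofHom φ.toRingHom) w).hom, fun r => ?_⟩, fun z => ?_⟩
  · exact congr($(hP.inl_desc (𝟙 _) (CommRingCat.ofHom φ.toRingHom) w).hom r)
  · exact congr($(hP.inr_desc (𝟙 _) (CommRingCat.ofHom φ.toRingHom) w).hom z)

end Cat

/-! ### The kernel ideal of a multiplicative law -/

section Ker
variable {R B A : Type*} [CommRing R] [CommRing B] [CommRing A] [Algebra R B] {d : ℕ}

lemma dp_zero_right {k : ℕ} (hk : k ≠ 0) : dp R k (0 : B) = 0 := by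
  rw [← zero_smul R (0 : B), dp_smul, zero_pow hk, zero_smul]

/-- A product `·` with a `×`-product on the left is computed from the coproduct of the right factor.
The term at `p = (k, 0)`, `q = (0, e)` is `γᵏ(xb) × (c · γᵉ(1))`; in every other term that survives,
the exponent `q.1` of `x` is positive. -/
lemma prod_dp_mul {k e : ℕ} (x b : B) (c : DivPow R B) :
    prod R B (dp R k x * c) (dp R k b * dp R e 1) =
      ∑ p ∈ antidiagonal k, ∑ q ∈ antidiagonal e, if p.1 + q.1 = k then
        dp R q.1 x * (dp R p.1 (x * b) * prod R B c (dp R p.2 b * dp R q.2 1)) else 0 := by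
  rw [prod_mul, map_mul, comulHom_dp, comulHom_dp, Finset.sum_mul_sum, map_sum, map_sum]
  refine Finset.sum_congr rfl fun p _ => ?_
  rw [map_sum, map_sum]
  refine Finset.sum_congr rfl fun q _ => ?_
  rw [Algebra.TensorProduct.tmul_mul_tmul, TensorProduct.map_tmul, LinearMap.mul'_apply, prod_dp]
  have : mulDp R B k x (dp R p.1 b * dp R q.1 1) =
      if p.1 + q.1 = k then dp R p.1 (x * b) * dp R q.1 x else 0 := by
    have := mulDp_mono R B k x ![p.1, q.1] ![b, 1]
    simpa [mono, Fin.prod_univ_two] using this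
  rw [this]
  split_ifs
  · ring
  · simp

/-- The elements `x` of `B` such that `γ` vanishes on the multiples of the divided powers of `x`. -/
def kerIdeal (γ : Gam d R B →+* A) : Ideal B where
  carrier := {x | ∀ k, k ≠ 0 → ∀ c, γ (proj R B d (dp R k x * c)) = 0}
  zero_mem' k hk c := by rw [dp_zero_right hk, zero_mul, map_zero, map_zero]
  add_mem' {x y} hx hy k hk c := by
    rw [dp_add, Finset.sum_mul, map_sum, map_sum]
    refine Finset.sum_eq_zero fun p hp => ?_
    rw [mem_antidiagonal] at hp
    by_cases h : p.1 = 0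
    · rw [mul_comm (dp R p.1 x), mul_assoc]
      exact hy _ (by omega) _
    · rw [mul_assoc]
      exact hx _ h _
  smul_mem' b x hx k hk c := by
    by_cases hd : d < k
    · rw [proj_dp_mul_of_lt hd, map_zero]
    obtain ⟨e, rfl⟩ := Nat.exists_eq_add_of_le (not_lt.1 hd)
    have key : ∀ c : DivPow R B, ∀ hc : c ∈ piece R e B,
        γ (proj R B (k + e) (dp R k (x * b) * c)) = 0 := by
      intro c hc
      -- Since `γ` is multiplicative and kills `z`, it kills `z · w`. The leading term of `z · w` is
      -- `γᵏ(xb) × c`, and `γ` kills each of the others because it contains some `γⁱ(x)` with `i ≠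
      -- 0`.
      let z : Gam (k + e) R B := ⟨dp R k x * c, mul_mem (dp_mem _ _) hc⟩
      let w : Gam (k + e) R B := ⟨dp R k b * dp R e 1, mul_mem (dp_mem _ _) (dp_mem _ _)⟩
      have h0 : γ z = 0 := by rw [← proj_coe z]; exact hx k hk c
      have h1 : γ (proj R B (k + e) (z * w).1) = 0 := by
        rw [proj_coe, map_mul, h0, zero_mul]
      have h2 : (z * w).1 = _ := prod_dp_mul x b c
      rw [h2, map_sum, map_sum, Finset.sum_eq_single (k, 0), map_sum, map_sum,
        Finset.sum_eq_single (0, e)] at h1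
      · rwa [if_pos (by simp), dp_zero, dp_zero, one_mul, one_mul, prod_comm hc (dp_mem _ _),
          one_prod hc] at h1
      · rintro ⟨i, j⟩ _ hij
        split_ifs with h
        · simp at h hij
          subst h
          simp_all
        · simp
      · simp
      · rintro ⟨i, j⟩ hij hij'
        rw [map_sum, map_sum]
        refine Finset.sum_eq_zero fun q hq => ?_
        split_ifs with h
        · refine hx _ ?_ _
          rintro h0
          rw [mem_antidiagonal] at hij
          apply hij'
          simp at hij h
          ext <;> simp <;> omega
        · simp
      · simp
    -- Only the component of degree `e` of a general `c` contributes in degree `k + e`.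
    rw [smul_eq_mul, mul_comm b x]
    have := key _ (proj R B e c).2
    rwa [← proj_dp_mul, proj_coe] at this

lemma mem_kerIdeal {γ : Gam d R B →+* A} {x : B} :
    x ∈ kerIdeal γ ↔ ∀ k, k ≠ 0 → ∀ c, γ (proj R B d (dp R k x * c)) = 0 := Iff.rfl

variable {B' : Type*} [CommRing B'] [Algebra R B'] (ψ : B →+* B')
  (h : ψ.comp (algebraMap R B) = (algebraMap R B').comp (RingHom.id R))

/-- For `x` in the kernel of `ψ`, the element `γᵏ(x) × c` goes to a multiple of `γᵏ(0)`, which is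
zero when `k ≠ 0`. -/
lemma ker_le_kerIdeal (γ : Gam d R B →+* A) (γ' : Gam d R B' →+* A)
    (hγ : ∀ z, γ' (Gam.map (RingHom.id R) ψ h d z) = γ z) : RingHom.ker ψ ≤ kerIdeal γ := by
  intro x hx k hk c
  rw [← hγ, map_proj, map_mul, mapAll_dp, hx, dp_zero_right hk, zero_mul, map_zero, map_zero]

variable {ψ}

lemma mapAll_surjective (hψ : Function.Surjective ψ) : Function.Surjective (mapAll (RingHom.id R) ψ h) := by
  intro z
  induction z using DivPow.induction_on with
  | C a => exact ⟨algebraMap R _ a, mapAll_algebraMap ..⟩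
  | add f g hf hg =>
    obtain ⟨f, rfl⟩ := hf
    obtain ⟨g, rfl⟩ := hg
    exact ⟨f + g, map_add ..⟩
  | dp f n m hf =>
    obtain ⟨f, rfl⟩ := hf
    obtain ⟨m, rfl⟩ := hψ m
    exact ⟨f * dp R n m, by rw [map_mul, mapAll_dp]⟩

lemma Gam.map_surjective (hψ : Function.Surjective ψ) : Function.Surjective (Gam.map (RingHom.id R) ψ h d) := by
  intro z
  obtain ⟨c, hc⟩ := mapAll_surjective h hψ z.1
  exact ⟨proj R B d c, by rw [map_proj, hc, proj_coe]⟩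

/-- Modulo the ideal generated by these divided powers, `γⁿ(x)` depends on `ψ(x)` only. So the
quotient map factors through `Γ_R(B')`, by means of a section of `ψ`. -/
lemma mem_span_dp_of_mapAll_eq_zero (hψ : Function.Surjective ψ) {z : DivPow R B} (hz : mapAll (RingHom.id R) ψ h z = 0) :
    z ∈ Ideal.span {w | ∃ k x, k ≠ 0 ∧ ψ x = 0 ∧ w = dp R k x} := by
  set K := Ideal.span {w : DivPow R B | ∃ k x, k ≠ 0 ∧ ψ x = 0 ∧ w = dp R k x}
  let q := Ideal.Quotient.mkₐ R K
  have hq : ∀ n x y, ψ x = ψ y → q (dp R n x) = q (dp R n y) := by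
    intro n x y hxy
    have h0 : ∀ k, k ≠ 0 → q (dp R k (x - y)) = 0 := fun k hk =>
      Ideal.Quotient.eq_zero_iff_mem.2 (Ideal.subset_span ⟨k, _, hk, by simp [hxy], rfl⟩)
    conv_lhs => rw [← sub_add_cancel x y, dp_add, map_sum]
    rw [Finset.sum_eq_single (0, n)]
    · simp [dp_zero]
    · rintro ⟨i, j⟩ hij hne
      have : i ≠ 0 := by
        rintro rfl
        rw [mem_antidiagonal] at hij
        simp at hij
        simp [hij] at hne
      rw [map_mul, h0 _ this, zero_mul]
    · simp
  -- `σ` is a mere map of sets. By `hq` its failure to be linear is invisible in the quotient, so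
  -- the relations of `Γ_R(B')` hold.
  obtain ⟨σ, hσ⟩ := hψ.hasRightInverse
  let inv : DivPow R B' →ₐ[R] DivPow R B ⧸ K := DivPow.lift (fun n b => q (dp R n (σ b)))
    (fun m => by rw [dp_zero, map_one])
    (fun n r m => by
      rw [hq n (σ (r • m)) (r • σ m), dp_smul, map_smul]
      rw [hσ, h_smul _ _ h, hσ]
      rfl)
    (fun n p m => by rw [← map_mul, dp_mul, map_nsmul])
    (fun n x y => by
      rw [hq n (σ (x + y)) (σ x + σ y), dp_add, map_sum]
      · simp only [map_mul]
      · rw [map_add, hσ, hσ, hσ])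
  have key : ∀ z, inv (mapAll (RingHom.id R) ψ h z) = q z := by
    intro z
    induction z using DivPow.induction_on with
    | C a => rw [mapAll_algebraMap, AlgHom.commutes, AlgHom.commutes]; rfl
    | add f g hf hg => simp only [map_add, hf, hg]
    | dp f n m hf =>
      rw [map_mul, map_mul, map_mul, hf, mapAll_dp, DivPow.lift_dp]
      congr 1
      exact hq _ _ _ (hσ _)
  rw [← Ideal.Quotient.eq_zero_iff_mem]
  exact (key z).symm.trans (by rw [hz, map_zero])

/-- `kerIdeal` is defined so that `γ` kills exactly the generators of the kernel found in
`mem_span_dp_of_mapAll_eq_zero`. Together with `ker_le_kerIdeal` this makes `kerIdeal γ` the largest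
ideal modulo which `γ` is still defined. -/
lemma Gam.exists_factorization (hψ : Function.Surjective ψ) (γ : Gam d R B →+* A) (hγ : RingHom.ker ψ ≤ kerIdeal γ) :
    ∃ γ' : Gam d R B' →+* A, ∀ z, γ' (Gam.map (RingHom.id R) ψ h d z) = γ z := by
  have hker : ∀ z, Gam.map (RingHom.id R) ψ h d z = 0 → γ z = 0 := by
    intro z hz
    have := mem_span_dp_of_mapAll_eq_zero h hψ congr(($hz).1)
    rw [← proj_coe z]
    generalize z.1 = y at this
    induction this using Submodule.span_induction with
    | mem y hy =>
      obtain ⟨k, x, hk, hx, rfl⟩ := hy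
      have := hγ hx k hk 1
      rwa [mul_one] at this
    | zero => simp
    | add x y _ _ hx hy => rw [map_add, map_add, hx, hy, add_zero]
    | smul c x hx hx' =>
      -- The quantification over all `c` in `kerIdeal` absorbs the coefficients occurring in the
      -- span.
      have : ∀ c, γ (proj R B d (x * c)) = 0 := by
        clear hx'
        induction hx using Submodule.span_induction with
        | mem y hy =>
          obtain ⟨k, x, hk, hx, rfl⟩ := hy
          exact hγ hx k hk
        | zero => simp
        | add x y _ _ hx hy => intro c; rw [add_mul, map_add, map_add, hx, hy, add_zero]
        | smul a x _ hx => intro c; rw [smul_eq_mul, mul_comm a, mul_assoc]; exact hx _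
      rw [smul_eq_mul, mul_comm]
      exact this c
  refine ⟨RingHom.liftOfSurjective _ (Gam.map_surjective h hψ) ⟨γ, fun z hz => hker z hz⟩,
    fun z => ?_⟩
  exact RingHom.liftOfRightInverse_comp_apply _ _ _ ⟨γ, fun z hz => hker z hz⟩ z

end Ker
end GammaAlgebra
end

noncomputable section
open scoped TensorProduct
open Finset.HasAntidiagonal (antidiagonal mem_antidiagonal)

namespace GammaAlgebra

/-! ### Characteristic polynomials of a multiplicative law -/

section Norm
variable {R B : Type*} [CommRing R] [CommRing B] [Algebra R B] {d : ℕ}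

variable (R) in
/-- The element `γⁱ(b) × γʲ(1)` of `Γⁱ⁺ʲ_R(B)`. -/
def elemSymm (d : ℕ) (b : B) (p : ℕ × ℕ) : Gam d R B := proj R B d (dp R p.1 b * dp R p.2 1)

lemma elemSymm_val (b : B) {p : ℕ × ℕ} (hp : p ∈ antidiagonal d) :
    (elemSymm R d b p).1 = dp R p.1 b * dp R p.2 1 := by
  obtain rfl := mem_antidiagonal.1 hp
  exact congr_arg Subtype.val
    (proj_coe (⟨_, mul_mem (dp_mem p.1 b) (dp_mem p.2 1)⟩ : Gam (p.1 + p.2) R B))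

/-- The characteristic polynomial of `b`, the norm of `t - b`, evaluated at `b`. -/
def charElem (φ : Gam d R B →ₐ[R] R) (b : B) : B :=
  ∑ p ∈ antidiagonal d, ((-1) ^ p.1 * φ (elemSymm R d b p)) • b ^ p.2

open Polynomial in
/-- The characteristic polynomial of `b`, the norm of `t - b`. -/
def charPoly (φ : Gam d R B →ₐ[R] R) (b : B) : R[X] :=
  ∑ p ∈ antidiagonal d, monomial p.2 ((-1) ^ p.1 * φ (elemSymm R d b p))

open Polynomial in
lemma aeval_charPoly (φ : Gam d R B →ₐ[R] R) (b : B) : aeval b (charPoly φ b) = charElem φ b := by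
  simp [charPoly, charElem, aeval_monomial, Algebra.smul_def]

open Polynomial in
lemma charPoly_coeff (φ : Gam d R B →ₐ[R] R) (b : B) : (charPoly φ b).coeff d = 1 := by
  rw [charPoly, finsetSum_coeff, Finset.sum_eq_single (0, d)]
  · have : elemSymm R d b (0, d) = 1 := Subtype.ext (by
      rw [elemSymm_val _ (by simp), dp_zero, one_mul]; rfl)
    simp [this]
  · rintro ⟨i, j⟩ h h'
    rw [coeff_monomial, if_neg]
    rintro rfl
    simp at h h'
    exact h' h
  · simp

open Polynomial in
lemma charPoly_natDegree_le (φ : Gam d R B →ₐ[R] R) (b : B) : (charPoly φ b).natDegree ≤ d := by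
  refine natDegree_sum_le_of_forall_le _ _ fun p hp => (natDegree_monomial_le _).trans ?_
  have := mem_antidiagonal.1 hp
  omega

lemma charPoly_monic (φ : Gam d R B →ₐ[R] R) (b : B) : (charPoly φ b).Monic :=
  Polynomial.monic_of_natDegree_le_of_coeff_eq_one d (charPoly_natDegree_le φ b) (charPoly_coeff φ b)

/-- Expand `γᵈ((-1)b + t·1)` by the addition and homogeneity rules. Applying an algebra homomorphism
shows that `charPoly` has the coefficients of the norm of `t - b`. -/
lemma gam_sub (t : R) (b : B) : Gam.gam d R (algebraMap R B t - b) =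
      ∑ p ∈ antidiagonal d, ((-1) ^ p.1 * t ^ p.2) • elemSymm R d b p := by
  refine Subtype.ext ?_
  have hs : ∀ (s : Finset (ℕ × ℕ)) (F : ℕ × ℕ → Gam d R B),
      (∑ p ∈ s, F p).1 = ∑ p ∈ s, (F p).1 := fun s F => map_sum (piece R d B).subtype F s
  rw [hs]
  have : algebraMap R B t - b = (-1 : R) • b + t • 1 := by
    rw [Algebra.algebraMap_eq_smul_one]; simp [sub_eq_add_neg, add_comm]
  change dp R d _ = _
  rw [this, dp_add]
  refine Finset.sum_congr rfl fun p hp => ?_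
  change _ = _ • (elemSymm R d b p).1
  rw [elemSymm_val _ hp, dp_smul, dp_smul, smul_mul_smul_comm]

lemma map_elemSymm {R' B' : Type*} [CommRing R'] [CommRing B'] [Algebra R' B'] (φ : R →+* R')
    (ψ : B →+* B') (h : ψ.comp (algebraMap R B) = (algebraMap R' B').comp φ) (b : B) (p : ℕ × ℕ) :
    Gam.map φ ψ h d (elemSymm R d b p) = elemSymm R' d (ψ b) p := by
  rw [elemSymm, map_proj, map_mul, mapAll_dp, mapAll_dp, map_one]
  rfl

lemma map_gam {R' B' : Type*} [CommRing R'] [CommRing B'] [Algebra R' B'] (φ : R →+* R')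
    (ψ : B →+* B') (h : ψ.comp (algebraMap R B) = (algebraMap R' B').comp φ) (b : B) :
    Gam.map φ ψ h d (Gam.gam d R b) = Gam.gam d R' (ψ b) :=
  Subtype.ext (mapAll_dp ..)

variable {R B : Type u} [CommRing R] [CommRing B] [Algebra R B]

open Polynomial in
/-- The norm of the value of the characteristic polynomial is zero. -/
lemma norm_charElem (hd : d ≠ 0) (φ : Gam d R B →ₐ[R] R) (b : B) :
    φ (Gam.gam d R (charElem φ b)) = 0 := by
  nontriviality R
  let χ := charPoly φ b
  have hχ : χ.Monic := charPoly_monic φ b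
  have hdeg : χ.natDegree = d := le_antisymm (charPoly_natDegree_le φ b)
    (le_natDegree_of_ne_zero (by rw [charPoly_coeff]; exact one_ne_zero))
  -- Adjoin a root `t` of `χ`. Over `R'` the norm of `t - b` is `χ(t) = 0`, and `t - b` divides
  -- `χ(b) - χ(t) = χ(b)`, so the norm of `χ(b)` vanishes in `R'`.
  let R' := AdjoinRoot χ
  obtain ⟨φ', hφ'⟩ := Gam.exists_extension d ((Algebra.ofId R R').comp φ)
  let ψ : B →ₐ[R] R' ⊗[R] B := Algebra.TensorProduct.includeRight
  let t : R' := AdjoinRoot.root χ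
  have h1 : φ' (Gam.gam d R' (algebraMap R' (R' ⊗[R] B) t - ψ b)) = 0 := by
    rw [gam_sub, map_sum]
    have h2 : aeval t χ = 0 := by rw [aeval_def]; exact AdjoinRoot.eval₂_root χ
    rw [← h2]
    simp only [χ, charPoly, map_sum, aeval_monomial, map_smul, smul_eq_mul]
    refine Finset.sum_congr rfl fun p hp => ?_
    have h3 := hφ' (elemSymm R d b p)
    rw [map_elemSymm] at h3
    have h4 : φ' (elemSymm R' d (ψ b) p) = algebraMap R R' (φ (elemSymm R d b p)) := h3
    rw [h4]
    simp only [map_mul, map_pow, map_neg, map_one]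
    ring
  have h5 : algebraMap R R' (φ (Gam.gam d R (charElem φ b))) = 0 := by
    have h6 := hφ' (Gam.gam d R (charElem φ b))
    rw [map_gam] at h6
    refine Eq.trans h6.symm ?_
    have h7 : ψ (charElem φ b) = aeval (ψ b) χ - aeval (algebraMap R' (R' ⊗[R] B) t) χ := by
      rw [aeval_algebraMap_apply, aeval_algHom_apply, aeval_charPoly, aeval_def t]
      have : eval₂ (algebraMap R R') t χ = 0 := AdjoinRoot.eval₂_root χ
      rw [this, map_zero, sub_zero]
    obtain ⟨q, hq⟩ : (algebraMap R' (R' ⊗[R] B) t - ψ b) ∣ ψ (charElem φ b) := by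
      rw [h7, aeval_def, aeval_def, ← Polynomial.eval_map, ← Polynomial.eval_map, ← neg_dvd, neg_sub]
      exact sub_dvd_eval_sub _ _ _
    change φ' (Gam.gam d R' (ψ (charElem φ b))) = 0
    rw [hq, Gam.gam_mul, map_mul, h1, zero_mul]
  -- Descent to `R`: a nonzero constant is not divisible by the monic polynomial `χ` of degree `d >
  -- 0`. In degree `0` the statement fails over a nonzero ring, since the norm is then `1`.
  by_contra hne
  have h8 : AdjoinRoot.mk χ (C (φ (Gam.gam d R (charElem φ b)))) = 0 := h5
  rw [AdjoinRoot.mk_eq_zero] at h8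
  exact hχ.not_dvd_of_natDegree_lt (C_ne_zero.2 hne) (by rw [natDegree_C]; omega) h8

end Norm
end GammaAlgebra
end

noncomputable section
open scoped TensorProduct
open Finset.HasAntidiagonal (antidiagonal mem_antidiagonal)

namespace GammaAlgebra

/-! ### The Cayley–Hamilton theorem -/

section CayleyHamilton
variable {R B : Type*} [CommRing R] [CommRing B] [Algebra R B]

/-- The entries of a matrix have the same total by rows and by columns, so for `k ≠ l` the
multiplication formula is an empty sum. -/
lemma prod_eq_zero_of_ne {k l : ℕ} (hkl : k ≠ l) {a c : DivPow R B} (ha : a ∈ piece R k B)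
    (hc : c ∈ piece R l B) : prod R B a c = 0 := by
  induction ha using piece_induction with
  | zero => simp
  | add a a' _ _ h h' => simp [h, h']
  | smul r a _ h => simp [h]
  | mono n k' x hk =>
    induction hc using piece_induction with
    | zero => simp
    | add b b' _ _ h h' => simp [h, h']
    | smul r b _ h => simp [h]
    | mono m l' y hl =>
      rw [prod_mono_mono]
      refine Finset.sum_eq_zero fun ξ hξ => ?_
      rw [mem_margins] at hξ
      refine absurd ?_ hkl
      rw [← hk, ← hl, ← Finset.sum_congr rfl fun i _ => hξ.1 i, Finset.sum_comm]
      exact (Finset.sum_congr rfl fun i _ => hξ.2 i).symm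

section Times
variable {k e : ℕ} {K E : Type*} [CommRing K] [CommRing E] [Algebra R K] [Algebra R E]
  (f : K ≃ₐ[R] Gam k R B) (g : E ≃ₐ[R] Gam e R B) (φ : Gam (k + e) R B →ₐ[R] R)

variable (R B) in
/-- The inclusion `Γᵏ_R(B) ⊆ Γ_R(B)`. -/
def Gam.val (k : ℕ) : Gam k R B →ₗ[R] DivPow R B where
  toFun z := z.1
  map_add' _ _ := rfl
  map_smul' _ _ := rfl

/-- The component of degree `(k, e)` of the coproduct of `γⁱ(b) × γʲ(1)`. -/
def coElemSymm (b : B) (r : ℕ × ℕ) : K ⊗[R] E :=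
  ∑ p ∈ antidiagonal r.1, ∑ q ∈ antidiagonal r.2, if p.1 + q.1 = k then
    f.symm (elemSymm R k b (p.1, q.1)) ⊗ₜ g.symm (elemSymm R e b (p.2, q.2)) else 0

/-- The linear form on `Γᵏ_R(B) ⊗ Γᵉ_R(B)` given by a linear form on `Γᵏ⁺ᵉ_R(B)`. -/
def timesMap : K ⊗[R] E →ₗ[R] R :=
  φ.toLinearMap ∘ₗ proj R B (k + e) ∘ₗ LinearMap.mul' R _ ∘ₗ
    TensorProduct.map (Gam.val R B k ∘ₗ f.toLinearMap) (Gam.val R B e ∘ₗ g.toLinearMap)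

lemma timesMap_tmul (x : K) (y : E) :
    timesMap f g φ (x ⊗ₜ y) = φ (proj R B (k + e) ((f x).1 * (g y).1)) := rfl

/-- A projection formula. `K` and `E` are copies of `Γᵏ_R(B)` and `Γᵉ_R(B)`. Multiplying `x × y` by
`w` amounts to multiplying `x ⊗ y` by the coproduct of `w`, of which only the component of bidegree
`(k, e)` acts nontrivially. Hence `timesMap` replaces `coElemSymm` by the value of `φ`. -/
lemma timesMap_mul_coElemSymm (b : B) {r : ℕ × ℕ} (hr : r ∈ antidiagonal (k + e)) (z : K ⊗[R] E) :
    timesMap f g φ (z * coElemSymm f g b r) =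
      timesMap f g φ z * φ (elemSymm R (k + e) b r) := by
  induction z using TensorProduct.induction_on with
  | zero => simp
  | add z z' h h' => simp only [add_mul, map_add, h, h']
  | tmul x y =>
    let w : Gam (k + e) R B := ⟨(f x).1 * (g y).1, mul_mem (f x).2 (g y).2⟩
    have h0 : timesMap f g φ (x ⊗ₜ y) = φ w := congr_arg φ (proj_coe w)
    have h1 : (w * elemSymm R (k + e) b r).1 =
      prod R B ((f x).1 * (g y).1) (elemSymm R (k + e) b r).1 := rfl
    rw [h0, ← map_mul, ← proj_coe (w * elemSymm R (k + e) b r), h1, elemSymm_val _ hr, prod_mul,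
      coElemSymm, Finset.mul_sum, map_sum]
    rw [map_mul (comulHom R B), comulHom_dp, comulHom_dp, Finset.sum_mul_sum]
    simp only [map_sum, Finset.mul_sum]
    refine Finset.sum_congr rfl fun p hp => Finset.sum_congr rfl fun q hq => ?_
    rw [Algebra.TensorProduct.tmul_mul_tmul, TensorProduct.map_tmul, LinearMap.mul'_apply]
    split_ifs with h
    · rw [Algebra.TensorProduct.tmul_mul_tmul, timesMap_tmul, map_mul f, map_mul g, f.apply_symm_apply,
        g.apply_symm_apply]
      rw [mem_antidiagonal] at hp hq hr
      have h2 : (f x * elemSymm R k b (p.1, q.1)).1 =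
        prod R B (f x).1 (elemSymm R k b (p.1, q.1)).1 := rfl
      have h3 : (g y * elemSymm R e b (p.2, q.2)).1 =
        prod R B (g y).1 (elemSymm R e b (p.2, q.2)).1 := rfl
      rw [h2, h3, elemSymm_val _ (mem_antidiagonal.2 h),
        elemSymm_val _ (mem_antidiagonal.2 (by simp; omega))]
    · rw [prod_eq_zero_of_ne (Ne.symm h) (f x).2 (mul_mem (dp_mem _ _) (dp_mem _ _)), zero_mul,
        map_zero, map_zero, mul_zero, map_zero]

/-- The coproduct turns the characteristic polynomial of degree `k + e` into the product of those of
degrees `k` and `e`: the terms on both sides are indexed by the same four exponents. -/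
lemma sum_coElemSymm {C : Type*} [CommRing C] [Algebra (K ⊗[R] E) C]
    (b : B) (y : C) :
    (∑ p ∈ antidiagonal k, ((-1) ^ p.1 * f.symm (elemSymm R k b p) ⊗ₜ[R] (1 : E)) • y ^ p.2) *
      (∑ q ∈ antidiagonal e, ((-1) ^ q.1 * (1 : K) ⊗ₜ[R] g.symm (elemSymm R e b q)) • y ^ q.2) =
    ∑ r ∈ antidiagonal (k + e), ((-1) ^ r.1 * coElemSymm f g b r) • y ^ r.2 := by
  rw [Finset.sum_mul_sum]
  simp only [coElemSymm, Finset.mul_sum, Finset.sum_smul]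
  rw [Finset.sum_sigma', Finset.sum_sigma', Finset.sum_sigma']
  simp only [mul_ite, mul_zero, ite_smul, zero_smul]
  rw [← Finset.sum_filter]
  refine Finset.sum_nbij' (fun z => ⟨⟨(z.1.1 + z.2.1, z.1.2 + z.2.2), (z.1.1, z.2.1)⟩, (z.1.2, z.2.2)⟩)
    (fun z => ⟨(z.1.2.1, z.2.1), (z.1.2.2, z.2.2)⟩) ?_ ?_ ?_ ?_ ?_
  · rintro ⟨⟨a, b⟩, ⟨c, d⟩⟩
    simp
    omega
  · rintro ⟨⟨⟨a, b⟩, ⟨c, d⟩⟩, ⟨i, j⟩⟩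
    simp
    omega
  · rintro ⟨⟨a, b⟩, ⟨c, d⟩⟩
    simp
  · rintro ⟨⟨⟨a, b⟩, ⟨c, d⟩⟩, ⟨i, j⟩⟩
    simp
    omega
  · rintro ⟨⟨a, b⟩, ⟨c, d⟩⟩ _
    simp only [smul_mul_smul_comm, pow_add]
    congr 1
    rw [mul_mul_mul_comm, Algebra.TensorProduct.tmul_mul_tmul, one_mul, mul_one]

/-- The projection formula iterated over a monomial in the coefficients of the characteristic
polynomial. -/
lemma timesMap_prod_mul (b : B) (n : ℕ × ℕ → ℕ)
    (s : Finset (ℕ × ℕ)) (hs : s ⊆ antidiagonal (k + e)) (z : K ⊗[R] E) :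
    (timesMap f g φ ((∏ r ∈ s, ((-1) ^ r.1 * coElemSymm f g b r) ^ n r) * z)) =
      (∏ r ∈ s, ((-1) ^ r.1 * φ (elemSymm R (k + e) b r)) ^ n r) *
        (timesMap f g φ z) := by
  have h1 : ∀ r ∈ antidiagonal (k + e), ∀ m z, (timesMap f g φ
      (((-1) ^ r.1 * coElemSymm f g b r) ^ m * z)) =
      ((-1) ^ r.1 * φ (elemSymm R (k + e) b r)) ^ m * (timesMap f g φ z) := by
    intro r hr m
    induction m with
    | zero => simp
    | succ m ih =>
      intro z
      have h3 : (timesMap f g φ (((-1) ^ r.1 * coElemSymm f g b r) * z)) =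
          (-1) ^ r.1 * (timesMap f g φ (z * coElemSymm f g b r)) := by
        rcases Nat.even_or_odd r.1 with h | h <;> simp [h.neg_one_pow, mul_comm z]
      rw [pow_succ, mul_assoc, ih, h3, timesMap_mul_coElemSymm f g φ b hr]
      ring
  induction s using Finset.induction_on generalizing z with
  | empty => simp
  | insert r s hrs ih =>
    rw [Finset.prod_insert hrs, Finset.prod_insert hrs, mul_assoc,
      h1 r (hs (Finset.mem_insert_self r s)), ih fun x hx => hs (Finset.mem_insert_of_mem hx),
      mul_assoc]

end Times

variable {R B : Type u} [CommRing R] [CommRing B] [Algebra R B]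

/-- Separates the coefficients of a linear combination from its vectors; `timesMap_prod_mul` then
applies to each monomial in the coefficients. -/
lemma gam_sum_smul (d : ℕ) {ι : Type*} [DecidableEq ι] (s : Finset ι) (q : ι → R) (x : ι → B) :
    dp R d (∑ i ∈ s, q i • x i) = ∑ m ∈ s.sym d, (∏ i ∈ s, q i ^ Multiset.count i m) •
      ∏ i ∈ s, dp R (Multiset.count i m) (x i) :=
  DividedPowerAlgebra.dp_sum_smul ..

lemma prod_dp_count_mem (d : ℕ) {ι : Type*} [DecidableEq ι] {s : Finset ι} {m : Sym ι d}
    (hm : m ∈ s.sym d) (x : ι → B) : ∏ i ∈ s, dp R (Multiset.count i m) (x i) ∈ piece R d B := by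
  rw [← Finset.prod_coe_sort]
  refine mono_mem B (fun i : s => Multiset.count i.1 (m : Multiset ι)) (fun i : s => x i.1) ?_
  rw [Finset.sum_coe_sort s fun i => Multiset.count i (m : Multiset ι), Multiset.sum_count_eq_card]
  · exact m.2
  · intro a ha
    exact Finset.mem_sym_iff.1 hm a ha

/-- By `norm_charElem`, the tautological law of degree `k` over `K ⊗ E` kills `γᵏ` of its own
characteristic polynomial at `b`, hence also `γᵏ` of the product of that value with the one of
degree `e`. This product is the coproduct of the characteristic polynomial of degree `k + e`.
Expanding, multiplying by `1 ⊗ c` and applying `timesMap` gives the value of `φ` on `γᵏ(χ_b(b)) ×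
c`. -/
lemma charElem_mem_kerIdeal_aux {k e : ℕ} {K E : Type u} [CommRing K] [CommRing E] [Algebra R K]
    [Algebra R E] (f : K ≃ₐ[R] Gam k R B) (g : E ≃ₐ[R] Gam e R B) (φ : Gam (k + e) R B →ₐ[R] R)
    (b : B) (hk : k ≠ 0) (c : Gam e R B) :
    φ (proj R B (k + e) (dp R k (charElem φ b) * c.1)) = 0 := by
  let ψ : B →ₐ[R] (K ⊗[R] E) ⊗[R] B := Algebra.TensorProduct.includeRight
  -- `ν` is the identity of `Γᵏ_R(B)`, regarded as a law with values in `K ⊗ E` and extended to that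
  -- base.
  obtain ⟨ν, hν⟩ := Gam.exists_extension (R' := K ⊗[R] E) k
    ((Algebra.TensorProduct.includeLeft : K →ₐ[R] K ⊗[R] E).comp f.symm.toAlgHom)
  have h0 := norm_charElem hk ν (ψ b)
  have h1 : charElem ν (ψ b) = ∑ p ∈ antidiagonal k,
      ((-1) ^ p.1 * f.symm (elemSymm R k b p) ⊗ₜ[R] (1 : E)) • ψ b ^ p.2 := by
    refine Finset.sum_congr rfl fun p _ => ?_
    have h2 := hν (elemSymm R k b p)
    rw [map_elemSymm] at h2
    exact congr(((-1) ^ p.1 * $h2) • ψ b ^ p.2)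
  have h3 : ν (Gam.gam k _ (∑ r ∈ antidiagonal (k + e),
      ((-1) ^ r.1 * coElemSymm f g b r) • ψ b ^ r.2)) = 0 := by
    rw [← sum_coElemSymm, ← h1, Gam.gam_mul, map_mul, h0, zero_mul]
  have h4 : ν (Gam.gam k _ (∑ r ∈ antidiagonal (k + e),
      ((-1) ^ r.1 * coElemSymm f g b r) • ψ b ^ r.2)) =
      ∑ m ∈ (antidiagonal (k + e)).sym k,
        (∏ r ∈ antidiagonal (k + e), ((-1) ^ r.1 * coElemSymm f g b r) ^ Multiset.count r m) *
        f.symm (proj R B k (∏ r ∈ antidiagonal (k + e), dp R (Multiset.count r m) (b ^ r.2))) ⊗ₜ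
          1 := by
    rw [← proj_coe (Gam.gam k _ _)]
    change ν (proj _ _ k (dp _ _ _)) = _
    rw [gam_sum_smul, map_sum, map_sum]
    refine Finset.sum_congr rfl fun m hm => ?_
    rw [map_smul, map_smul, smul_eq_mul]
    congr 1
    have h5 := hν (proj R B k (∏ r ∈ antidiagonal (k + e), dp R (Multiset.count r m) (b ^ r.2)))
    rw [map_proj, map_prod] at h5
    simp only [mapAll_dp] at h5
    refine Eq.trans ?_ h5
    congr 3
    funext r
    exact congr(dp _ _ $((map_pow ψ b r.2).symm))
  rw [h3] at h4
  -- The relation lives in the first tensor factor; `1 ⊗ c` brings in the arbitrary second factor.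
  have h6 := congr(timesMap f g φ ($h4 * 1 ⊗ₜ g.symm c))
  rw [zero_mul, map_zero, Finset.sum_mul, map_sum] at h6
  refine Eq.trans ?_ h6.symm
  rw [charElem, gam_sum_smul, Finset.sum_mul, map_sum]
  refine (map_sum φ _ _).trans (Finset.sum_congr rfl fun m hm => ?_)
  rw [mul_assoc, timesMap_prod_mul _ _ _ _ _ _ subset_rfl, Algebra.TensorProduct.tmul_mul_tmul,
    one_mul, mul_one, timesMap_tmul, f.apply_symm_apply, g.apply_symm_apply, smul_mul_assoc,
    map_smul, map_smul, smul_eq_mul]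
  congr 4
  exact congr_arg Subtype.val (proj_coe (⟨_, prod_dp_count_mem k hm _⟩ : Gam k R B)).symm

/-- A Cayley–Hamilton theorem for multiplicative laws. -/
theorem charElem_mem_kerIdeal {d : ℕ} (φ : Gam d R B →ₐ[R] R) (b : B) :
    charElem φ b ∈ kerIdeal φ.toRingHom := by
  intro k hk c
  by_cases hd : d < k
  · rw [proj_dp_mul_of_lt hd, map_zero]
  obtain ⟨e, rfl⟩ := Nat.exists_eq_add_of_le (not_lt.1 hd)
  have := charElem_mem_kerIdeal_aux .refl .refl φ b hk (proj R B e c)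
  rwa [← proj_dp_mul, proj_coe] at this

end CayleyHamilton
end GammaAlgebra
end

noncomputable section
open scoped TensorProduct
open Finset.HasAntidiagonal (antidiagonal mem_antidiagonal)

namespace GammaAlgebra

/-! ### The ideal generated by the values of the characteristic polynomials -/

section CharIdeal
variable {R B : Type*} [CommRing R] [CommRing B] [Algebra R B] {d : ℕ}

/-- The ideal generated by the values of the characteristic polynomials. -/
def charIdeal (φ : Gam d R B →ₐ[R] R) : Ideal B := Ideal.span (Set.range (charElem φ))

lemma charIdeal_le_kerIdeal {R B : Type u} [CommRing R] [CommRing B] [Algebra R B]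
    (φ : Gam d R B →ₐ[R] R) : charIdeal φ ≤ kerIdeal φ.toRingHom := by
  rw [charIdeal, Ideal.span_le]
  rintro _ ⟨b, rfl⟩
  exact charElem_mem_kerIdeal φ b

/-- Modulo this ideal each `b` is a root of its own monic characteristic polynomial. -/
lemma isIntegral_quotient_charIdeal (φ : Gam d R B →ₐ[R] R) :
    ((Ideal.Quotient.mk (charIdeal φ)).comp (algebraMap R B)).IsIntegral := by
  intro x
  obtain ⟨b, rfl⟩ := Ideal.Quotient.mk_surjective x
  refine ⟨charPoly φ b, charPoly_monic φ b, ?_⟩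
  rw [← Polynomial.hom_eval₂, ← Polynomial.aeval_def, aeval_charPoly, Ideal.Quotient.eq_zero_iff_mem]
  exact Ideal.subset_span ⟨b, rfl⟩

/-- Each term is homogeneous in `b` of degree `i + j = d`. This serves to clear denominators in
`charIdeal_map`. -/
lemma charElem_smul (φ : Gam d R B →ₐ[R] R) (r : R) (b : B) :
    charElem φ (r • b) = r ^ d • charElem φ b := by
  rw [charElem, charElem, Finset.smul_sum]
  refine Finset.sum_congr rfl fun p hp => ?_
  have : elemSymm R d (r • b) p = algebraMap R _ (r ^ p.1) * elemSymm R d b p := by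
    rw [← Algebra.smul_def, elemSymm, dp_smul, smul_mul_assoc, map_smul]
    rfl
  rw [this, map_mul, AlgHom.commutes, smul_pow, smul_smul, smul_smul]
  have hd : r ^ d = r ^ p.1 * r ^ p.2 := by rw [← pow_add, mem_antidiagonal.1 hp]
  rw [hd]
  congr 1
  simp only [Algebra.algebraMap_self_apply]
  ring

variable {R' B' : Type*} [CommRing R'] [CommRing B'] [Algebra R' B'] (σ : R →+* R')
    (ψ : B →+* B') (h : ψ.comp (algebraMap R B) = (algebraMap R' B').comp σ)
    (φ : Gam d R B →ₐ[R] R) (φ' : Gam d R' B' →ₐ[R'] R')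

lemma map_charElem (hφ : ∀ z, φ' (Gam.map σ ψ h d z) = σ (φ z)) (b : B) :
    ψ (charElem φ b) = charElem φ' (ψ b) := by
  rw [charElem, charElem, map_sum]
  refine Finset.sum_congr rfl fun p _ => ?_
  rw [h_smul σ ψ h, ← map_elemSymm σ ψ h, hφ]
  simp

/-- The hypothesis on `ψ` is the one satisfied by localizations. By homogeneity the generator
belonging to `b'` agrees, up to the unit `uᵈ`, with the image of the generator belonging to `b`. -/
lemma charIdeal_map (hφ : ∀ z, φ' (Gam.map σ ψ h d z) = σ (φ z))
    (hψ : ∀ b', ∃ u : R', IsUnit u ∧ ∃ b, u • b' = ψ b) :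
    (charIdeal φ).map ψ = charIdeal φ' := by
  refine le_antisymm ?_ ?_
  · rw [charIdeal, Ideal.map_span, Ideal.span_le]
    rintro _ ⟨_, ⟨b, rfl⟩, rfl⟩
    rw [map_charElem σ ψ h φ φ' hφ]
    exact Ideal.subset_span ⟨_, rfl⟩
  · rw [charIdeal, Ideal.span_le]
    rintro _ ⟨b', rfl⟩
    obtain ⟨u, hu, b, hb⟩ := hψ b'
    have h1 : u ^ d • charElem φ' b' ∈ (charIdeal φ).map ψ := by
      rw [← charElem_smul, hb, ← map_charElem σ ψ h φ φ' hφ]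
      exact Ideal.mem_map_of_mem _ (Ideal.subset_span ⟨b, rfl⟩)
    rw [Algebra.smul_def] at h1
    exact (Ideal.unit_mul_mem_iff_mem _ ((hu.pow d).map _)).1 h1

end CharIdeal
end GammaAlgebra
end

noncomputable section
open CategoryTheory Limits AlgebraicGeometry Opposite GammaAlgebra

namespace GammaSpace

/-! ### Morphisms of schemes tested on affine schemes -/

section Gluing

/-- A morphism of schemes is determined by its composites with morphisms from affine schemes. -/
lemma hom_ext_of_Spec {W Y : Scheme.{u}} {m m' : W ⟶ Y}
    (h : ∀ (R : CommRingCat.{u}) (g : Spec R ⟶ W), g ≫ m = g ≫ m') : m = m' :=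
  W.affineCover.hom_ext _ _ fun i => h _ (W.affineCover.f i)

/-- A compatible family of morphisms from the affine schemes over `W` comes from a morphism. -/
lemma exists_hom_of_Spec {W Y : Scheme.{u}} (v : ∀ {R : CommRingCat.{u}}, (Spec R ⟶ W) → (Spec R ⟶ Y))
    (hv : ∀ {R R' : CommRingCat.{u}} (φ : R ⟶ R') (g : Spec R ⟶ W),
      Spec.map φ ≫ v g = v (Spec.map φ ≫ g)) :
    ∃ m : W ⟶ Y, ∀ (R : CommRingCat.{u}) (g : Spec R ⟶ W), g ≫ m = v g := by
  have hv' : ∀ {R R' : CommRingCat.{u}} (k : Spec R' ⟶ Spec R) (g : Spec R ⟶ W),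
      k ≫ v g = v (k ≫ g) := fun k g => by
    rw [← Spec.map_preimage k, hv]
  let 𝒰 : W.OpenCover := W.affineOpenCover.openCover
  let G (i : 𝒰.I₀) : Spec (W.affineOpenCover.X i) ⟶ W := W.affineOpenCover.f i
  let m : W ⟶ Y := 𝒰.glueMorphisms (fun i => v (G i)) fun i j => hom_ext_of_Spec fun R g => by
    have e : (g ≫ pullback.fst (𝒰.f i) (𝒰.f j)) ≫ G i = (g ≫ pullback.snd (𝒰.f i) (𝒰.f j)) ≫ G j :=
      (Category.assoc ..).trans (congr(g ≫ $(pullback.condition)).trans (Category.assoc ..).symm)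
    exact (Category.assoc ..).symm.trans
      (((hv' _ (G i)).trans ((congr_arg v e).trans (hv' _ (G j)).symm)).trans (Category.assoc ..))
  have hm : ∀ i, G i ≫ m = v (G i) := 𝒰.ι_glueMorphisms _ _
  refine ⟨m, fun R g => ?_⟩
  -- `g` need not factor through a member of the cover, so both sides are compared on the affine
  -- schemes over the pull-back of the cover along `g`.
  have key : ∀ (i : 𝒰.I₀) (R' : CommRingCat.{u}) (k : Spec R' ⟶ pullback g (G i)),
      k ≫ pullback.fst g (G i) ≫ g ≫ m = k ≫ pullback.fst g (G i) ≫ v g := by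
    intro i R' k
    have e : (k ≫ pullback.fst g (G i)) ≫ g = (k ≫ pullback.snd g (G i)) ≫ G i := by
      simp [pullback.condition]
    rw [← Category.assoc, ← Category.assoc k, hv' _ g, e, ← hv' _ (G i), ← hm, ← Category.assoc, e,
      Category.assoc]
  exact Scheme.Cover.hom_ext (𝒰.pullback₁ g) _ _ fun i => hom_ext_of_Spec fun R' k => key i R' k

end Gluing

/-! ### Base change of `Γᵈ` over schemes -/

section BaseChange
variable {R R' : CommRingCat.{u}} {P P' : Scheme.{u}} (d : ℕ)

lemma isPushout_functionRing {p : P ⟶ Spec R} {p' : P' ⟶ Spec R'} [IsAffineHom p] (φ : R ⟶ R')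
    (m : P' ⟶ P) (h : IsPullback m p' p (Spec.map φ)) :
    IsPushout (CommRingCat.ofHom φ.hom) (CommRingCat.ofHom (algebraMap R (FunctionRing p)))
      (CommRingCat.ofHom (algebraMap R' (FunctionRing p')))
      (CommRingCat.ofHom (FunctionRing.map p p' m)) := by
  have : IsAffine P := isAffine_of_isAffineHom p
  have h1 := (isPushout_appTop_of_isPullback h).flip
  refine h1.of_iso (Scheme.ΓSpecIso R) (Scheme.ΓSpecIso R') (Iso.refl _) (Iso.refl _) ?_ ?_ ?_ ?_
  · exact Scheme.ΓSpecIso_naturality φ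
  · exact (Category.comp_id _).trans (Iso.hom_inv_id_assoc (Scheme.ΓSpecIso R) p.appTop).symm
  · exact (Category.comp_id _).trans (Iso.hom_inv_id_assoc (Scheme.ΓSpecIso R') p'.appTop).symm
  · exact (Category.comp_id _).trans (Category.id_comp _).symm

variable {X S : Presh.{u}} {f : X ⟶ S}

lemma isPullback_prodMap (hf : IsAffineMor f) {T T' : Scheme.{u}} (g : T' ⟶ T)
    (s : yon.obj T ⟶ S) (s' : yon.obj T' ⟶ S) (h) :
    IsPullback (prodMap hf hf (𝟙 X) (𝟙 S) (by simp) s' s g h) (hf.rep.snd s') (hf.rep.snd s) g := by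
  have e : yon.map g ≫ s = s' := by simpa using h
  have : prodMap hf hf (𝟙 X) (𝟙 S) (by simp) s' s g h = Family.baseChange hf s s' g e :=
    hf.rep.hom_ext (by simp) (by simp)
  rw [this]
  exact Family.isPullback_baseChange g e

/-- `Gam.isPushout` for the cartesian square relating `X ×_S Spec R'` to `X ×_S Spec R`. The
representability of `Γᵈ(X/S)` over affine schemes rests on it. -/
lemma isPushout_baseMap (hf : IsAffineMor f) (φ : R ⟶ R') (s : yon.obj (Spec R) ⟶ S)
    (s' : yon.obj (Spec R') ⟶ S) (hs : yon.map (Spec.map φ) ≫ s = s') :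
    IsPushout φ (gamOver.ι d hf s) (gamOver.ι d hf s')
      (CommRingCat.ofHom (baseMap d hf φ s s' hs)) := by
  have : IsAffineHom (hf.rep.snd s) := hf.property_snd s
  exact Gam.isPushout d φ.hom _ _
    (isPushout_functionRing φ _ (isPullback_prodMap hf (Spec.map φ) s s' (by simpa using hs)))

lemma baseMap_baseMap {R'' : CommRingCat.{u}} (hf : IsAffineMor f) (φ : R ⟶ R') (φ' : R' ⟶ R'')
    (φ'' : R ⟶ R'') (hφ : φ ≫ φ' = φ'') (s : yon.obj (Spec R) ⟶ S) (s' : yon.obj (Spec R') ⟶ S)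
    (s'' : yon.obj (Spec R'') ⟶ S) (hs hs' hs'' z) :
    baseMap d hf φ' s' s'' hs' (baseMap d hf φ s s' hs z) = baseMap d hf φ'' s s'' hs'' z :=
  gamMap_comp d _ _ _ _ _ _ _ _ _ hφ
    (prodMap_comp _ _ _ _ _ _ _ _ _ _ _ _ _ _ _ _ _ _ _ _ _ (by simp) (by simp [← hφ])) z

end BaseChange

end GammaSpace
end

noncomputable section
open CategoryTheory Limits AlgebraicGeometry Opposite GammaAlgebra

namespace GammaSpace

/-! ### Cartesian squares tested on points -/

section Points

lemma uliftYonedaEquiv_symm_app {F : Presh.{u}} {T W : Scheme.{u}} (x : yon.obj T ⟶ F) (g : W ⟶ T) :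
    x.app (op W) ⟨g⟩ = uliftYonedaEquiv (yon.map g ≫ x) := by
  rw [uliftYonedaEquiv_comp]
  congr 1

/-- A square is cartesian if it is so on points with values in schemes. -/
lemma isPullback_of_points {F G : Presh.{u}} {P V : Scheme.{u}} {q : yon.obj P ⟶ F} {p : P ⟶ V}
    {π : F ⟶ G} {t : yon.obj V ⟶ G} (w : q ≫ π = yon.map p ≫ t)
    (hsurj : ∀ (W : Scheme.{u}) (x : yon.obj W ⟶ F) (y : W ⟶ V), x ≫ π = yon.map y ≫ t →
      ∃ m : W ⟶ P, yon.map m ≫ q = x ∧ m ≫ p = y)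
    (hinj : ∀ (W : Scheme.{u}) (m m' : W ⟶ P), yon.map m ≫ q = yon.map m' ≫ q → m ≫ p = m' ≫ p →
      m = m') : IsPullback q (yon.map p) π t := by
  refine IsPullback.of_forall_isPullback_app fun ⟨W⟩ => ?_
  rw [Types.isPullback_iff]
  refine ⟨congr(($w).app (op W)), ?_, ?_⟩
  · rintro ⟨m⟩ ⟨m'⟩ ⟨h₁, h₂⟩
    refine ULift.ext _ _ (hinj W m m' ?_ congr(($h₂).down))
    apply uliftYonedaEquiv.injective
    rw [← uliftYonedaEquiv_symm_app, ← uliftYonedaEquiv_symm_app]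
    exact h₁
  · rintro x ⟨y⟩ h
    obtain ⟨m, h₁, h₂⟩ := hsurj W (uliftYonedaEquiv.symm x) y (by
      apply uliftYonedaEquiv.injective
      rw [uliftYonedaEquiv_comp, Equiv.apply_symm_apply, ← uliftYonedaEquiv_symm_app]
      exact h)
    refine ⟨⟨m⟩, ?_, ULift.ext _ _ h₂⟩
    rw [uliftYonedaEquiv_symm_app, h₁, Equiv.apply_symm_apply]

end Points

/-! ### The tautological point over an affine scheme -/

section Taut
variable {X S : Presh.{u}} {f : X ⟶ S} (d : ℕ) (hf : IsAffineMor f) {R : CommRingCat.{u}}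
  (t : yon.obj (Spec R) ⟶ S)

lemma toPoint_map_comp {T T' : Scheme.{u}} {hf : IsAffineMor f} (x : yon.obj T ⟶ gammaSpace d hf)
    (g : T' ⟶ T) : toPoint (yon.map g ≫ x) = (toPoint x).restrict g :=
  (uliftYonedaEquiv_naturality (F := gammaSpace d hf) x g.op).symm

section
variable {d hf t}

lemma gamOver_hom_ext (hf : IsAffineMor f) {R' R'' : CommRingCat.{u}} {φ : R ⟶ R'} {s : yon.obj (Spec R') ⟶ S}
    (hs : yon.map (Spec.map φ) ≫ t = s) {u v : GamRing d (hf.rep.snd s) →+* R''}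
    (h : ∀ r, u (algebraMap R' _ r) = v (algebraMap R' _ r))
    (h' : ∀ z, u (baseMap d hf φ t s hs z) = v (baseMap d hf φ t s hs z)) : u = v := by
  have : CommRingCat.ofHom u = CommRingCat.ofHom v := by
    refine (isPushout_baseMap d hf φ t s hs).hom_ext ?_ ?_
    · exact CommRingCat.hom_ext (RingHom.ext h)
    · exact CommRingCat.hom_ext (RingHom.ext h')
  exact congr(($this).hom)

end

/-- The homomorphism `Γᵈ_R'(B') → R'` which extends a homomorphism `Γᵈ_R(B) → R'`. -/
def tautApp {R' : CommRingCat.{u}} (s : yon.obj (Spec R') ⟶ S) (g : gamOver d hf t ⟶ R')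
    (h : yon.map (Spec.map (gamOver.ι d hf t ≫ g)) ≫ t = s) : gamOver d hf s ⟶ R' :=
  (isPushout_baseMap d hf (gamOver.ι d hf t ≫ g) t s h).desc (𝟙 _) g (by simp)

lemma tautApp_algebraMap {R' : CommRingCat.{u}} (s : yon.obj (Spec R') ⟶ S)
    (g : gamOver d hf t ⟶ R') (h) (r : R') : (tautApp d hf t s g h).hom (algebraMap R' _ r) = r :=
  congr(($((isPushout_baseMap d hf (gamOver.ι d hf t ≫ g) t s h).inl_desc (𝟙 _) g (by simp))).hom r)

lemma tautApp_baseMap {R' : CommRingCat.{u}} (s : yon.obj (Spec R') ⟶ S)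
    (g : gamOver d hf t ⟶ R') (φ : R ⟶ R') (hφ : gamOver.ι d hf t ≫ g = φ) (h) (h') (z) :
    (tautApp d hf t s g h).hom (baseMap d hf φ t s h' z) = g.hom z := by
  subst hφ
  exact congr(($((isPushout_baseMap d hf (gamOver.ι d hf t ≫ g) t s h).inr_desc (𝟙 _) g (by simp))).hom z)

/-- The tautological point of `Γᵈ(X/S)` over `Spec Γᵈ_R(B)`. -/
def tautPoint : GammaPoint d hf (Spec (gamOver d hf t)) where
  base := yon.map (Spec.map (gamOver.ι d hf t)) ≫ t
  app s g h := (tautApp d hf t s (Spec.preimage g) (by simpa using h)).hom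
  app_algebraMap s g h r := tautApp_algebraMap ..
  app_baseMap {R' R''} φ s s' hs g h g' h' hg z := by
    have h₁ : yon.map (Spec.map (gamOver.ι d hf t ≫ Spec.preimage g)) ≫ t = s := by simpa using h
    have h₂ : yon.map (Spec.map (gamOver.ι d hf t ≫ Spec.preimage g')) ≫ t = s' := by simpa using h'
    have : (tautApp d hf t s' (Spec.preimage g') h₂).hom.comp (baseMap d hf φ s s' hs) =
        φ.hom.comp (tautApp d hf t s (Spec.preimage g) h₁).hom := by
      have e : Spec.preimage g ≫ φ = Spec.preimage g' := by
        apply Spec.map_injective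
        simp [hg]
      refine gamOver_hom_ext hf h₁ (fun r => ?_) fun z => ?_
      · rw [RingHom.comp_apply, RingHom.comp_apply, tautApp_algebraMap, baseMap, gamMap_algebraMap]
        exact tautApp_algebraMap ..
      · rw [RingHom.comp_apply, RingHom.comp_apply, tautApp_baseMap _ _ _ _ _ _ rfl,
          baseMap_baseMap d hf _ φ (gamOver.ι d hf t ≫ Spec.preimage g') (by rw [← e, Category.assoc])
            t s s' h₁ hs h₂, tautApp_baseMap _ _ _ _ _ _ rfl, ← e]
        rfl
    exact congr($this z)

/-- The tautological morphism `Spec Γᵈ_R(B) ⟶ Γᵈ(X/S)`. -/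
def taut : yon.obj (Spec (gamOver d hf t)) ⟶ gammaSpace d hf := uliftYonedaEquiv.symm (tautPoint d hf t)

lemma toPoint_taut : toPoint (taut d hf t) = tautPoint d hf t := Equiv.apply_symm_apply _ _

lemma taut_π : taut d hf t ≫ gammaSpace.π d hf = yon.map (Spec.map (gamOver.ι d hf t)) ≫ t := by
  rw [← toPoint_base, toPoint_taut]
  rfl

variable {d hf t} in
lemma toPoint_map_taut_app {W : Scheme.{u}} (m : W ⟶ Spec (gamOver d hf t)) {R' : CommRingCat.{u}}
    (g : Spec R' ⟶ W) (φ : R ⟶ R') (hφ : Spec.map φ = g ≫ m ≫ Spec.map (gamOver.ι d hf t))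
    (s : yon.obj (Spec R') ⟶ S) (h) (h') (z) :
    (toPoint (yon.map m ≫ taut d hf t)).app s g h (baseMap d hf φ t s h' z) =
      (Spec.preimage (g ≫ m)).hom z := by
  have e : ∀ (x y : GammaPoint d hf W) (_ : x = y) (h) (h') (z), x.app s g h z = y.app s g h' z := by
    rintro x _ rfl _ _ _; rfl
  have hb : yon.map g ≫ ((tautPoint d hf t).restrict m).base = s := by
    rw [← h, toPoint_map_comp, toPoint_taut]
  rw [e _ ((tautPoint d hf t).restrict m) (by rw [toPoint_map_comp, toPoint_taut]) h hb]
  refine tautApp_baseMap _ _ _ _ _ _ ?_ _ _ _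
  apply Spec.map_injective
  simp [hφ]

/-- A point over `W ⟶ Spec R` gives, for each `Spec R' ⟶ W`, a homomorphism `Γᵈ_R'(B') → R'`. By
base change it amounts to an `R`-algebra homomorphism `Γᵈ_R(B) → R'`, that is, a morphism `Spec R' ⟶
Spec Γᵈ_R(B)`, and these are compatible, so they come from a morphism on `W`. -/
lemma isPullback_taut :
    IsPullback (taut d hf t) (yon.map (Spec.map (gamOver.ι d hf t))) (gammaSpace.π d hf) t := by
  refine isPullback_of_points (taut_π d hf t) (fun W x w hw => ?_) fun W m m' h₁ h₂ => ?_
  · have hb : (toPoint x).base = yon.map w ≫ t := by rw [toPoint_base, hw]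
    have hs : ∀ {R' : CommRingCat.{u}} (g : Spec R' ⟶ W),
        yon.map (Spec.map (Spec.preimage (g ≫ w))) ≫ t = yon.map g ≫ (toPoint x).base := fun g => by
      rw [Spec.map_preimage, hb, Functor.map_comp, Category.assoc]
    let u {R' : CommRingCat.{u}} (g : Spec R' ⟶ W) : gamOver d hf t ⟶ R' :=
      CommRingCat.ofHom (((toPoint x).app _ g rfl).comp (baseMap d hf _ t _ (hs g)))
    have hu : ∀ {R' : CommRingCat.{u}} (g : Spec R' ⟶ W),
        gamOver.ι d hf t ≫ u g = Spec.preimage (g ≫ w) := by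
      intro R' g
      ext r
      have : baseMap d hf _ t _ (hs g) (algebraMap R _ r) = _ := gamMap_algebraMap ..
      exact (congr_arg ((toPoint x).app _ g rfl) this).trans ((toPoint x).app_algebraMap ..)
    obtain ⟨m, hm⟩ := exists_hom_of_Spec (fun {R'} g => Spec.map (u g)) (fun {R' R''} φ g => by
      rw [← Spec.map_comp]
      congr 1
      ext z
      have e : yon.map (Spec.map φ) ≫ yon.map g ≫ (toPoint x).base =
        yon.map (Spec.map φ ≫ g) ≫ (toPoint x).base := by simp
      refine ((toPoint x).app_baseMap φ _ _ e g rfl (Spec.map φ ≫ g) rfl rfl _).symm.trans ?_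
      refine congr_arg ((toPoint x).app _ (Spec.map φ ≫ g) rfl) ?_
      refine baseMap_baseMap d hf _ _ _ ?_ _ _ _ _ _ _ _
      apply Spec.map_injective
      simp)
    have hmw : m ≫ Spec.map (gamOver.ι d hf t) = w := by
      refine hom_ext_of_Spec fun R' g => ?_
      rw [← Category.assoc, hm, ← Spec.map_comp, hu, Spec.map_preimage]
    refine ⟨m, ?_, hmw⟩
    apply toPoint_injective
    have hb' : (toPoint (yon.map m ≫ taut d hf t)).base = (toPoint x).base := by
      rw [toPoint_base, Category.assoc, taut_π, hb, ← hmw, Functor.map_comp, Category.assoc]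
    refine GammaPoint.ext' hb' fun R' s g h₁ h₂ z => ?_
    have hs' : yon.map (Spec.map (Spec.preimage (g ≫ w))) ≫ t = s := (hs g).trans h₂
    refine congr($(gamOver_hom_ext hf hs' (u := (toPoint (yon.map m ≫ taut d hf t)).app s g h₁)
      (v := (toPoint x).app s g h₂) (fun r => ?_) fun z => ?_) z)
    · rw [GammaPoint.app_algebraMap, GammaPoint.app_algebraMap]
    · rw [toPoint_map_taut_app m g _ (by rw [hmw, Spec.map_preimage]), hm, Spec.preimage_map]
      subst h₂
      rfl
  -- Uniqueness: evaluating the point on the image of `baseMap` recovers the ring homomorphism that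
  -- defines the morphism.
  · refine hom_ext_of_Spec fun R' g => ?_
    rw [← Spec.map_preimage (g ≫ m), ← Spec.map_preimage (g ≫ m')]
    congr 1
    ext z
    have hs : yon.map (Spec.map (Spec.preimage (g ≫ m ≫ Spec.map (gamOver.ι d hf t)))) ≫ t =
        yon.map g ≫ (toPoint (yon.map m ≫ taut d hf t)).base := by
      rw [Spec.map_preimage, toPoint_base, Category.assoc, taut_π]
      simp
    have e₁ := toPoint_map_taut_app m g _ (Spec.map_preimage _) _ rfl hs z
    have e₂ := toPoint_map_taut_app m' g _ ((Spec.map_preimage _).trans (by rw [h₂]))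
      (yon.map g ≫ (toPoint (yon.map m ≫ taut d hf t)).base) (by rw [h₁]) hs z
    rw [← e₁, ← e₂]
    have : ∀ (x y : yon.obj W ⟶ gammaSpace d hf) (_ : x = y) (s) (h) (h') (z),
        (toPoint x).app s g h z = (toPoint y).app s g h' z := by
      rintro x _ rfl _ _ _ _; rfl
    exact this _ _ h₁ _ _ _ _

end Taut
end GammaSpace
end

noncomputable section
open CategoryTheory Limits AlgebraicGeometry Opposite GammaAlgebra

namespace GammaSpace

/-! ### Descent for `Γᵈ(X/S)` -/

section Sheaf

/-- The sheaf condition in terms of morphisms out of representable presheaves. -/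
lemma isSheaf_of_existsUnique {F : Presh.{u}} {J : GrothendieckTopology Scheme.{u}}
    (H : ∀ (W : Scheme.{u}) (T : Sieve W), T ∈ J W →
      ∀ z : ∀ (V : Scheme.{u}) (k : V ⟶ W), T k → (yon.obj V ⟶ F),
      (∀ (V V' : Scheme.{u}) (k : V ⟶ W) (hk : T k) (l : V' ⟶ V) (hl : T (l ≫ k)),
        z V' (l ≫ k) hl = yon.map l ≫ z V k hk) →
      ∃! y : yon.obj W ⟶ F, ∀ (V : Scheme.{u}) (k : V ⟶ W) (hk : T k), yon.map k ≫ y = z V k hk) :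
    Presieve.IsSheaf J F := by
  intro W T hT x hx
  rw [Presieve.compatible_iff_sieveCompatible] at hx
  obtain ⟨y, hy, hy'⟩ := H W T hT (fun V k hk => uliftYonedaEquiv.{u + 1}.symm (x k hk))
    fun V V' k hk l hl => (congr_arg uliftYonedaEquiv.{u + 1}.symm (hx k l hk)).trans
      (uliftYonedaEquiv_symm_map.{u + 1} l.op (x k hk))
  refine ⟨uliftYonedaEquiv.{u + 1} y, fun V k hk => ?_, fun b hb => ?_⟩
  · exact (uliftYonedaEquiv_naturality.{u + 1} y k.op).trans
      ((congr_arg uliftYonedaEquiv.{u + 1} (hy V k hk)).trans (Equiv.apply_symm_apply _ _))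
  · refine (Equiv.symm_apply_eq _).1 (hy' (uliftYonedaEquiv.{u + 1}.symm b) fun V k hk => ?_)
    exact (uliftYonedaEquiv_symm_map.{u + 1} k.op b).symm.trans
      (congr_arg uliftYonedaEquiv.{u + 1}.symm (hb k hk))

lemma existsUnique_of_isSheaf {F : Presh.{u}} {J : GrothendieckTopology Scheme.{u}}
    (hF : Presieve.IsSheaf J F) {W : Scheme.{u}} {T : Sieve W} (hT : T ∈ J W)
    (z : ∀ (V : Scheme.{u}) (k : V ⟶ W), T k → (yon.obj V ⟶ F))
    (hz : ∀ (V V' : Scheme.{u}) (k : V ⟶ W) (hk : T k) (l : V' ⟶ V) (hl : T (l ≫ k)),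
      z V' (l ≫ k) hl = yon.map l ≫ z V k hk) :
    ∃! y : yon.obj W ⟶ F, ∀ (V : Scheme.{u}) (k : V ⟶ W) (hk : T k), yon.map k ≫ y = z V k hk := by
  let x : Presieve.FamilyOfElements F T.arrows := fun V k hk => uliftYonedaEquiv.{u + 1} (z V k hk)
  have hx : x.SieveCompatible := fun V V' k l hk =>
    (congr_arg uliftYonedaEquiv.{u + 1} (hz _ _ k hk l _)).trans
      (uliftYonedaEquiv_naturality.{u + 1} (z V k hk) l.op).symm
  obtain ⟨b, hb, hb'⟩ := hF T hT x ((Presieve.compatible_iff_sieveCompatible _).2 hx)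
  refine ⟨uliftYonedaEquiv.{u + 1}.symm b, fun V k hk => ?_, fun y hy => ?_⟩
  · exact ((uliftYonedaEquiv_symm_map.{u + 1} k.op b).symm.trans
      (congr_arg uliftYonedaEquiv.{u + 1}.symm (hb k hk))).trans (Equiv.symm_apply_apply _ _)
  · refine (Equiv.eq_symm_apply _).2 (hb' _ fun V k hk => ?_)
    exact (uliftYonedaEquiv_naturality.{u + 1} y k.op).trans
      (congr_arg uliftYonedaEquiv.{u + 1} (hy V k hk))

variable {X S : Presh.{u}} {f : X ⟶ S} (d : ℕ) (hf : IsAffineMor f)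
  (J : GrothendieckTopology Scheme.{u}) [J.Subcanonical]

/-- By `isPullback_taut`, points lying over `k ≫ t` are morphisms to `Spec Γᵈ_R(B)` over `Spec R`,
and these glue because the topology is subcanonical. -/
lemma existsUnique_amalgamation_over_Spec {R : CommRingCat.{u}} (t : yon.obj (Spec R) ⟶ S)
    (T : Sieve (Spec R)) (hT : T ∈ J (Spec R))
    (z : ∀ {V : Scheme.{u}} (k : V ⟶ Spec R), T k → (yon.obj V ⟶ gammaSpace d hf))
    (hz : ∀ {V : Scheme.{u}} (k : V ⟶ Spec R) (hk : T k), z k hk ≫ gammaSpace.π d hf = yon.map k ≫ t)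
    (hz' : ∀ {V W : Scheme.{u}} (k : V ⟶ Spec R) (hk : T k) (l : W ⟶ V) (hl : T (l ≫ k)),
      z (l ≫ k) hl = yon.map l ≫ z k hk) :
    ∃! y : yon.obj (Spec R) ⟶ gammaSpace d hf, y ≫ gammaSpace.π d hf = t ∧
      ∀ {V : Scheme.{u}} (k : V ⟶ Spec R) (hk : T k), yon.map k ≫ y = z k hk := by
  have hP := isPullback_taut d hf t
  have hsh : Presieve.IsSheaf J (yoneda.obj (Spec (gamOver d hf t))) :=
    GrothendieckTopology.Subcanonical.isSheaf_of_isRepresentable _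
  have hsep : ∀ m m' : Spec R ⟶ Spec (gamOver d hf t),
      (∀ {V : Scheme.{u}} (k : V ⟶ Spec R), T k → k ≫ m = k ≫ m') → m = m' := fun m m' h =>
    (hsh T hT).isSeparatedFor.ext fun V k hk => h k hk
  have hsep' : ∀ m : Spec R ⟶ Spec R, (∀ {V : Scheme.{u}} (k : V ⟶ Spec R), T k → k ≫ m = k) →
      m = 𝟙 _ := fun m h =>
    ((GrothendieckTopology.Subcanonical.isSheaf_of_isRepresentable (J := J)
      (yoneda.obj (Spec R))) T hT).isSeparatedFor.ext fun V k hk =>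
        (h k hk).trans (Category.comp_id k).symm
  let v : Presieve.FamilyOfElements (yoneda.obj (Spec (gamOver d hf t))) T.arrows := fun V k hk =>
    yon.preimage (hP.lift (z k hk) (yon.map k) (hz k hk))
  have hv : ∀ {V : Scheme.{u}} (k : V ⟶ Spec R) (hk : T k),
      yon.map (v k hk) = hP.lift (z k hk) (yon.map k) (hz k hk) := fun k hk => yon.map_preimage _
  have hv' : v.Compatible := by
    rw [Presieve.compatible_iff_sieveCompatible]
    intro V W k l hk
    apply yon.map_injective
    change _ = yon.map (l ≫ v k hk)
    rw [Functor.map_comp, hv, hv]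
    apply hP.hom_ext
    · rw [IsPullback.lift_fst, Category.assoc, IsPullback.lift_fst, hz' k hk]
    · rw [IsPullback.lift_snd, Category.assoc, IsPullback.lift_snd, Functor.map_comp]
  obtain ⟨m, hm, -⟩ := hsh T hT v hv'
  have hm : ∀ {V : Scheme.{u}} (k : V ⟶ Spec R) (hk : T k), k ≫ m = v k hk := fun k hk => hm k hk
  have hmR : m ≫ Spec.map (gamOver.ι d hf t) = 𝟙 _ := by
    refine hsep' _ fun k hk => ?_
    rw [← Category.assoc, hm k hk]
    apply yon.map_injective
    rw [Functor.map_comp, hv, IsPullback.lift_snd]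
  refine ⟨yon.map m ≫ taut d hf t, ⟨?_, fun k hk => ?_⟩, ?_⟩
  · rw [Category.assoc, taut_π, ← Functor.map_comp_assoc, hmR]
    simp
  · rw [← Functor.map_comp_assoc, hm k hk, hv, IsPullback.lift_fst]
  · rintro y ⟨hy, hy'⟩
    have h₁ : yon.map (yon.preimage (hP.lift y (𝟙 _) (by simpa using hy))) = _ := yon.map_preimage _
    have : m = yon.preimage (hP.lift y (𝟙 _) (by simpa using hy)) := by
      refine hsep _ _ fun k hk => ?_
      rw [hm k hk]
      apply yon.map_injective
      rw [hv, Functor.map_comp, h₁]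
      apply hP.hom_ext
      · rw [IsPullback.lift_fst, Category.assoc, IsPullback.lift_fst, hy' k hk]
      · simp
    rw [this, h₁, IsPullback.lift_fst]


variable {d hf} in
/-- Points of `Γᵈ(X/S)` with values in `W` are compatible families of points over the affine
schemes over `W`. -/
lemma existsUnique_of_Spec {W : Scheme.{u}} (β : yon.obj W ⟶ S)
    (y : ∀ (R : CommRingCat.{u}), (Spec R ⟶ W) → (yon.obj (Spec R) ⟶ gammaSpace d hf))
    (hy : ∀ (R : CommRingCat.{u}) (g : Spec R ⟶ W), y R g ≫ gammaSpace.π d hf = yon.map g ≫ β)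
    (hyn : ∀ (R R' : CommRingCat.{u}) (φ : R ⟶ R') (g : Spec R ⟶ W),
      yon.map (Spec.map φ) ≫ y R g = y R' (Spec.map φ ≫ g)) :
    ∃! p : yon.obj W ⟶ gammaSpace d hf, p ≫ gammaSpace.π d hf = β ∧
      ∀ (R : CommRingCat.{u}) (g : Spec R ⟶ W), yon.map g ≫ p = y R g := by
  have happ : ∀ {V : Scheme.{u}} (p q : GammaPoint d hf V) (_ : p = q) {R : CommRingCat.{u}}
      (s : yon.obj (Spec R) ⟶ S) (g : Spec R ⟶ V) (h h' c), p.app s g h c = q.app s g h' c := by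
    rintro V p _ rfl R s g _ _ _
    rfl
  have hbase : ∀ {R : CommRingCat.{u}} (g : Spec R ⟶ W),
      (toPoint (y R g)).base = yon.map g ≫ β := fun g => by rw [toPoint_base, hy _ g]
  -- The value of the glued point at `g : Spec R ⟶ W` is that of `y R g` at the identity of `Spec
  -- R`.
  let p : GammaPoint d hf W :=
    { base := β
      app := fun {R} s g h => (toPoint (y R g)).app s (𝟙 _) (by rw [hbase, ← h]; simp)
      app_algebraMap := fun s g h r => GammaPoint.app_algebraMap ..
      app_baseMap := fun {R R'} φ s s' hs g h g' h' hg c => by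
        have e : toPoint (y R' g') = (toPoint (y R g)).restrict (Spec.map φ) := by
          rw [← toPoint_map_comp, hyn, hg]
        refine (happ _ _ e s' (𝟙 _) _ (by rw [← e, hbase, ← h']; simp) _).trans ?_
        exact (toPoint (y R g)).app_baseMap φ s s' hs (𝟙 _) _ (𝟙 _ ≫ Spec.map φ) _ (by simp) c }
  have hP : toPoint (uliftYonedaEquiv.{u + 1}.symm p : yon.obj W ⟶ gammaSpace d hf) = p :=
    Equiv.apply_symm_apply _ _
  refine ⟨(uliftYonedaEquiv.{u + 1}.symm p : yon.obj W ⟶ gammaSpace d hf),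
    ⟨?_, fun R g => ?_⟩, fun q hq => ?_⟩
  · exact (toPoint_base _).symm.trans (congr_arg GammaPoint.base hP)
  · apply toPoint_injective
    refine ((toPoint_map_comp d _ g).trans (congr_arg (fun z => GammaPoint.restrict z g) hP)).trans ?_
    refine GammaPoint.ext' (hbase g).symm fun R' s k h₁ h₂ c => ?_
    have hk : ∃ φ, k = Spec.map φ := ⟨_, (Spec.map_preimage k).symm⟩
    obtain ⟨φ, rfl⟩ := hk
    have e : toPoint (y R' (Spec.map φ ≫ g)) = (toPoint (y R g)).restrict (Spec.map φ) := by
      rw [← toPoint_map_comp, hyn]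
    refine (happ _ _ e s (𝟙 _) _ (by rw [← e, hbase, ← h₁]; simp [GammaPoint.restrict, p]) c).trans ?_
    exact (toPoint (y R g)).app_congr (Category.id_comp _) _ _ c
  · apply toPoint_injective
    rw [hP]
    have hqb : (toPoint q).base = β := by rw [toPoint_base, hq.1]
    refine GammaPoint.ext' hqb fun R s g h₁ h₂ c => ?_
    have e : toPoint (y R g) = (toPoint q).restrict g := by
      rw [← toPoint_map_comp, hq.2]
    refine ((happ _ _ e s (𝟙 _) (by rw [hbase, ← h₂]; simp [p])
      (by rw [← e, hbase, ← h₂]; simp [p]) c).trans ?_).symm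
    exact (toPoint q).app_congr (Category.id_comp g) _ _ c

/-- The base morphisms glue because `S` is a sheaf. Over each `Spec R ⟶ W` the pulled back sieve
gives a unique amalgamation; uniqueness makes these compatible, and compatible points over affine
schemes form a point over `W`. -/
lemma isSheaf_gammaSpace (hS : Presieve.IsSheaf J S) : Presieve.IsSheaf J (gammaSpace d hf) := by
  refine isSheaf_of_existsUnique fun W T hT z hz => ?_
  obtain ⟨β, hβ, hβ'⟩ := existsUnique_of_isSheaf hS hT (fun V k hk => z V k hk ≫ gammaSpace.π d hf)
    fun V V' k hk l hl => by rw [hz _ _ k hk l hl, Category.assoc]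
  have hzc : ∀ {V : Scheme.{u}} (m m' : V ⟶ W) (_ : m = m') (h : T m) (h' : T m'),
      z V m h = z V m' h' := by
    rintro V m _ rfl _ _; rfl
  have hy : ∀ (R : CommRingCat.{u}) (g : Spec R ⟶ W), ∃! y : yon.obj (Spec R) ⟶ gammaSpace d hf,
      y ≫ gammaSpace.π d hf = yon.map g ≫ β ∧
      ∀ (V : Scheme.{u}) (k : V ⟶ Spec R) (hk : T (k ≫ g)), yon.map k ≫ y = z V (k ≫ g) hk :=
    fun R g => existsUnique_amalgamation_over_Spec d hf J (yon.map g ≫ β) (T.pullback g)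
      (J.pullback_stable g hT) (fun {V} k hk => z V (k ≫ g) hk)
      (fun k hk => by
        refine (hβ _ _ hk).symm.trans ?_
        rw [Functor.map_comp, Category.assoc])
      (fun {V V'} k hk l hl => (hzc _ _ (Category.assoc l k g) hl
        (T.downward_closed hk l)).trans (hz _ _ (k ≫ g) hk l _))
  choose y hy hy' using hy
  have hyn : ∀ (R R' : CommRingCat.{u}) (φ : R ⟶ R') (g : Spec R ⟶ W),
      yon.map (Spec.map φ) ≫ y R g = y R' (Spec.map φ ≫ g) := by
    intro R R' φ g
    refine hy' R' (Spec.map φ ≫ g) _ ⟨?_, fun V k hk => ?_⟩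
    · rw [Category.assoc, (hy R g).1, Functor.map_comp, Category.assoc]
    · rw [← Functor.map_comp_assoc]
      exact ((hy R g).2 V (k ≫ Spec.map φ) (by rwa [Category.assoc])).trans
        (hzc _ _ (Category.assoc ..) _ _)
  obtain ⟨p, ⟨hp, hpy⟩, hp'⟩ := existsUnique_of_Spec β y (fun R g => (hy R g).1) hyn
  refine ⟨p, fun V k hk => ?_, fun q hq => hp' q ⟨?_, fun R g => hy' R g (yon.map g ≫ q) ⟨?_, fun V k hk => ?_⟩⟩⟩
  -- `V` need not be affine, so the two points are identified through their restrictions to the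
  -- affine schemes over `V`.
  · obtain ⟨r, -, hr'⟩ := existsUnique_of_Spec (yon.map k ≫ β) (fun R g => y R (g ≫ k))
      (fun R g => by rw [(hy _ _).1, Functor.map_comp, Category.assoc])
      (fun R R' φ g => by rw [hyn, Category.assoc])
    refine (hr' _ ⟨by rw [Category.assoc, hp], fun R g => ?_⟩).trans
      (hr' _ ⟨(hβ V k hk).symm, fun R g => ?_⟩).symm
    · rw [← Functor.map_comp_assoc, hpy]
    -- Since `g ≫ k` lies in the sieve, the identity of `Spec R` lies in the pulled back sieve,
    -- where the amalgamation is known.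
    · rw [← hz V _ k hk g (T.downward_closed hk g), ← Category.id_comp (y R (g ≫ k)),
        ← yon.map_id, (hy R (g ≫ k)).2 _ (𝟙 _) (by
          rw [Category.id_comp]; exact T.downward_closed hk g)]
      exact hzc _ _ (Category.id_comp _).symm _ _
  · exact hβ' _ fun V k hk => by rw [← hq V k hk, Category.assoc]
  · rw [Category.assoc]
    congr 1
    exact hβ' _ fun V k hk => by rw [← hq V k hk, Category.assoc]
  · rw [← Functor.map_comp_assoc, hq]

end Sheaf
end GammaSpace
end

noncomputable section
open CategoryTheory Limits AlgebraicGeometry Opposite GammaAlgebra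

namespace GammaSpace

/-! ### Zariski gluing of morphisms to a sheaf -/

section ZariskiGluing
variable {F : Presh.{u}} {W : Scheme.{u}}

lemma hom_ext_of_openCover (hF : Presieve.IsSheaf Scheme.zariskiTopology F) (𝒰 : W.OpenCover) {x y : yon.obj W ⟶ F}
    (h : ∀ i, yon.map (𝒰.f i) ≫ x = yon.map (𝒰.f i) ≫ y) : x = y := by
  apply uliftYonedaEquiv.{u + 1}.injective
  have h' : (Presieve.ofArrows 𝒰.X 𝒰.f).IsSheafFor F := by
    rw [Presieve.isSheafFor_iff_generate]
    exact hF _ 𝒰.mem_grothendieckTopology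
  refine h'.isSeparatedFor.ext fun V k hk => ?_
  obtain ⟨i, rfl, rfl⟩ := Presieve.ofArrows_surj _ _ hk
  refine (uliftYonedaEquiv_naturality.{u + 1} x (eqToHom _ ≫ 𝒰.f i).op).trans
    (Eq.trans ?_ (uliftYonedaEquiv_naturality.{u + 1} y (eqToHom _ ≫ 𝒰.f i).op).symm)
  refine congr_arg uliftYonedaEquiv.{u + 1} ?_
  change yon.map (_ ≫ 𝒰.f i) ≫ x = yon.map (_ ≫ 𝒰.f i) ≫ y
  rw [Functor.map_comp, Category.assoc, h, Category.assoc]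

/-- Gluing of morphisms along an open cover. -/
lemma exists_of_openCover (hF : Presieve.IsSheaf Scheme.zariskiTopology F) (𝒰 : W.OpenCover) (z : ∀ i, yon.obj (𝒰.X i) ⟶ F)
    (hz : ∀ (i j : 𝒰.I₀) (V : Scheme.{u}) (k : V ⟶ 𝒰.X i) (l : V ⟶ 𝒰.X j), k ≫ 𝒰.f i = l ≫ 𝒰.f j →
      yon.map k ≫ z i = yon.map l ≫ z j) :
    ∃ y : yon.obj W ⟶ F, ∀ i, yon.map (𝒰.f i) ≫ y = z i := by
  have h : (Presieve.ofArrows 𝒰.X 𝒰.f).IsSheafFor F := by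
    rw [Presieve.isSheafFor_iff_generate]
    exact hF _ 𝒰.mem_grothendieckTopology
  rw [Presieve.isSheafFor_arrows_iff] at h
  obtain ⟨b, hb, -⟩ := h (fun i => uliftYonedaEquiv.{u + 1} (z i)) fun i j V k l e =>
    (uliftYonedaEquiv_naturality.{u + 1} (z i) k.op).trans
      ((congr_arg uliftYonedaEquiv.{u + 1} (hz i j V k l e)).trans
      (uliftYonedaEquiv_naturality.{u + 1} (z j) l.op).symm)
  refine ⟨uliftYonedaEquiv.{u + 1}.symm b, fun i => ?_⟩
  exact ((uliftYonedaEquiv_symm_map.{u + 1} (𝒰.f i).op b).symm.trans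
      (congr_arg uliftYonedaEquiv.{u + 1}.symm (hb i))).trans (Equiv.symm_apply_apply _ _)

/-- Gluing of morphisms along a locally directed open cover. -/
lemma exists_of_locallyDirected (hF : Presieve.IsSheaf Scheme.zariskiTopology F) (𝒰 : W.OpenCover) [Category 𝒰.I₀] [𝒰.LocallyDirected]
    (z : ∀ i, yon.obj (𝒰.X i) ⟶ F)
    (hz : ∀ (i j : 𝒰.I₀) (k : i ⟶ j), yon.map (𝒰.trans k) ≫ z j = z i) :
    ∃ y : yon.obj W ⟶ F, ∀ i, yon.map (𝒰.f i) ≫ y = z i := by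
  refine exists_of_openCover hF 𝒰 z fun i j V k l e => ?_
  have : yon.map (pullback.fst (𝒰.f i) (𝒰.f j)) ≫ z i = yon.map (pullback.snd (𝒰.f i) (𝒰.f j)) ≫ z j := by
    refine hom_ext_of_openCover hF (𝒰.intersectionOfLocallyDirected i j) fun m => ?_
    rw [← Functor.map_comp_assoc, ← Functor.map_comp_assoc]
    refine (congr_arg (fun k => yon.map k ≫ z i) (pullback.lift_fst _ _ _)).trans (Eq.trans ?_
      (congr_arg (fun k => yon.map k ≫ z j) (pullback.lift_snd _ _ _)).symm)
    exact (hz _ _ m.2.1).trans (hz _ _ m.2.2).symm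
  have h := congr(yon.map (pullback.lift k l e) ≫ $this)
  rwa [← Functor.map_comp_assoc, ← Functor.map_comp_assoc, pullback.lift_fst, pullback.lift_snd] at h

end ZariskiGluing

/-! ### Relative spectra -/

section RelativeSpec
open Scheme.AffineZariskiSite
variable {W : Scheme.{u}} {A : W.AffineZariskiSiteᵒᵖ ⥤ CommRingCat.{u}}
  {α : (toOpensFunctor W).op ⋙ W.presheaf ⟶ A}

/-- The morphism from the spectrum of the ring of an affine open subscheme. -/
def affineFromSpec (U : W.AffineZariskiSite) : Spec Γ(W, U.toOpens) ⟶ W := IsAffineOpen.fromSpec U.2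

/-- The restriction of functions to a smaller affine open subscheme. -/
def affineRes {U V : W.AffineZariskiSite} (h : U ⟶ V) : Γ(W, V.toOpens) ⟶ Γ(W, U.toOpens) :=
  W.presheaf.map ((toOpensFunctor W).map h).op

lemma affineRes_fromSpec {U V : W.AffineZariskiSite} (h : U ⟶ V) :
    Spec.map (affineRes h) ≫ affineFromSpec V = affineFromSpec U :=
  V.2.map_fromSpec U.2 _

lemma affineRes_id (U : W.AffineZariskiSite) : affineRes (𝟙 U) = 𝟙 _ := W.presheaf.map_id _

lemma affineRes_comp {U V V' : W.AffineZariskiSite} (h : U ⟶ V) (h' : V ⟶ V') :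
    affineRes h' ≫ affineRes h = affineRes (h ≫ h') := (W.presheaf.map_comp _ _).symm

/-- The relative spectrum of a quasi-coherent algebra which is given on the affine open
subschemes. -/
lemma exists_relativeSpec (H : α.Coequifibered) :
    ∃ (P : Scheme.{u}) (p : P ⟶ W) (m : ∀ U : W.AffineZariskiSite, Spec (A.obj (op U)) ⟶ P),
      (∀ U, IsPullback (m U) (Spec.map (α.app (op U))) p (affineFromSpec U)) ∧
      (∀ (U V : W.AffineZariskiSite) (h : U ⟶ V), Spec.map (A.map h.op) ≫ m V = m U) ∧
      ∀ (F : Presh.{u}) (_ : Presieve.IsSheaf Scheme.zariskiTopology F)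
        (z : ∀ U : W.AffineZariskiSite, yon.obj (Spec (A.obj (op U))) ⟶ F)
        (_ : ∀ (U V : W.AffineZariskiSite) (h : U ⟶ V), yon.map (Spec.map (A.map h.op)) ≫ z V = z U),
        ∃ y : yon.obj P ⟶ F, ∀ U, yon.map (m U) ≫ y = z U := by
  let D := relativeGluingData H
  have : (D.functor ⋙ Scheme.forget).IsLocallyDirected :=
    Scheme.Cover.RelativeGluingData.instIsLocallyDirectedI₀CompFunctorForgetOfIsThin ..
  have h1 : ∀ U : W.AffineZariskiSite, Spec.map (α.app (op U)) ≫ U.2.isoSpec.inv =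
      D.natTrans.app U := fun U => rfl
  refine ⟨D.glued, D.toBase, fun U => D.cover.f U, fun U => ?_, fun U V h => ?_,
    fun F hF z hz => ?_⟩
  · have h2 := (D.isPullback_natTrans_ι_toBase U).flip
    -- The gluing data are formed over the open subschemes `U` themselves; `isoSpec` replaces these
    -- by `Spec Γ(W, U)`.
    refine h2.of_iso (Iso.refl _) (Iso.refl _) U.2.isoSpec (Iso.refl _) ?_ ?_ ?_ ?_
    · exact (Category.comp_id _).trans (Category.id_comp _).symm
    · rw [Iso.refl_hom, ← h1]
      exact (Category.assoc _ _ _).trans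
        ((congr_arg (Spec.map (α.app (op U)) ≫ ·) U.2.isoSpec.inv_hom_id).trans
          ((Category.comp_id _).trans (Category.id_comp _).symm))
    · exact (Category.comp_id _).trans (Category.id_comp _).symm
    · exact (Category.comp_id _).trans ((Iso.hom_inv_id_assoc U.2.isoSpec _).symm.trans rfl)
  · exact colimit.w D.functor h
  · exact exists_of_locallyDirected hF D.cover z hz

end RelativeSpec
end GammaSpace
end

noncomputable section
open CategoryTheory Limits AlgebraicGeometry Opposite GammaAlgebra

namespace GammaSpace

/-! ### Properties and cartesian squares local on the base -/

section Local
variable {W : Scheme.{u}}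

/-- The cover of a scheme by the spectra of the rings of its affine open subschemes. -/
def affineSpecCover (W : Scheme.{u}) : W.OpenCover where
  I₀ := W.AffineZariskiSite
  X U := Spec Γ(W, U.1)
  f U := affineFromSpec U
  mem₀ := by
    rw [Scheme.presieve₀_mem_precoverage_iff]
    refine ⟨fun x => ?_, fun U => U.2.isOpenImmersion_fromSpec⟩
    obtain ⟨U, hxU⟩ := TopologicalSpace.Opens.mem_iSup.mp
      ((iSup_affineOpens_eq_top W).ge (Set.mem_univ x))
    refine ⟨U, ?_⟩
    have := U.2.range_fromSpec
    exact this.ge hxU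

lemma of_openCover_of_isPullback {Q : MorphismProperty Scheme.{u}} [IsZariskiLocalAtTarget Q]
    (𝒰 : W.OpenCover) {P : Scheme.{u}} {p : P ⟶ W} {Pi : 𝒰.I₀ → Scheme.{u}} (m : ∀ i, Pi i ⟶ P)
    (pi : ∀ i, Pi i ⟶ 𝒰.X i) (h : ∀ i, IsPullback (m i) (pi i) p (𝒰.f i)) (H : ∀ i, Q (pi i)) :
    Q p := by
  refine IsZariskiLocalAtTarget.of_openCover 𝒰 fun i => ?_
  refine (Q.arrow_mk_iso_iff ?_).1 (H i)
  exact Arrow.isoMk ((h i).isoIsPullback _ _ (IsPullback.of_hasPullback p (𝒰.f i))) (Iso.refl _)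
    (IsPullback.isoIsPullback_hom_snd _ _ (h i) _)

/-- For a cartesian square, the inverse images of the members of an open cover form a cover. -/
lemma hom_ext_of_isPullback {F : Presh.{u}} (hF : Presieve.IsSheaf Scheme.zariskiTopology F)
    (𝒰 : W.OpenCover) {P : Scheme.{u}} {p : P ⟶ W} {Pi : 𝒰.I₀ → Scheme.{u}} (m : ∀ i, Pi i ⟶ P)
    (pi : ∀ i, Pi i ⟶ 𝒰.X i) (h : ∀ i, IsPullback (m i) (pi i) p (𝒰.f i)) {x y : yon.obj P ⟶ F}
    (H : ∀ i, yon.map (m i) ≫ x = yon.map (m i) ≫ y) : x = y := by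
  refine hom_ext_of_openCover hF (𝒰.pullback₁ p) fun i => ?_
  have e : (𝒰.pullback₁ p).f i = (h i).lift (pullback.fst _ _) (pullback.snd _ _)
    pullback.condition ≫ m i := ((h i).lift_fst _ _ _).symm
  rw [e]
  generalize (h i).lift _ _ _ = k
  exact (congr_arg (· ≫ x) (yon.map_comp k (m i))).trans ((Category.assoc _ _ _).trans
    ((congr_arg (yon.map k ≫ ·) (H i)).trans ((Category.assoc _ _ _).symm.trans
    (congr_arg (· ≫ y) (yon.map_comp k (m i)).symm))))

variable {F G : Presh.{u}}

/-- For a Zariski sheaf `F`, a square over `W` is cartesian if it is so over the members of an open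
cover of `W`. -/
lemma isPullback_of_openCover (hF : Presieve.IsSheaf Scheme.zariskiTopology F)
    {π : F ⟶ G} {t : yon.obj W ⟶ G} (𝒰 : W.OpenCover) {P : Scheme.{u}} {p : P ⟶ W}
    {q : yon.obj P ⟶ F} (w : q ≫ π = yon.map p ≫ t)
    {Pi : 𝒰.I₀ → Scheme.{u}} (m : ∀ i, Pi i ⟶ P)
    (pi : ∀ i, Pi i ⟶ 𝒰.X i) (h : ∀ i, IsPullback (m i) (pi i) p (𝒰.f i))
    (h' : ∀ i, IsPullback (yon.map (m i) ≫ q) (yon.map (pi i)) π (yon.map (𝒰.f i) ≫ t)) :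
    IsPullback q (yon.map p) π t := by
  -- Uniqueness is local on `V`. It is also the reason why the local lifts constructed below agree
  -- on overlaps.
  have hinj : ∀ (V : Scheme.{u}) (n n' : V ⟶ P), yon.map n ≫ q = yon.map n' ≫ q → n ≫ p = n' ≫ p →
      n = n' := by
    intro V n n' h₁ h₂
    refine Scheme.Cover.hom_ext (𝒰.pullback₁ (n ≫ p)) _ _ fun i => ?_
    change pullback.fst (n ≫ p) (𝒰.f i) ≫ n = pullback.fst (n ≫ p) (𝒰.f i) ≫ n'
    have e : (pullback.fst (n ≫ p) (𝒰.f i) ≫ n) ≫ p = pullback.snd (n ≫ p) (𝒰.f i) ≫ 𝒰.f i := by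
      rw [Category.assoc, pullback.condition]
    have e' : (pullback.fst (n ≫ p) (𝒰.f i) ≫ n') ≫ p = pullback.snd (n ≫ p) (𝒰.f i) ≫ 𝒰.f i := by
      rw [Category.assoc, ← h₂, pullback.condition]
    have : (h i).lift _ _ e = (h i).lift _ _ e' := by
      apply yon.map_injective
      apply (h' i).hom_ext
      · rw [← Functor.map_comp_assoc, ← Functor.map_comp_assoc, IsPullback.lift_fst,
          IsPullback.lift_fst, Functor.map_comp, Functor.map_comp, Category.assoc, Category.assoc, h₁]
      · rw [← Functor.map_comp, ← Functor.map_comp, IsPullback.lift_snd, IsPullback.lift_snd]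
    rw [← (h i).lift_fst _ _ e, this, IsPullback.lift_fst]
  refine isPullback_of_points w (fun V x v hx => ?_) hinj
  have hxi : ∀ i, (yon.map (pullback.fst v (𝒰.f i)) ≫ x) ≫ π =
      yon.map (pullback.snd v (𝒰.f i)) ≫ yon.map (𝒰.f i) ≫ t := fun i => by
    rw [Category.assoc, hx, ← Functor.map_comp_assoc, ← Functor.map_comp_assoc, pullback.condition]
  let n (i : 𝒰.I₀) : pullback v (𝒰.f i) ⟶ Pi i := yon.preimage ((h' i).lift _ _ (hxi i))
  have hn : ∀ i, yon.map (n i) = (h' i).lift _ _ (hxi i) := fun i => yon.map_preimage _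
  have hn₁ : ∀ i, yon.map (n i ≫ m i) ≫ q = yon.map (pullback.fst v (𝒰.f i)) ≫ x := fun i => by
    rw [Functor.map_comp, Category.assoc, hn, IsPullback.lift_fst]
  have hn₂ : ∀ i, (n i ≫ m i) ≫ p = pullback.fst v (𝒰.f i) ≫ v := fun i => by
    have : n i ≫ pi i = pullback.snd v (𝒰.f i) := by
      apply yon.map_injective
      rw [Functor.map_comp, hn, IsPullback.lift_snd]
    rw [Category.assoc, (h i).w, ← Category.assoc, this, pullback.condition]
  let 𝒱 := 𝒰.pullback₁ v
  let nm (i : 𝒱.I₀) : 𝒱.X i ⟶ P := n i ≫ m i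
  have hnm₁ : ∀ i, yon.map (nm i) ≫ q = yon.map (𝒱.f i) ≫ x := hn₁
  have hnm₂ : ∀ i, nm i ≫ p = 𝒱.f i ≫ v := hn₂
  let N : V ⟶ P := Scheme.Cover.glueMorphisms 𝒱 nm fun i j => hinj _ _ _
    (by rw [Functor.map_comp, Category.assoc, hnm₁, Functor.map_comp, Category.assoc, hnm₁,
      ← Functor.map_comp_assoc, ← Functor.map_comp_assoc, pullback.condition])
    (by rw [Category.assoc, hnm₂, Category.assoc, hnm₂, pullback.condition_assoc])
  have hN : ∀ i, 𝒱.f i ≫ N = nm i := Scheme.Cover.ι_glueMorphisms _ _ _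
  refine ⟨N, hom_ext_of_openCover hF 𝒱 fun i => ?_, Scheme.Cover.hom_ext 𝒱 _ _ fun i => ?_⟩
  · rw [← Functor.map_comp_assoc, hN, hnm₁]
  · rw [← Category.assoc, hN, hnm₂]

end Local

/-! ### Affineness of `Γᵈ(X/S)` over `S` -/

section
variable {X S : Presh.{u}} {f : X ⟶ S} (d : ℕ) (hf : IsAffineMor f)

/-- A point is determined by its values on the image of `Γᵈ_R(B)`, and there both sides are given by
`baseMap`. Hence the tautological points glue over a base that is not affine. -/
lemma map_baseMap_taut {R R' : CommRingCat.{u}} (φ : R ⟶ R') (t : yon.obj (Spec R) ⟶ S)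
    (t' : yon.obj (Spec R') ⟶ S) (ht) :
    yon.map (Spec.map (CommRingCat.ofHom (baseMap d hf φ t t' ht))) ≫ taut d hf t = taut d hf t' := by
  have hι : CommRingCat.ofHom (algebraMap R (GamRing d (hf.rep.snd t))) ≫
      CommRingCat.ofHom (baseMap d hf φ t t' ht) = φ ≫ gamOver.ι d hf t' :=
    (isPushout_baseMap d hf φ t t' ht).w.symm
  have hm : Spec.map (CommRingCat.ofHom (baseMap d hf φ t t' ht)) ≫ Spec.map (gamOver.ι d hf t) =
      Spec.map (gamOver.ι d hf t') ≫ Spec.map φ := by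
    rw [← Spec.map_comp, ← Spec.map_comp]
    exact congr_arg Spec.map hι
  apply toPoint_injective
  refine GammaPoint.ext' ?_ fun R'' s g h₁ h₂ z => ?_
  · rw [toPoint_base, toPoint_base, Category.assoc, taut_π, taut_π, ← Functor.map_comp_assoc, hm,
      Functor.map_comp, Category.assoc, ht]
  · have hs : yon.map (Spec.map (gamOver.ι d hf t' ≫ Spec.preimage g)) ≫ t' = s := by
      rw [← h₂, toPoint_base, taut_π]
      simp
    have hs' : yon.map (Spec.map (φ ≫ gamOver.ι d hf t' ≫ Spec.preimage g)) ≫ t = s := by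
      rw [Spec.map_comp, Functor.map_comp, Category.assoc, ht, hs]
    refine congr($(gamOver_hom_ext hf hs' (u := (toPoint _).app s g h₁)
      (v := (toPoint (taut d hf t')).app s g h₂) (fun r => ?_) fun z => ?_) z)
    · rw [GammaPoint.app_algebraMap, GammaPoint.app_algebraMap]
    · rw [toPoint_map_taut_app _ g _ (by rw [hm]; simp [Spec.map_comp])]
      have e : ∀ (x y : GammaPoint d hf (Spec (gamOver d hf t'))) (_ : x = y) (h) (h') (z),
          x.app s g h z = y.app s g h' z := by
        rintro x _ rfl _ _ _; rfl
      rw [e (toPoint (taut d hf t')) (toPoint (yon.map (𝟙 _) ≫ taut d hf t')) (by simp) _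
        (by simpa using h₂), ← baseMap_baseMap d hf φ _ _ rfl t t' s ht hs hs',
        toPoint_map_taut_app (𝟙 _) g _ (by simp)]
      have : Spec.preimage (g ≫ Spec.map (CommRingCat.ofHom (baseMap d hf φ t t' ht))) =
          CommRingCat.ofHom (baseMap d hf φ t t' ht) ≫ Spec.preimage (g ≫ 𝟙 _) := by
        apply Spec.map_injective
        simp
      rw [this]
      rfl

lemma baseMap_id {R : CommRingCat.{u}} (φ : R ⟶ R) (hφ : φ = 𝟙 R) (t : yon.obj (Spec R) ⟶ S) (ht) (z) :
    baseMap d hf φ t t ht z = z :=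
  gamMap_id d _ _ _ hφ (hf.rep.hom_ext (by simp) (by simp [hφ])) z

open Scheme.AffineZariskiSite
variable {W : Scheme.{u}} (t : yon.obj W ⟶ S)

lemma affineRes_base {U V : W.AffineZariskiSite} (h : U ⟶ V) :
    yon.map (Spec.map (affineRes h)) ≫ yon.map (affineFromSpec V) ≫ t =
      yon.map (affineFromSpec U) ≫ t := by
  rw [← Functor.map_comp_assoc, affineRes_fromSpec]

/-- The algebra `Γᵈ(f_* 𝒪_X)` on the affine open subschemes of an `S`-scheme. -/
def gamFunctor : W.AffineZariskiSiteᵒᵖ ⥤ CommRingCat.{u} where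
  obj U := gamOver d hf (yon.map (affineFromSpec U.unop) ≫ t)
  map h := CommRingCat.ofHom (baseMap d hf (affineRes h.unop) _ _ (affineRes_base t h.unop))
  map_id _ := CommRingCat.hom_ext (RingHom.ext fun z =>
    baseMap_id d hf _ (affineRes_id _) _ (affineRes_base t (𝟙 _)) z)
  map_comp h h' := CommRingCat.hom_ext (RingHom.ext fun z => (baseMap_baseMap d hf _ _ _
    (affineRes_comp h'.unop h.unop) _ _ _ (affineRes_base t h.unop) (affineRes_base t h'.unop)
    (affineRes_base t (h'.unop ≫ h.unop)) z).symm)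

/-- The structure homomorphism `𝒪 ⟶ Γᵈ(f_* 𝒪_X)`. -/
def gamFunctor.ι : (toOpensFunctor W).op ⋙ W.presheaf ⟶ gamFunctor d hf t where
  app U := (gamOver.ι d hf (yon.map (affineFromSpec U.unop) ≫ t) :)
  naturality _ _ h := (isPushout_baseMap d hf (affineRes h.unop)
    _ _ (affineRes_base t h.unop)).w

/-- Base change along restriction maps is the quasi-coherence of `Γᵈ(f_* 𝒪_X)`, needed for its
relative spectrum. -/
lemma gamFunctor.coequifibered : (gamFunctor.ι d hf t).Coequifibered := fun _ _ h =>
  (isPushout_baseMap d hf (affineRes h.unop) _ _ (affineRes_base t h.unop) :)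

/-- Over `W ⟶ S` the spectra of `gamFunctor` glue to a scheme `P` affine over `W`, and the
tautological points glue to a point of `Γᵈ(X/S)` over `P`. The resulting square is cartesian since
it is so over affine open subschemes, by `isPullback_taut`. -/
lemma isAffineMor_π (hΓ : Presieve.IsSheaf Scheme.zariskiTopology (gammaSpace d hf))
    (hS : Presieve.IsSheaf Scheme.zariskiTopology S) :
    IsAffineMor (gammaSpace.π d hf) := by
  have : IsZariskiLocalAtTarget (@IsAffineHom : MorphismProperty Scheme.{u}) :=
    @HasAffineProperty.instIsZariskiLocalAtTarget (@IsAffineHom) _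
      instHasAffinePropertyIsAffineHomIsAffine
  have : MorphismProperty.RespectsIso (@IsAffineHom : MorphismProperty Scheme.{u}) :=
    MorphismProperty.IsStableUnderBaseChange.respectsIso
  refine MorphismProperty.relative.of_exists fun W t => ?_
  obtain ⟨P, p, m, hm, hP⟩ : ∃ (P : Scheme.{u}) (p : P ⟶ W)
      (m : ∀ U : W.AffineZariskiSite, Spec (gamOver d hf (yon.map (affineFromSpec U) ≫ t)) ⟶ P),
      (∀ U, IsPullback (m U) (Spec.map (gamOver.ι d hf (yon.map (affineFromSpec U) ≫ t))) p
        (affineFromSpec U)) ∧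
      ∃ q : yon.obj P ⟶ gammaSpace d hf, ∀ U, yon.map (m U) ≫ q = taut d hf _ := by
    obtain ⟨P, p, m, hm, -, hP⟩ := exists_relativeSpec (gamFunctor.coequifibered d hf t)
    exact ⟨P, p, m, hm, hP _ hΓ (fun U => taut d hf (yon.map (affineFromSpec U) ≫ t))
      fun U V h => map_baseMap_taut ..⟩
  obtain ⟨q, hq⟩ := hP
  refine ⟨P, q, p, isPullback_of_openCover hΓ (affineSpecCover W) ?_ m _ hm
    fun (U : W.AffineZariskiSite) => ?_, of_openCover_of_isPullback (Q := @IsAffineHom)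
    (affineSpecCover W) m _ hm fun (U : W.AffineZariskiSite) => isAffineHom_of_isAffine (Spec.map _)⟩
  · refine hom_ext_of_isPullback hS (affineSpecCover W) m _ hm fun (U : W.AffineZariskiSite) => ?_
    rw [← Category.assoc, hq, taut_π, ← Functor.map_comp_assoc, ← (hm U).w, Functor.map_comp,
      Category.assoc]
  · rw [hq]
    exact isPullback_taut d hf _

end

end GammaSpace
end

noncomputable section
open CategoryTheory Limits AlgebraicGeometry Opposite GammaAlgebra

namespace GammaSpace

/-! ### Spaces affine over an algebraic space -/

section AlgebraicSpace

instance : Scheme.etaleTopology.{u}.Subcanonical :=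
  GrothendieckTopology.Subcanonical.of_le Scheme.etaleTopology_le_proetaleTopology

variable {F S : Presh.{u}} {π : F ⟶ S}

/-- If `S` has a representable diagonal and `F ⟶ S` is affine, then `F` has a representable
diagonal. -/
lemma IsAffineMor.diag (hπ : IsAffineMor π) (hS : yon.relativelyRepresentable (Limits.diag S)) :
    yon.relativelyRepresentable (Limits.diag F) := by
  refine Functor.relativelyRepresentable.diag_of_map_from_obj fun a x b y => ?_
  -- The fibre product `c` of `a` and `b` over `S` is a scheme. The two points of `F` become
  -- sections `s₁`, `s₂` of the scheme `F ×_S c` over `c`, and the fibre product over `F` is their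
  -- equalizer.
  have hr : yon.relativelyRepresentable (x ≫ π) := Functor.relativelyRepresentable.of_diag hS _
  let c := hr.pullback (y ≫ π)
  let c₁ : yon.obj c ⟶ yon.obj a := hr.fst (y ≫ π)
  let c₂ : c ⟶ b := hr.snd (y ≫ π)
  have hc : IsPullback c₁ (yon.map c₂) (x ≫ π) (y ≫ π) := hr.isPullback _
  have hc' : (c₁ ≫ x) ≫ π = (yon.map c₂ ≫ y) ≫ π := by
    rw [Category.assoc, Category.assoc, hc.w]
  let P := hπ.rep.pullback ((c₁ ≫ x) ≫ π)
  let s₁ : c ⟶ P := hπ.rep.lift (c₁ ≫ x) (𝟙 c) (by simp)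
  let s₂ : c ⟶ P := hπ.rep.lift (yon.map c₂ ≫ y) (𝟙 c) (by simp [hc.w])
  refine ⟨equalizer s₁ s₂, equalizer.ι s₁ s₂ ≫ c₂, yon.map (equalizer.ι s₁ s₂) ≫ c₁,
    isPullback_of_points ?_ (fun W u v huv => ?_) fun W m m' h₁ h₂ => ?_⟩
  · have : yon.map (equalizer.ι s₁ s₂) ≫ yon.map s₁ ≫ hπ.rep.fst _ =
        yon.map (equalizer.ι s₁ s₂) ≫ yon.map s₂ ≫ hπ.rep.fst _ := by
      rw [← Functor.map_comp_assoc, equalizer.condition, Functor.map_comp_assoc]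
    simpa [s₁, s₂] using this
  · have hw : u ≫ x ≫ π = yon.map v ≫ y ≫ π := by
      rw [← Category.assoc, huv, Category.assoc]
    let n : W ⟶ c := yon.preimage (hc.lift u (yon.map v) hw)
    have hn : yon.map n = hc.lift u (yon.map v) hw := yon.map_preimage _
    have h₁ : yon.map n ≫ c₁ = u := by rw [hn, IsPullback.lift_fst]
    have h₂ : n ≫ c₂ = v := by
      apply yon.map_injective
      rw [Functor.map_comp, hn, IsPullback.lift_snd]
    have he : n ≫ s₁ = n ≫ s₂ := by
      apply hπ.rep.hom_ext
      · simp only [Functor.map_comp, Category.assoc, s₁, s₂,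
          Functor.relativelyRepresentable.lift_fst]
        rw [← Category.assoc, h₁, huv, ← h₂, Functor.map_comp, Category.assoc]
      · simp [s₁, s₂]
    refine ⟨equalizer.lift n he, ?_, ?_⟩
    · rw [← Functor.map_comp_assoc, equalizer.lift_ι, h₁]
    · rw [equalizer.lift_ι_assoc, h₂]
  · apply equalizer.hom_ext
    apply yon.map_injective
    apply hc.hom_ext
    · rw [Functor.map_comp, Functor.map_comp, Category.assoc, Category.assoc]
      exact h₁
    · rw [← Functor.map_comp, ← Functor.map_comp, Category.assoc, Category.assoc, h₂]

/-- A sheaf which is affine over an algebraic space is an algebraic space. -/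
lemma IsAlgebraicSpace.of_isAffineMor (hS : IsAlgebraicSpace S) (hπ : IsAffineMor π)
    (hF : Presheaf.IsSheaf Scheme.etaleTopology F) : IsAlgebraicSpace F := by
  refine ⟨hF, hπ.diag hS.diag, ?_⟩
  have := MorphismProperty.relative_isStableUnderBaseChange (F := yon) etaleSurjective.{u}
  obtain ⟨U, p, hp⟩ := hS.atlas
  exact ⟨hπ.rep.pullback p, hπ.rep.fst p,
    MorphismProperty.of_isPullback (hπ.rep.isPullback p).flip hp⟩

end AlgebraicSpace

section
variable {X S : Presh.{u}} {f : X ⟶ S} (d : ℕ) (hf : IsAffineMor f)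

lemma isZariskiSheaf_of_isEtaleSheaf {F : Presh.{u}} (hF : Presheaf.IsSheaf Scheme.etaleTopology F) :
    Presieve.IsSheaf Scheme.zariskiTopology F :=
  Presieve.isSheaf_of_le _ Scheme.zariskiTopology_le_etaleTopology
    ((isSheaf_iff_isSheaf_of_type _ _).1 hF)

lemma IsAlgebraicSpace.isAffineMor_π (hS : IsAlgebraicSpace S) : IsAffineMor (gammaSpace.π d hf) :=
  GammaSpace.isAffineMor_π d hf
    (isSheaf_gammaSpace d hf _ (isZariskiSheaf_of_isEtaleSheaf hS.isSheaf))
    (isZariskiSheaf_of_isEtaleSheaf hS.isSheaf)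

lemma IsAlgebraicSpace.gammaSpace (hS : IsAlgebraicSpace S) : IsAlgebraicSpace (gammaSpace d hf) :=
  hS.of_isAffineMor (hS.isAffineMor_π d hf) ((isSheaf_iff_isSheaf_of_type _ _).2
    (isSheaf_gammaSpace d hf _ ((isSheaf_iff_isSheaf_of_type _ _).1 hS.isSheaf)))

lemma toPoint_taut_app {R : CommRingCat.{u}} (t : yon.obj (Spec R) ⟶ S) (h) (z) :
    (toPoint (taut d hf t)).app (yon.map (Spec.map (gamOver.ι d hf t)) ≫ t) (𝟙 _) h
      (baseMap d hf (gamOver.ι d hf t) t _ rfl z) = z := by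
  have e : ∀ (x y : GammaPoint d hf (Spec (gamOver d hf t))) (_ : x = y) (s) (h) (h') (z),
      x.app s (𝟙 _) h z = y.app s (𝟙 _) h' z := by
    rintro x _ rfl _ _ _ _; rfl
  refine (e _ (toPoint (yon.map (𝟙 _) ≫ taut d hf t)) (by simp) _ _
    (by simpa using h) _).trans ?_
  rw [toPoint_map_taut_app (𝟙 _) (𝟙 _) (gamOver.ι d hf t) (by simp)]
  have : Spec.preimage (𝟙 (Spec (gamOver d hf t)) ≫ 𝟙 _) = 𝟙 _ := Spec.map_injective (by simp)
  rw [this]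
  rfl

end

end GammaSpace
end

noncomputable section
open CategoryTheory Limits AlgebraicGeometry Opposite GammaAlgebra

namespace GammaSpace

/-! ### Points with values in an affine scheme -/

section AffinePoints

lemma map_id_comp {T : Scheme.{u}} {F : Presh.{u}} {k : T ⟶ T} (hk : k = 𝟙 T)
    (x : yon.obj T ⟶ F) : yon.map k ≫ x = x := by
  rw [hk, yon.map_id, Category.id_comp]

variable {X S : Presh.{u}} {f : X ⟶ S} {d : ℕ} {hf : IsAffineMor f}

lemma toPoint_app_congr {T : Scheme.{u}} {x y : yon.obj T ⟶ gammaSpace d hf} (e : x = y)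
    {R : CommRingCat.{u}} (s : yon.obj (Spec R) ⟶ S) {g g' : Spec R ⟶ T} (hg : g = g') (h h' z) :
    (toPoint x).app s g h z = (toPoint y).app s g' h' z := by
  subst e hg; rfl

lemma toPoint_map_app {T T' : Scheme.{u}} (x : yon.obj T ⟶ gammaSpace d hf) (k : T' ⟶ T)
    {R : CommRingCat.{u}} (s : yon.obj (Spec R) ⟶ S) (g : Spec R ⟶ T') (h h' z) :
    (toPoint (yon.map k ≫ x)).app s g h z = (toPoint x).app s (g ≫ k) h' z := by
  have e : ∀ (p q : GammaPoint d hf T') (_ : p = q) (h h' z), p.app s g h z = q.app s g h' z := by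
    rintro p _ rfl _ _ _; rfl
  exact e _ ((toPoint x).restrict k) (toPoint_map_comp d x k) _
    (by simpa [GammaPoint.restrict] using h') _

/-- A point of `Γᵈ(X/S)` with values in `Spec R` is determined by the corresponding homomorphism
`Γᵈ_R(B) → R`. -/
lemma hom_ext_of_app {R : CommRingCat.{u}} {x y : yon.obj (Spec R) ⟶ gammaSpace d hf}
    (s : yon.obj (Spec R) ⟶ S) (hx hy)
    (H : ∀ z, (toPoint x).app s (𝟙 _) hx z = (toPoint y).app s (𝟙 _) hy z) : x = y := by
  apply toPoint_injective
  have hx' : (toPoint x).base = s := by simpa using hx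
  have hy' : (toPoint y).base = s := by simpa using hy
  refine GammaPoint.ext' (hx'.trans hy'.symm) fun R' s' g h₁ h₂ z => ?_
  obtain ⟨φ, rfl⟩ : ∃ φ, g = Spec.map φ := ⟨_, (Spec.map_preimage g).symm⟩
  have hs : yon.map (Spec.map φ) ≫ s = s' := by rw [← hx', h₁]
  refine congr($(gamOver_hom_ext hf hs (u := (toPoint x).app s' _ h₁)
    (v := (toPoint y).app s' _ h₂) (fun r => ?_) fun z => ?_) z)
  · rw [GammaPoint.app_algebraMap, GammaPoint.app_algebraMap]
  · rw [(toPoint x).app_baseMap φ s s' hs (𝟙 _) hx _ h₁ (by simp),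
      (toPoint y).app_baseMap φ s s' hs (𝟙 _) hy _ h₂ (by simp), H]

/-- Homomorphisms of `R`-algebras `Γᵈ_R(B) → R` give points of `Γᵈ(X/S)` with values in
`Spec R`. -/
lemma exists_of_ringHom {R : CommRingCat.{u}} (s : yon.obj (Spec R) ⟶ S)
    (γ : GamRing d (hf.rep.snd s) →+* R) (hγ : ∀ r, γ (algebraMap R _ r) = r) :
    ∃ (x : yon.obj (Spec R) ⟶ gammaSpace d hf) (h : _), x ≫ gammaSpace.π d hf = s ∧
      ∀ z, (toPoint x).app s (𝟙 _) h z = γ z := by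
  have hι : gamOver.ι d hf s ≫ CommRingCat.ofHom γ = 𝟙 R := CommRingCat.hom_ext (RingHom.ext hγ)
  have hπ : (yon.map (Spec.map (CommRingCat.ofHom γ)) ≫ taut d hf s) ≫ gammaSpace.π d hf = s := by
    rw [Category.assoc, taut_π, ← Functor.map_comp_assoc, ← Spec.map_comp, hι]
    exact map_id_comp (Spec.map_id R) s
  have hb : yon.map (𝟙 (Spec R)) ≫
      (toPoint (yon.map (Spec.map (CommRingCat.ofHom γ)) ≫ taut d hf s)).base = s := by
    rw [toPoint_base, hπ]
    exact map_id_comp rfl s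
  refine ⟨yon.map (Spec.map (CommRingCat.ofHom γ)) ≫ taut d hf s, hb, hπ, fun z => ?_⟩
  have h1 := toPoint_map_taut_app (Spec.map (CommRingCat.ofHom γ)) (𝟙 _) (𝟙 R)
    ((Spec.map_id R).trans (by
      rw [← Spec.map_comp, hι, Category.id_comp]
      exact (Spec.map_id R).symm)) s hb (map_id_comp (Spec.map_id R) s) z
  rw [baseMap_id d hf _ rfl] at h1
  rw [Category.id_comp, Spec.preimage_map] at h1
  exact h1

end AffinePoints

/-! ### `Γᵈ` of a closed subspace -/

section ClosedSubspace
variable {X X₀ S : Presh.{u}} {f : X ⟶ S} {f₀ : X₀ ⟶ S} {d : ℕ} (hf₀ : IsAffineMor f₀)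
  (hf : IsAffineMor f) (a : X₀ ⟶ X) (w : a ≫ f = f₀ ≫ 𝟙 S)

/-- The restriction of functions from `X ×_S Spec R` to `X₀ ×_S Spec R`. -/
def functionRes {R : CommRingCat.{u}} (s : yon.obj (Spec R) ⟶ S) :
    FunctionRing (hf.rep.snd s) →+* FunctionRing (hf₀.rep.snd s) :=
  FunctionRing.map _ _ (prodMap hf₀ hf a (𝟙 S) w s s (𝟙 _) (by simp))

lemma functionRes_algebraMap {R : CommRingCat.{u}} (s : yon.obj (Spec R) ⟶ S) :
    (functionRes hf₀ hf a w s).comp (algebraMap R _) = (algebraMap R _).comp (RingHom.id R) :=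
  FunctionRing.map_comp_algebraMap (𝟙 R) _ (by simp)

lemma toPoint_comp_map_app {T : Scheme.{u}} (x : yon.obj T ⟶ gammaSpace d hf₀)
    {R : CommRingCat.{u}} (s : yon.obj (Spec R) ⟶ S) (g : Spec R ⟶ T) (h h' z) :
    (toPoint (x ≫ gammaSpace.map d hf₀ hf a (𝟙 S) w)).app s g h z =
      (toPoint x).app s g h' (squareMap d hf₀ hf a (𝟙 S) w s s (Category.comp_id s).symm z) := by
  have e : ∀ (p q : GammaPoint d hf T) (_ : p = q) (h h' z), p.app s g h z = q.app s g h' z := by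
    rintro p _ rfl _ _ _; rfl
  have hb : yon.map g ≫ ((toPoint x).push hf a (𝟙 S) w).base = s := by
    exact (congr_arg (yon.map g ≫ ·) (Category.comp_id _)).trans h'
  exact (e _ ((toPoint x).push hf a (𝟙 S) w) (toPoint_comp_map hf w x) h hb z).trans
    (GammaPoint.push_app hf a (𝟙 S) w (toPoint x) s g _ s h' _ z)

/-- The homomorphism of a point coming from `X₀` factors through `Γᵈ` of the functions on `X₀`, so
`ker_le_kerIdeal` applies. -/
lemma ker_functionRes_le {T : Scheme.{u}} (x : yon.obj T ⟶ gammaSpace d hf₀)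
    {R : CommRingCat.{u}} (s : yon.obj (Spec R) ⟶ S) (g : Spec R ⟶ T) (h) :
    RingHom.ker (functionRes hf₀ hf a w s) ≤
      kerIdeal ((toPoint (x ≫ gammaSpace.map d hf₀ hf a (𝟙 S) w)).app s g h) := by
  have h' : yon.map g ≫ (toPoint x).base = s := by
    rw [← h, toPoint_base, toPoint_base, Category.assoc, gammaSpace.map_π, Category.comp_id]
  exact ker_le_kerIdeal _ (functionRes_algebraMap hf₀ hf a w s) _ ((toPoint x).app s g h')
    fun z => (toPoint_comp_map_app hf₀ hf a w x s g h h' z).symm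

variable {hf₀ hf a w}

/-- If functions restrict surjectively to `X₀`, then `Γᵈ` of the function rings also maps
surjectively, and a homomorphism is determined by its composite with a surjection. -/
lemma gammaSpace_map_injective (hsurj : ∀ (R : CommRingCat.{u}) (s : yon.obj (Spec R) ⟶ S),
    Function.Surjective (functionRes hf₀ hf a w s)) {T : Scheme.{u}}
    {x y : yon.obj T ⟶ gammaSpace d hf₀}
    (h : x ≫ gammaSpace.map d hf₀ hf a (𝟙 S) w = y ≫ gammaSpace.map d hf₀ hf a (𝟙 S) w) :
    x = y := by
  have hb : x ≫ gammaSpace.π d hf₀ = y ≫ gammaSpace.π d hf₀ := by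
    have := congr($h ≫ gammaSpace.π d hf)
    simpa only [Category.assoc, gammaSpace.map_π, Category.comp_id] using this
  apply toPoint_injective
  refine GammaPoint.ext' (by rw [toPoint_base, toPoint_base, hb]) fun R s g h₁ h₂ z => ?_
  obtain ⟨z, rfl⟩ := Gam.map_surjective (d := d) (functionRes_algebraMap hf₀ hf a w s) (hsurj R s) z
  have h₁' : yon.map g ≫ (toPoint (x ≫ gammaSpace.map d hf₀ hf a (𝟙 S) w)).base = s := by
    rw [← h₁, toPoint_base, toPoint_base, Category.assoc, gammaSpace.map_π, Category.comp_id]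
  have h₂' : yon.map g ≫ (toPoint (y ≫ gammaSpace.map d hf₀ hf a (𝟙 S) w)).base = s := by
    rw [← h₂, toPoint_base, toPoint_base, Category.assoc, gammaSpace.map_π, Category.comp_id]
  exact (toPoint_comp_map_app hf₀ hf a w x s g h₁' h₁ z).symm.trans
    ((toPoint_app_congr h s rfl _ _ _).trans (toPoint_comp_map_app hf₀ hf a w y s g h₂' h₂ z))

lemma exists_factorization_of_affine (hsurj : ∀ (R : CommRingCat.{u}) (s : yon.obj (Spec R) ⟶ S),
    Function.Surjective (functionRes hf₀ hf a w s)) {R : CommRingCat.{u}}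
    (x : yon.obj (Spec R) ⟶ gammaSpace d hf) (s : yon.obj (Spec R) ⟶ S) (h)
    (hker : RingHom.ker (functionRes hf₀ hf a w s) ≤ kerIdeal ((toPoint x).app s (𝟙 _) h)) :
    ∃ x₀ : yon.obj (Spec R) ⟶ gammaSpace d hf₀, x₀ ≫ gammaSpace.map d hf₀ hf a (𝟙 S) w = x := by
  obtain ⟨γ, hγ⟩ := Gam.exists_factorization (functionRes_algebraMap hf₀ hf a w s) (hsurj R s) _ hker
  obtain ⟨x₀, h₀, hπ, hx₀⟩ := exists_of_ringHom s γ fun r => by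
    have := hγ (algebraMap R _ r)
    rw [Gam.map_algebraMap] at this
    exact this.trans ((toPoint x).app_algebraMap ..)
  have h' : yon.map (𝟙 (Spec R)) ≫ (toPoint (x₀ ≫ gammaSpace.map d hf₀ hf a (𝟙 S) w)).base = s := by
    rw [toPoint_base, Category.assoc, gammaSpace.map_π, Category.comp_id, hπ]
    simp
  refine ⟨x₀, hom_ext_of_app s h' h fun z => ?_⟩
  exact (toPoint_comp_map_app hf₀ hf a w x₀ s _ h' h₀ z).trans ((hx₀ _).trans (hγ z))

/-- For a closed subspace `X₀` of `X`, a point of `Γᵈ(X/S)` comes from `Γᵈ(X₀/S)` if this is so over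
the affine open subschemes. -/
lemma exists_factorization (hS : Presieve.IsSheaf Scheme.zariskiTopology S)
    (hsurj : ∀ (R : CommRingCat.{u}) (s : yon.obj (Spec R) ⟶ S),
      Function.Surjective (functionRes hf₀ hf a w s)) {T : Scheme.{u}}
    (x : yon.obj T ⟶ gammaSpace d hf) (t : yon.obj T ⟶ S)
    (h : ∀ U : T.AffineZariskiSite, yon.map (affineFromSpec U) ≫ (toPoint x).base =
      yon.map (affineFromSpec U) ≫ t)
    (hker : ∀ U : T.AffineZariskiSite,
      RingHom.ker (functionRes hf₀ hf a w (yon.map (affineFromSpec U) ≫ t)) ≤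
        kerIdeal ((toPoint x).app _ (affineFromSpec U) (h U))) :
    ∃ x₀ : yon.obj T ⟶ gammaSpace d hf₀, x₀ ≫ gammaSpace.map d hf₀ hf a (𝟙 S) w = x := by
  have hU : ∀ U : T.AffineZariskiSite, ∃ y : yon.obj (Spec Γ(T, U.toOpens)) ⟶ gammaSpace d hf₀,
      y ≫ gammaSpace.map d hf₀ hf a (𝟙 S) w = yon.map (affineFromSpec U) ≫ x := fun U => by
    have h' : yon.map (𝟙 _) ≫ (toPoint (yon.map (affineFromSpec U) ≫ x)).base =
        yon.map (affineFromSpec U) ≫ t := by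
      rw [toPoint_base, ← h U, toPoint_base]
      simp
    refine exists_factorization_of_affine hsurj _ _ h' fun b hb => ?_
    have := hker U hb
    rw [mem_kerIdeal] at this ⊢
    intro k hk c
    refine Eq.trans ?_ (this k hk c)
    exact (toPoint_map_app x _ _ _ h' (by simpa using h U) _).trans
      (toPoint_app_congr rfl _ (Category.id_comp _) _ _ _)
  choose y hy using hU
  have hΓ := isSheaf_gammaSpace d hf₀ _ hS
  -- The local factorizations agree on overlaps because `Γᵈ(X₀/S) ⟶ Γᵈ(X/S)` is injective on points.
  obtain ⟨x₀, hx₀⟩ := exists_of_openCover hΓ (affineSpecCover T) y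
    fun (U V : T.AffineZariskiSite) W k l e => gammaSpace_map_injective hsurj (by
      have e' : k ≫ affineFromSpec U = l ≫ affineFromSpec V := e
      refine (Category.assoc _ _ _).trans (Eq.trans ?_ (Category.assoc _ _ _).symm)
      refine (congr_arg (yon.map k ≫ ·) (hy U)).trans (Eq.trans ?_
        (congr_arg (yon.map l ≫ ·) (hy V)).symm)
      have e'' : yon.map k ≫ yon.map (affineFromSpec U) = yon.map l ≫ yon.map (affineFromSpec V) :=
        (yon.map_comp k (affineFromSpec U)).symm.trans
          ((congr_arg yon.map e').trans (yon.map_comp l (affineFromSpec V)))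
      exact (Category.assoc _ _ _).symm.trans ((congr_arg (· ≫ x) e'').trans
        (Category.assoc _ _ _)))
  refine ⟨x₀, hom_ext_of_openCover (isSheaf_gammaSpace d hf _ hS) (affineSpecCover T)
    fun (U : T.AffineZariskiSite) => ?_⟩
  exact (Category.assoc _ _ _).symm.trans
    ((congr_arg (· ≫ gammaSpace.map d hf₀ hf a (𝟙 S) w) (hx₀ U)).trans (hy U))

end ClosedSubspace
end GammaSpace
end

noncomputable section
open CategoryTheory Limits AlgebraicGeometry Opposite GammaAlgebra

/-! ### Intersections of closed subspaces -/

namespace GammaSpace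

lemma isSheaf_yon (T : Scheme.{u}) : Presieve.IsSheaf Scheme.zariskiTopology.{u} (yon.obj T) :=
  GrothendieckTopology.Subcanonical.isSheaf_of_isRepresentable _

/-- Intersecting closed subschemes adds their ideals: `A` modulo the sum of the kernels receives
compatible maps from `B₁` and `B₂`, hence one from the pushout. -/
lemma ker_le_of_isPushout {A B₁ B₂ C : CommRingCat.{u}} {f : A ⟶ B₁} {g : A ⟶ B₂} {i : B₁ ⟶ C}
    {j : B₂ ⟶ C} (h : IsPushout f g i j) (hf : Function.Surjective f.hom)
    (hg : Function.Surjective g.hom) :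
    RingHom.ker (i.hom.comp f.hom) ≤ RingHom.ker f.hom ⊔ RingHom.ker g.hom := by
  intro x hx
  let Q := A ⧸ (RingHom.ker f.hom ⊔ RingHom.ker g.hom)
  let q : A →+* Q := Ideal.Quotient.mk _
  have hq₁ : RingHom.ker f.hom ≤ RingHom.ker q := by rw [Ideal.mk_ker]; exact le_sup_left
  have hq₂ : RingHom.ker g.hom ≤ RingHom.ker q := by rw [Ideal.mk_ker]; exact le_sup_right
  let u₁ : B₁ →+* Q := f.hom.liftOfSurjective hf ⟨q, hq₁⟩
  let u₂ : B₂ →+* Q := g.hom.liftOfSurjective hg ⟨q, hq₂⟩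
  have hu₁ : ∀ a, u₁ (f.hom a) = q a := RingHom.liftOfRightInverse_comp_apply _ _ _ ⟨q, hq₁⟩
  have hu₂ : ∀ a, u₂ (g.hom a) = q a := RingHom.liftOfRightInverse_comp_apply _ _ _ ⟨q, hq₂⟩
  have w : f ≫ CommRingCat.ofHom u₁ = g ≫ CommRingCat.ofHom u₂ :=
    CommRingCat.hom_ext (RingHom.ext fun a => (hu₁ a).trans (hu₂ a).symm)
  have h₀ : (h.desc _ _ w).hom (i.hom (f.hom x)) = q x :=
    (congr(($(h.inl_desc _ _ w)).hom (f.hom x))).trans (hu₁ x)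
  rw [show i.hom (f.hom x) = 0 from hx, map_zero] at h₀
  exact Ideal.Quotient.eq_zero_iff_mem.1 h₀.symm

section ClosedSubspaces
variable {X X₀ X₁ X₂ S : Presh.{u}} {f : X ⟶ S} {f₀ : X₀ ⟶ S} {f₁ : X₁ ⟶ S} {f₂ : X₂ ⟶ S}
  {hf : IsAffineMor f} {hf₀ : IsAffineMor f₀} {hf₁ : IsAffineMor f₁} {hf₂ : IsAffineMor f₂}

lemma isPullback_map_prodMap {a : X₀ ⟶ X} (w : a ≫ f = f₀ ≫ 𝟙 S) {W : Scheme.{u}}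
    (s : yon.obj W ⟶ S) (h) :
    IsPullback (hf₀.rep.fst s) (yon.map (prodMap hf₀ hf a (𝟙 S) w s s (𝟙 _) h)) a
      (hf.rep.fst s) := by
  refine IsPullback.of_bot ?_ (prodMap_fst ..).symm (hf.rep.isPullback s)
  have h₁ : yon.map (prodMap hf₀ hf a (𝟙 S) w s s (𝟙 _) h) ≫ yon.map (hf.rep.snd s) =
      yon.map (hf₀.rep.snd s) := by
    rw [← Functor.map_comp, prodMap_snd, Category.comp_id]
  rw [h₁, w, Category.comp_id]
  exact hf₀.rep.isPullback s

lemma isPullback_prodMap_prodMap {a₁ : X₁ ⟶ X} {a₂ : X₂ ⟶ X} {b₁ : X₀ ⟶ X₁} {b₂ : X₀ ⟶ X₂}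
    (hP : IsPullback b₁ b₂ a₁ a₂) (w₁ : a₁ ≫ f = f₁ ≫ 𝟙 S) (w₂ : a₂ ≫ f = f₂ ≫ 𝟙 S)
    (v₁ : b₁ ≫ f₁ = f₀ ≫ 𝟙 S) (v₂ : b₂ ≫ f₂ = f₀ ≫ 𝟙 S) {W : Scheme.{u}} (s : yon.obj W ⟶ S) (h) :
    IsPullback (prodMap hf₀ hf₁ b₁ (𝟙 S) v₁ s s (𝟙 _) h) (prodMap hf₀ hf₂ b₂ (𝟙 S) v₂ s s (𝟙 _) h)
      (prodMap hf₁ hf a₁ (𝟙 S) w₁ s s (𝟙 _) h) (prodMap hf₂ hf a₂ (𝟙 S) w₂ s s (𝟙 _) h) := by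
  have w : b₁ ≫ a₁ = b₂ ≫ a₂ := hP.w
  have h0 : prodMap hf₀ hf₁ b₁ (𝟙 S) v₁ s s (𝟙 _) h ≫ prodMap hf₁ hf a₁ (𝟙 S) w₁ s s (𝟙 _) h =
      prodMap hf₀ hf₂ b₂ (𝟙 S) v₂ s s (𝟙 _) h ≫ prodMap hf₂ hf a₂ (𝟙 S) w₂ s s (𝟙 _) h := by
    apply hf.rep.hom_ext <;> simp [w]
  refine IsPullback.of_map yon h0 ?_
  refine (IsPullback.of_right ?_ ?_ (isPullback_map_prodMap w₂ s h)).flip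
  · rw [prodMap_fst, prodMap_fst]
    exact (isPullback_map_prodMap v₁ s h).paste_horiz hP.flip
  · rw [← Functor.map_comp, ← Functor.map_comp, h0]

/-- The closed subspaces of `X ×_S Spec R` defined by `X₁`, `X₂` and `X₁ ×_X X₂`. -/
lemma ker_functionRes_le_sup {a₁ : X₁ ⟶ X} {a₂ : X₂ ⟶ X} {b₁ : X₀ ⟶ X₁} {b₂ : X₀ ⟶ X₂}
    {a₀ : X₀ ⟶ X} (h₀ : b₁ ≫ a₁ = a₀)
    (hP : IsPullback b₁ b₂ a₁ a₂) (w₁ : a₁ ≫ f = f₁ ≫ 𝟙 S) (w₂ : a₂ ≫ f = f₂ ≫ 𝟙 S)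
    (w₀ : a₀ ≫ f = f₀ ≫ 𝟙 S) {R : CommRingCat.{u}} (s : yon.obj (Spec R) ⟶ S)
    (hs₁ : Function.Surjective (functionRes hf₁ hf a₁ w₁ s))
    (hs₂ : Function.Surjective (functionRes hf₂ hf a₂ w₂ s)) :
    RingHom.ker (functionRes hf₀ hf a₀ w₀ s) ≤
      RingHom.ker (functionRes hf₁ hf a₁ w₁ s) ⊔ RingHom.ker (functionRes hf₂ hf a₂ w₂ s) := by
  subst h₀
  have v₁ : b₁ ≫ f₁ = f₀ ≫ 𝟙 S := by rw [← w₀, Category.assoc, w₁, Category.comp_id]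
  have v₂ : b₂ ≫ f₂ = f₀ ≫ 𝟙 S := by rw [← w₀, hP.w, Category.assoc, w₂, Category.comp_id]
  have : IsAffineHom (hf.rep.snd s) := hf.property_snd s
  have : IsAffineHom (hf₁.rep.snd s) := hf₁.property_snd s
  have : IsAffineHom (hf₂.rep.snd s) := hf₂.property_snd s
  have : IsAffine (hf.rep.pullback s) := isAffine_of_isAffineHom (hf.rep.snd s)
  have : IsAffine (hf₁.rep.pullback s) := isAffine_of_isAffineHom (hf₁.rep.snd s)
  have : IsAffine (hf₂.rep.pullback s) := isAffine_of_isAffineHom (hf₂.rep.snd s)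
  have hP' := isPushout_appTop_of_isPullback
    (isPullback_prodMap_prodMap (hf := hf) (hf₀ := hf₀) (hf₁ := hf₁) (hf₂ := hf₂) hP w₁ w₂ v₁ v₂ s
      (by simp))
  refine le_trans (le_of_eq ?_) (ker_le_of_isPushout hP' hs₁ hs₂)
  have := prodMap_comp hf₁ hf a₁ (𝟙 S) w₁ s s (𝟙 _) (by simp) hf₀ b₁ (𝟙 S) v₁ (b₁ ≫ a₁) (𝟙 S) w₀ s
    (𝟙 _) (by simp) (𝟙 _) (by simp) rfl (Category.comp_id _)
  congr 1
  exact congr(($this).appTop.hom).symm.trans congr(($(Scheme.Hom.comp_appTop _ _)).hom)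

end ClosedSubspaces

section ClosedSubscheme
variable {T Y Z : Scheme.{u}} {p : Y ⟶ T} {q : Z ⟶ T} (hp : IsAffineMor (yon.map p))
  (hq : IsAffineMor (yon.map q)) (i : Z ⟶ Y) [IsClosedImmersion i]

/-- The morphism inducing `functionRes` is a base change of the closed immersion `i`, with affine
target. -/
lemma functionRes_surjective (w : yon.map i ≫ yon.map p = yon.map q ≫ 𝟙 _) (R : CommRingCat.{u})
    (s : yon.obj (Spec R) ⟶ yon.obj T) : Function.Surjective (functionRes hq hp (yon.map i) w s) := by
  have : IsAffineHom (hp.rep.snd s) := hp.property_snd s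
  have : IsAffine (hp.rep.pullback s) := isAffine_of_isAffineHom (hp.rep.snd s)
  have h := isPullback_map_prodMap (hf := hp) (hf₀ := hq) w s (by simp)
  have h' : IsPullback (yon.preimage (hq.rep.fst s)) (prodMap hq hp (yon.map i) (𝟙 _) w s s (𝟙 _)
      (by simp)) i (yon.preimage (hp.rep.fst s)) := by
    refine IsPullback.of_map yon (yon.map_injective ?_) ?_
    · rw [Functor.map_comp, Functor.map_comp, yon.map_preimage, yon.map_preimage]
      exact h.w
    · rw [yon.map_preimage, yon.map_preimage]
      exact h
  have : IsClosedImmersion (prodMap hq hp (yon.map i) (𝟙 _) w s s (𝟙 _) (by simp)) :=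
    MorphismProperty.of_isPullback (P := @IsClosedImmersion) h' inferInstance
  exact (IsClosedImmersion.isAffine_surjective_of_isAffine _).2

end ClosedSubscheme

/-! ### Families with the same point are equivalent -/

namespace Family
variable {X S : Presh.{u}} {f : X ⟶ S} {d : ℕ} {hf : IsAffineMor f} {T : Scheme.{u}}
  {t : yon.obj T ⟶ S}

lemma isAffine_snd (hf : IsAffineMor f) (t : yon.obj T ⟶ S) : IsAffineMor (yon.map (hf.rep.snd t)) :=
  have : IsAffineHom (hf.rep.snd t) := hf.property_snd t
  isAffine_map _

lemma map_i_snd (ξ : Family d hf t) :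
    yon.map ξ.i ≫ yon.map (hf.rep.snd t) = yon.map ξ.p ≫ 𝟙 _ := by
  rw [Category.comp_id, p, Functor.map_comp]

/-- The point of `Γᵈ(X ×_S T/T)` given by a family. -/
def toGammaSnd (ξ : Family d hf t) : yon.obj T ⟶ gammaSpace d (isAffine_snd hf t) :=
  ξ.α ≫ gammaSpace.map d ξ.isAffine_p (isAffine_snd hf t) (yon.map ξ.i) (𝟙 _) ξ.map_i_snd

lemma toGammaSnd_π (ξ : Family d hf t) : ξ.toGammaSnd ≫ gammaSpace.π d _ = 𝟙 _ := by
  rw [toGammaSnd, Category.assoc, gammaSpace.map_π, Category.comp_id, ξ.α_π]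

lemma toGammaSnd_map (ξ : Family d hf t) :
    ξ.toGammaSnd ≫ gammaSpace.map d (isAffine_snd hf t) hf (hf.rep.fst t) t (hf.rep.w t) =
      ξ.toGamma := by
  rw [toGammaSnd, Category.assoc, gammaSpace.map_comp, toGamma]
  · rfl
  · exact Category.id_comp _

/-- `Γᵈ(X ×_S T/T)` is the base change of `Γᵈ(X/S)` to `T`, and both points have the identity as
component in `T`. This moves the comparison to where `Z₁` and `Z₂` are closed subschemes. -/
lemma toGammaSnd_eq {ξ₁ ξ₂ : Family d hf t} (h : ξ₁.toGamma = ξ₂.toGamma) :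
    ξ₁.toGammaSnd = ξ₂.toGammaSnd := by
  refine gammaSpace.hom_ext (isAffine_snd hf t) hf (hf.rep.isPullback t) ?_ ?_
  · exact ξ₁.toGammaSnd_map.trans (h.trans ξ₂.toGammaSnd_map.symm)
  · rw [toGammaSnd_π, toGammaSnd_π]

lemma IsRestriction.toGamma_eq {ξ₀ ξ : Family d hf t} (h : ξ₀.IsRestriction ξ) :
    ξ₀.toGamma = ξ.toGamma := by
  obtain ⟨j, hj, hα⟩ := h
  rw [toGamma, toGamma, ← hα, Category.assoc, gammaSpace.map_comp]
  · rw [← Category.assoc, ← Functor.map_comp, hj]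
  · exact Category.id_comp _

lemma Equivalent.toGamma_eq {ξ₁ ξ₂ : Family d hf t} (h : ξ₁.Equivalent ξ₂) :
    ξ₁.toGamma = ξ₂.toGamma := by
  obtain ⟨ξ₀, h₁, h₂⟩ := h
  rw [← h₁.toGamma_eq, h₂.toGamma_eq]

lemma toGamma_pullback (ξ : Family d hf t) {T' : Scheme.{u}} {t' : yon.obj T' ⟶ S} (g : T' ⟶ T)
    (hg : yon.map g ≫ t = t') : (ξ.pullback g hg).toGamma = yon.map g ≫ ξ.toGamma := by
  have w : yon.map (ξ.proj g hg) ≫ yon.map ξ.p = yon.map (ξ.pullback g hg).p ≫ yon.map g := by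
    rw [← Functor.map_comp, ← Functor.map_comp, (ξ.isPullback_proj _ _).w]
  rw [toGamma, toGamma, ← ξ.pullback_α_map_assoc g hg w, gammaSpace.map_comp]
  · rw [← Category.assoc, ← Functor.map_comp, (ξ.isPullback_proj_i g hg).w, Functor.map_comp,
      Category.assoc, baseChange_fst]
  · exact hg

/-- Two families which give the same point of `Γᵈ(X/S)` are equivalent. -/
lemma equivalent_of_toGamma_eq {ξ₁ ξ₂ : Family d hf t} (h : ξ₁.toGamma = ξ₂.toGamma) :
    ξ₁.Equivalent ξ₂ := by
  have hβ := toGammaSnd_eq h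
  -- The common closed subscheme is the intersection of `Z₁` and `Z₂`.
  let i₁ := pullback.fst ξ₁.i ξ₂.i
  let i₂ := pullback.snd ξ₁.i ξ₂.i
  have hP : IsPullback i₁ i₂ ξ₁.i ξ₂.i := IsPullback.of_hasPullback _ _
  let i₀ := i₁ ≫ ξ₁.i
  have hi₀ : IsClosedImmersion i₀ := inferInstance
  have hint : IsIntegralHom (i₀ ≫ hf.rep.snd t) := by
    have e : i₀ ≫ hf.rep.snd t = i₁ ≫ ξ₁.p := Category.assoc _ _ _
    have : IsIntegralHom ξ₁.p := ξ₁.isIntegral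
    rw [e]
    infer_instance
  have hp₀ : IsAffineMor (yon.map (i₀ ≫ hf.rep.snd t)) := isAffine_map _
  have w₀ : yon.map i₀ ≫ yon.map (hf.rep.snd t) = yon.map (i₀ ≫ hf.rep.snd t) ≫ 𝟙 _ := by
    rw [Category.comp_id]
    exact (yon.map_comp _ _).symm
  have hbase : (toPoint ξ₁.toGammaSnd).base = 𝟙 _ := (toPoint_base _).trans ξ₁.toGammaSnd_π
  obtain ⟨α₀, hα₀⟩ := exists_factorization (d := d) (hf₀ := hp₀) (hf := isAffine_snd hf t) (w := w₀)
    (isSheaf_yon T) (functionRes_surjective _ _ i₀ w₀) ξ₁.toGammaSnd (𝟙 _)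
    (fun U => by rw [hbase]) (fun U => by
      -- The ideal of the intersection is contained in the sum of the ideals of `Z₁` and `Z₂`. Each
      -- of these lies in the kernel ideal of the common point, one because of `ξ₁.α` and the other
      -- because of `ξ₂.α`; it matters here that `kerIdeal` is closed under addition.
      refine (ker_functionRes_le_sup (hf₁ := ξ₁.isAffine_p) (hf₂ := ξ₂.isAffine_p)
        (yon.map_comp i₁ ξ₁.i).symm (hP.map yon)
        ξ₁.map_i_snd ξ₂.map_i_snd w₀ _ (functionRes_surjective _ _ _ _ _ _)
        (functionRes_surjective _ _ _ _ _ _)).trans (sup_le ?_ ?_)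
      · exact ker_functionRes_le _ _ _ _ ξ₁.α _ _ _
      · have e : yon.map (affineFromSpec U) ≫ (toPoint ξ₂.toGammaSnd).base =
            yon.map (affineFromSpec U) ≫ 𝟙 _ := by rw [← hβ, hbase]
        refine (ker_functionRes_le _ _ _ _ ξ₂.α _ (affineFromSpec U) e).trans (le_of_eq ?_)
        congr 1
        exact RingHom.ext fun z => toPoint_app_congr hβ.symm _ rfl _ _ _)
  have hα₀π : α₀ ≫ gammaSpace.π d hp₀ = 𝟙 _ := by
    have := congr($hα₀ ≫ gammaSpace.π d (isAffine_snd hf t))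
    rw [Category.assoc, gammaSpace.map_π, Category.comp_id, toGammaSnd_π] at this
    exact this
  refine ⟨⟨_, i₀, hi₀, hint, α₀, hα₀π⟩, ⟨i₁, rfl, ?_⟩, ⟨i₂, hP.w.symm, ?_⟩⟩
  -- Passing from `Z₁` to the ambient `X ×_S T` is injective on points, and there the equality is
  -- the defining property of `α₀`.
  · refine gammaSpace_map_injective (functionRes_surjective
      (isAffine_snd hf t) ξ₁.isAffine_p ξ₁.i ξ₁.map_i_snd) ?_
    rw [Category.assoc, gammaSpace.map_comp]
    · exact hα₀
    · exact (yon.map_comp _ _).symm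
    · exact Category.comp_id _
  · refine gammaSpace_map_injective (functionRes_surjective
      (isAffine_snd hf t) ξ₂.isAffine_p ξ₂.i ξ₂.map_i_snd) ?_
    rw [Category.assoc, gammaSpace.map_comp]
    · exact hα₀.trans hβ
    · exact (yon.map_comp _ _).symm.trans (congr_arg yon.map hP.w.symm)
    · exact Category.comp_id _

end Family

end GammaSpace
end

noncomputable section
open CategoryTheory Limits AlgebraicGeometry Opposite GammaAlgebra

namespace GammaSpace

/-! ### The support of a point -/

section Support

/-- `B'` is the localization of `B` at the image of `r`, so a power of `r` clears the denominator of
`y`. -/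
lemma exists_mul_eq_of_isPushout {R R' B B' : CommRingCat.{u}} {σ : R ⟶ R'} {a : R ⟶ B}
    {b : R' ⟶ B'} {ψ : B ⟶ B'} (h : IsPushout σ a b ψ) (r : R)
    (hr : letI := σ.hom.toAlgebra; IsLocalization.Away r R') (y : B') :
    ∃ u : R', IsUnit u ∧ ∃ c, b.hom u * y = ψ.hom c := by
  algebraize [σ.hom, a.hom, b.hom, ψ.hom, ψ.hom.comp a.hom]
  have : IsScalarTower R R' B' := .of_algebraMap_eq' congr(($(h.w)).hom).symm
  have hp : Algebra.IsPushout R R' B B' := (CommRingCat.isPushout_iff_isPushout ..).1 h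
  have hl : IsLocalization (Algebra.algebraMapSubmonoid B (.powers r)) B' :=
    (Algebra.isLocalization_iff_isPushout (.powers r) R').2 hp.symm
  obtain ⟨⟨c, ⟨_, m, hm, rfl⟩⟩, hc⟩ := IsLocalization.surj (Algebra.algebraMapSubmonoid B (.powers r)) y
  refine ⟨σ.hom m, IsLocalization.map_units R' (⟨m, hm⟩ : Submonoid.powers r), c, ?_⟩
  refine (mul_comm _ _).trans (Eq.trans ?_ hc)
  exact congr_arg (y * ·) congr(($(h.w)).hom m)

lemma isPushout_quotient {B B' : CommRingCat.{u}} (ψ : B ⟶ B') (I : Ideal B) (I' : Ideal B')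
    (h : I.map ψ.hom = I') (h') :
    IsPushout ψ (CommRingCat.ofHom (Ideal.Quotient.mk I)) (CommRingCat.ofHom (Ideal.Quotient.mk I'))
      (CommRingCat.ofHom (Ideal.quotientMap I' ψ.hom h')) := by
  refine ⟨⟨CommRingCat.hom_ext (RingHom.ext fun x => rfl)⟩, ⟨PushoutCocone.IsColimit.mk _
    (fun s => CommRingCat.ofHom (Ideal.Quotient.lift I' s.inl.hom fun x hx => ?_))
    (fun s => ?_) (fun s => ?_) fun s m hm _ => ?_⟩⟩
  · rw [← h] at hx
    have : I.map ψ.hom ≤ RingHom.ker s.inl.hom := by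
      rw [Ideal.map_le_iff_le_comap]
      intro y hy
      have := congr(($(s.condition)).hom y)
      refine this.trans ?_
      have e : (CommRingCat.ofHom (Ideal.Quotient.mk I)).hom y = 0 :=
        Ideal.Quotient.eq_zero_iff_mem.2 hy
      exact (congr_arg s.inr.hom e).trans (map_zero _)
    exact this hx
  · exact CommRingCat.hom_ext (RingHom.ext fun x => rfl)
  · refine CommRingCat.hom_ext (Ideal.Quotient.ringHom_ext (RingHom.ext fun x => ?_))
    exact congr(($(s.condition)).hom x)
  · refine CommRingCat.hom_ext (Ideal.Quotient.ringHom_ext (RingHom.ext fun x => ?_))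
    exact congr(($hm).hom x)

open Scheme.AffineZariskiSite
variable {X S : Presh.{u}} {f : X ⟶ S} {d : ℕ} {hf : IsAffineMor f} {T : Scheme.{u}}
  {t : yon.obj T ⟶ S} (x : yon.obj T ⟶ gammaSpace d hf) (hx : x ≫ gammaSpace.π d hf = t)

/-- Morphisms in the affine Zariski site are inclusions of basic open subsets. -/
lemma isLocalization_affineRes {U V : T.AffineZariskiSite} (h : U ⟶ V) :
    ∃ r : Γ(T, V.toOpens), letI := (affineRes h).hom.toAlgebra; IsLocalization.Away r Γ(T, U.toOpens) := by
  obtain ⟨r, hr⟩ := leOfHom h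
  obtain rfl : V.basicOpen r = U := Subtype.ext hr
  exact ⟨r, V.2.isLocalization_basicOpen r⟩

/-- The functions on `X ×_S U` for affine open subschemes `U` of `T`. -/
abbrev funOn (hf : IsAffineMor f) (t : yon.obj T ⟶ S) (U : T.AffineZariskiSite) : Type u :=
  FunctionRing (hf.rep.snd (yon.map (affineFromSpec U) ≫ t))

/-- The restriction of functions from `X ×_S V` to `X ×_S U`. -/
def funRes (hf : IsAffineMor f) (t : yon.obj T ⟶ S) {U V : T.AffineZariskiSite} (h : U ⟶ V) :
    funOn hf t V →+* funOn hf t U :=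
  FunctionRing.map _ _ (prodMap hf hf (𝟙 X) (𝟙 S) (by simp) _ _ (Spec.map (affineRes h))
    (by simpa using affineRes_base t h))

lemma isPushout_funRes (hf : IsAffineMor f) (t : yon.obj T ⟶ S) {U V : T.AffineZariskiSite}
    (h : U ⟶ V) :
    IsPushout (affineRes h) (CommRingCat.ofHom (algebraMap _ (funOn hf t V)))
      (CommRingCat.ofHom (algebraMap _ (funOn hf t U))) (CommRingCat.ofHom (funRes hf t h)) :=
  have : IsAffineHom (hf.rep.snd (yon.map (affineFromSpec V) ≫ t)) := hf.property_snd _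
  isPushout_functionRing (affineRes h) _ (isPullback_prodMap hf _ _ _
    (by simpa using affineRes_base t h))

lemma funRes_algebraMap (hf : IsAffineMor f) (t : yon.obj T ⟶ S) {U V : T.AffineZariskiSite}
    (h : U ⟶ V) : (funRes hf t h).comp (algebraMap _ _) = (algebraMap _ _).comp (affineRes h).hom :=
  congr(($((isPushout_funRes hf t h).w)).hom).symm

lemma funRes_id (hf : IsAffineMor f) (t : yon.obj T ⟶ S) (U : T.AffineZariskiSite) (b) :
    funRes hf t (𝟙 U) b = b := by
  have : prodMap hf hf (𝟙 X) (𝟙 S) (by simp) _ _ (Spec.map (affineRes (𝟙 U)))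
    (by simpa using affineRes_base t (𝟙 U)) = 𝟙 _ :=
    hf.rep.hom_ext (by simp) (by rw [prodMap_snd, affineRes_id]; simp)
  exact (congr(($this).appTop.hom b)).trans congr(($(Scheme.Hom.id_appTop)).hom b)

lemma funRes_comp (hf : IsAffineMor f) (t : yon.obj T ⟶ S) {U V W : T.AffineZariskiSite}
    (h : U ⟶ V) (h' : V ⟶ W) (b) :
    funRes hf t (h ≫ h') b = funRes hf t h (funRes hf t h' b) := by
  have := prodMap_comp hf hf (𝟙 X) (𝟙 S) (by simp) _ _ (Spec.map (affineRes h'))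
    (by simpa using affineRes_base t h') hf (𝟙 X) (𝟙 S) (by simp) (𝟙 X) (𝟙 S) (by simp) _
    (Spec.map (affineRes h)) (by simpa using affineRes_base t h) (Spec.map (affineRes (h ≫ h')))
    (by simpa using affineRes_base t (h ≫ h')) (by simp)
    (by rw [← Spec.map_comp, affineRes_comp])
  exact (congr(($this).appTop.hom b)).symm.trans congr(($(Scheme.Hom.comp_appTop _ _)).hom b)

lemma base_of_π_eq (hx : x ≫ gammaSpace.π d hf = t) (U : T.AffineZariskiSite) :
    yon.map (affineFromSpec U) ≫ (toPoint x).base = yon.map (affineFromSpec U) ≫ t := by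
  rw [toPoint_base, hx]

/-- The algebra homomorphism `Γᵈ_R(B) → R` given by a point of `Γᵈ(X/S)`, over an affine open
subscheme `Spec R`. -/
def homOn (U : T.AffineZariskiSite) : Gam d Γ(T, U.toOpens) (funOn hf t U) →ₐ[Γ(T, U.toOpens)]
    Γ(T, U.toOpens) where
  __ := (toPoint x).app _ (affineFromSpec U) (base_of_π_eq x hx U)
  commutes' _ := (toPoint x).app_algebraMap ..

/-- The ideal of the support of a point of `Γᵈ(X/S)`, over an affine open subscheme. -/
def supportIdeal (U : T.AffineZariskiSite) : Ideal (funOn hf t U) := charIdeal (homOn x hx U)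

/-- Restriction from `V` to `U` inverts a single function, and `charIdeal` is compatible with such
localizations. This is the quasi-coherence by which the local supports glue. -/
lemma supportIdeal_map {U V : T.AffineZariskiSite} (h : U ⟶ V) :
    (supportIdeal x hx V).map (funRes hf t h) = supportIdeal x hx U := by
  refine charIdeal_map (affineRes h).hom _ (funRes_algebraMap hf t h) _ _ (fun z => ?_) fun b' => ?_
  · exact (toPoint x).app_baseMap (affineRes h) _ _ (affineRes_base t h) _ (base_of_π_eq x hx V) _
      (base_of_π_eq x hx U) (affineRes_fromSpec h) z
  · obtain ⟨r, hr⟩ := isLocalization_affineRes h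
    obtain ⟨u, hu, b, hb⟩ := exists_mul_eq_of_isPushout (isPushout_funRes hf t h) r hr b'
    exact ⟨u, hu, b, (Algebra.smul_def _ _).trans hb⟩

lemma supportIdeal_le_comap {U V : T.AffineZariskiSite} (h : U ⟶ V) :
    supportIdeal x hx V ≤ (supportIdeal x hx U).comap (funRes hf t h) := by
  rw [← Ideal.map_le_iff_le_comap, supportIdeal_map]

/-- The algebra of functions on the support of a point of `Γᵈ(X/S)`. -/
def supportFunctor : T.AffineZariskiSiteᵒᵖ ⥤ CommRingCat.{u} where
  obj U := .of (funOn hf t U.unop ⧸ supportIdeal x hx U.unop)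
  map h := CommRingCat.ofHom (Ideal.quotientMap _ (funRes hf t h.unop)
    (supportIdeal_le_comap x hx h.unop))
  map_id U := CommRingCat.hom_ext (Ideal.Quotient.ringHom_ext (RingHom.ext fun b =>
    congr_arg (Ideal.Quotient.mk _) (funRes_id hf t U.unop b)))
  map_comp h h' := CommRingCat.hom_ext (Ideal.Quotient.ringHom_ext (RingHom.ext fun b =>
    congr_arg (Ideal.Quotient.mk _) (funRes_comp hf t h'.unop h.unop b)))

/-- The structure homomorphism of the functions on the support. -/
def supportMap (U : T.AffineZariskiSite) :
    Γ(T, U.toOpens) ⟶ .of (funOn hf t U ⧸ supportIdeal x hx U) :=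
  CommRingCat.ofHom (algebraMap _ (funOn hf t U)) ≫ CommRingCat.ofHom (Ideal.Quotient.mk _)

lemma isPushout_supportMap {U V : T.AffineZariskiSite} (h : U ⟶ V) :
    IsPushout (affineRes h) (supportMap x hx V) (supportMap x hx U)
      (CommRingCat.ofHom (Ideal.quotientMap _ (funRes hf t h) (supportIdeal_le_comap x hx h))) :=
  (isPushout_funRes hf t h).paste_vert (isPushout_quotient _ _ _ (supportIdeal_map x hx h) _)

/-- The structure homomorphism of the functions on the support. -/
def supportFunctor.ι : (toOpensFunctor T).op ⋙ T.presheaf ⟶ supportFunctor x hx where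
  app U := (supportMap x hx U.unop :)
  naturality _ _ h := (isPushout_supportMap x hx h.unop).w

lemma supportFunctor.coequifibered : (supportFunctor.ι x hx).Coequifibered := fun _ _ h =>
  (isPushout_supportMap x hx h.unop :)

/-- The Cayley–Hamilton theorem, in the form that the point is already defined on its support. -/
lemma supportIdeal_le_kerIdeal (U : T.AffineZariskiSite) : supportIdeal x hx U ≤
    kerIdeal ((toPoint x).app _ (affineFromSpec U) (base_of_π_eq x hx U)) :=
  charIdeal_le_kerIdeal _

lemma isIntegral_supportMap (U : T.AffineZariskiSite) : (supportMap x hx U).hom.IsIntegral :=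
  isIntegral_quotient_charIdeal _

end Support

end GammaSpace
end

noncomputable section
open CategoryTheory Limits AlgebraicGeometry Opposite GammaAlgebra

namespace GammaSpace

/-! ### Closed subschemes of affine schemes -/

section QuotientInclusion
variable {R R' : CommRingCat.{u}} {P P' : Scheme.{u}} (p : P ⟶ Spec R) [IsAffine P]
  (I : Ideal (FunctionRing p))

/-- The projection from the functions on an affine scheme to a quotient. -/
def quotientHom : Γ(P, ⊤) ⟶ .of (FunctionRing p ⧸ I) :=
  CommRingCat.ofHom (R := FunctionRing p) (Ideal.Quotient.mk I)

/-- The closed subscheme of an affine scheme defined by an ideal. -/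
def quotientIncl : Spec (.of (FunctionRing p ⧸ I)) ⟶ P := Spec.map (quotientHom p I) ≫ P.isoSpec.inv

instance : IsClosedImmersion (quotientIncl p I) := by
  have h : Function.Surjective (Ideal.Quotient.mk I) := Ideal.Quotient.mk_surjective
  have : IsClosedImmersion (Spec.map (quotientHom p I)) := IsClosedImmersion.spec_of_surjective _ h
  exact IsClosedImmersion.comp (Spec.map (quotientHom p I)) P.isoSpec.inv

lemma quotientIncl_comp : quotientIncl p I ≫ p =
    Spec.map (CommRingCat.ofHom ((Ideal.Quotient.mk I).comp (algebraMap R (FunctionRing p)))) := by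
  have h := Scheme.isoSpec_inv_naturality p
  rw [Scheme.isoSpec_Spec_inv, ← Spec.map_comp] at h
  rw [quotientIncl, Category.assoc, ← h]
  exact (Spec.map_comp _ _).symm

lemma map_quotientMap_quotientIncl (p' : P' ⟶ Spec R') [IsAffine P'] (I' : Ideal (FunctionRing p'))
    (m : P' ⟶ P) (h) :
    Spec.map (CommRingCat.ofHom (Ideal.quotientMap I' (FunctionRing.map p p' m) h)) ≫
      quotientIncl p I = quotientIncl p' I' ≫ m := by
  rw [quotientIncl, quotientIncl, Category.assoc, ← Scheme.isoSpec_inv_naturality m,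
    ← Category.assoc, ← Category.assoc, ← Spec.map_comp, ← Spec.map_comp]
  rfl

lemma mem_of_quotientIncl_appTop {b : FunctionRing p} (h : (quotientIncl p I).appTop.hom b = 0) :
    b ∈ I := by
  have h1 : P.isoSpec.inv.appTop ≫ (Scheme.ΓSpecIso Γ(P, ⊤)).hom = 𝟙 _ := by
    rw [← Scheme.toSpecΓ_appTop, ← Scheme.Hom.comp_appTop, P.toSpecΓ_isoSpec_inv,
      Scheme.Hom.id_appTop]
  have h2 : (quotientIncl p I).appTop ≫ (Scheme.ΓSpecIso _).hom = quotientHom p I := by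
    rw [quotientIncl, Scheme.Hom.comp_appTop, Category.assoc, Scheme.ΓSpecIso_naturality,
      ← Category.assoc, h1, Category.id_comp]
  refine Ideal.Quotient.eq_zero_iff_mem.1 ((congr(($h2).hom b)).symm.trans ?_)
  exact (congr_arg (Scheme.ΓSpecIso _).hom.hom h).trans (map_zero _)

end QuotientInclusion

/-! ### Existence of a support integral over the base -/

section Existence
open Scheme.AffineZariskiSite
variable {d : ℕ} {T Y : Scheme.{u}} {p : Y ⟶ T} {hp : IsAffineMor (yon.map p)}

/-- A section of `Γᵈ(Y/T)` comes from a closed subscheme of `Y` which is integral over `T`. -/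
theorem exists_closed_integral (β : yon.obj T ⟶ gammaSpace d hp)
    (hβ : β ≫ gammaSpace.π d hp = 𝟙 _) :
    ∃ (Z : Scheme.{u}) (i : Z ⟶ Y) (_ : IsClosedImmersion i) (_ : IsIntegralHom (i ≫ p))
      (α : yon.obj T ⟶ gammaSpace d (isAffine_map (i ≫ p))) (w : _),
      α ≫ gammaSpace.map d (isAffine_map (i ≫ p)) hp (yon.map i) (𝟙 _) w = β := by
  let s (U : T.AffineZariskiSite) := yon.map (affineFromSpec U) ≫ 𝟙 (yon.obj T)
  have hsnd (U : T.AffineZariskiSite) : IsAffineHom (hp.rep.snd (s U)) := hp.property_snd _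
  have hP (U : T.AffineZariskiSite) : IsAffine (hp.rep.pullback (s U)) :=
    isAffine_of_isAffineHom (hp.rep.snd (s U))
  let I (U : T.AffineZariskiSite) : Ideal (FunctionRing (hp.rep.snd (s U))) := supportIdeal β hβ U
  let v (U : T.AffineZariskiSite) : hp.rep.pullback (s U) ⟶ Y := yon.preimage (hp.rep.fst (s U))
  have hv (U : T.AffineZariskiSite) : yon.map (v U) = hp.rep.fst (s U) := yon.map_preimage _
  have hvP (U : T.AffineZariskiSite) : IsPullback (v U) (hp.rep.snd (s U)) p (affineFromSpec U) := by
    have h := hp.rep.isPullback (s U)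
    rw [← hv] at h
    refine IsPullback.of_map yon (yon.map_injective ?_) ?_
    · rw [Functor.map_comp, Functor.map_comp]
      exact h.w.trans (congr_arg (yon.map (hp.rep.snd (s U)) ≫ ·) (Category.comp_id _))
    · exact (Category.comp_id (yon.map (affineFromSpec U))) ▸ h
  let k (U : T.AffineZariskiSite) : Spec (.of (FunctionRing (hp.rep.snd (s U)) ⧸ I U)) ⟶
    hp.rep.pullback (s U) := quotientIncl _ (I U)
  have hk (U : T.AffineZariskiSite) : k U ≫ hp.rep.snd (s U) = Spec.map (supportMap β hβ U) :=
    quotientIncl_comp _ _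
  -- Glue the spectra of the quotients by the support ideals to a scheme over `T`. Their inclusions
  -- in `Y` glue too, because `Y` represents a Zariski sheaf.
  obtain ⟨Z, q, m, hm, hZ⟩ : ∃ (Z : Scheme.{u}) (q : Z ⟶ T)
      (m : ∀ U : T.AffineZariskiSite, Spec (.of (FunctionRing (hp.rep.snd (s U)) ⧸ I U)) ⟶ Z),
      (∀ U, IsPullback (m U) (Spec.map (supportMap β hβ U)) q (affineFromSpec U)) ∧
      ∃ y : yon.obj Z ⟶ yon.obj Y, ∀ U, yon.map (m U) ≫ y = yon.map (k U ≫ v U) := by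
    obtain ⟨Z, q, m, hm, -, hZ⟩ := exists_relativeSpec (supportFunctor.coequifibered β hβ)
    refine ⟨Z, q, m, hm, hZ _ (isSheaf_yon Y) (fun U => yon.map (k U ≫ v U)) fun U V h => ?_⟩
    have h1 := map_quotientMap_quotientIncl (hp.rep.snd (s V)) (I V) (hp.rep.snd (s U)) (I U)
      (prodMap hp hp (𝟙 _) (𝟙 _) (by simp) _ _ (Spec.map (affineRes h))
        ((affineRes_base (𝟙 _) h).trans (Category.comp_id _).symm)) (supportIdeal_le_comap β hβ h)
    have h2 : prodMap hp hp (𝟙 _) (𝟙 _) (by simp) (s U) (s V) (Spec.map (affineRes h))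
        ((affineRes_base (𝟙 _) h).trans (Category.comp_id _).symm) ≫ v V = v U := by
      apply yon.map_injective
      rw [Functor.map_comp, hv, hv, prodMap_fst, Category.comp_id]
    refine (yon.map_comp _ _).symm.trans (congr_arg yon.map ?_)
    refine (Category.assoc _ _ _).symm.trans ((congr_arg (· ≫ v V) h1).trans ?_)
    exact (Category.assoc _ _ _).trans (congr_arg (k U ≫ ·) h2)
  obtain ⟨y, hy⟩ := hZ
  let i : Z ⟶ Y := yon.preimage y
  have hi (U) : m U ≫ i = k U ≫ v U := by
    apply yon.map_injective
    rw [Functor.map_comp, yon.map_preimage, hy]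
  have hq : i ≫ p = q := by
    apply yon.map_injective
    refine hom_ext_of_isPullback (isSheaf_yon T) (affineSpecCover T) m _ hm
      fun (U : T.AffineZariskiSite) => ?_
    rw [← Functor.map_comp, ← Functor.map_comp, ← Category.assoc, hi, Category.assoc, (hvP U).w,
      ← Category.assoc, hk, (hm U).w]
  subst hq
  have hmk (U) : IsPullback (m U) (k U) i (v U) :=
    IsPullback.of_bot (by rw [hk]; exact hm U) (hi U) (hvP U)
  -- Tested on the cover of `Y` by the inverse images of the affine open subschemes of `T`, over
  -- which `i` is the local inclusion `k U` up to isomorphism.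
  have hci : IsClosedImmersion i := by
    let e (U : T.AffineZariskiSite) := (hvP U).isoPullback
    have h (U) : IsPullback (m U) (k U ≫ (e U).hom) i (pullback.fst p (affineFromSpec U)) := by
      refine IsPullback.of_bot ?_ ?_ (IsPullback.of_hasPullback p (affineFromSpec U))
      · rw [Category.assoc, IsPullback.isoPullback_hom_snd, hk]
        exact hm U
      · rw [Category.assoc, IsPullback.isoPullback_hom_fst, hi]
    refine of_openCover_of_isPullback (Q := @IsClosedImmersion) ((affineSpecCover T).pullback₁ p) m
      (fun (U : T.AffineZariskiSite) => k U ≫ (e U).hom) h fun (U : T.AffineZariskiSite) => ?_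
    have : IsClosedImmersion (k U) := inferInstanceAs (IsClosedImmersion (quotientIncl _ _))
    exact IsClosedImmersion.comp (k U) (e U).hom
  have hint : IsIntegralHom (i ≫ p) := by
    have : IsZariskiLocalAtTarget (@IsIntegralHom : MorphismProperty Scheme.{u}) :=
      @HasAffineProperty.instIsZariskiLocalAtTarget (@IsIntegralHom) _
        IsIntegralHom.hasAffineProperty
    exact of_openCover_of_isPullback (Q := @IsIntegralHom) (affineSpecCover T) m _ hm
      fun (U : T.AffineZariskiSite) => IsIntegralHom.SpecMap_iff.2 (isIntegral_supportMap β hβ U)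
  have w : yon.map i ≫ yon.map p = yon.map (i ≫ p) ≫ 𝟙 _ := by
    rw [Category.comp_id, Functor.map_comp]
  have hZ : IsAffineMor (yon.map (i ≫ p)) := isAffine_map _
  -- A function vanishing on `Z` over `U` pulls back to zero along `l` on the local support, so it
  -- lies in the support ideal and hence in the kernel ideal of `β`.
  obtain ⟨α, hα⟩ := exists_factorization (hf₀ := hZ) (hf := hp) (w := w) (isSheaf_yon T)
    (functionRes_surjective hp hZ i w) β (𝟙 _) (base_of_π_eq β hβ) fun U b hb => by
      refine supportIdeal_le_kerIdeal β hβ U (mem_of_quotientIncl_appTop _ _ ?_)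
      let l : Spec (.of (FunctionRing (hp.rep.snd (s U)) ⧸ I U)) ⟶ hZ.rep.pullback (s U) :=
        hZ.rep.lift (yon.map (m U)) (Spec.map (supportMap β hβ U)) (by
          rw [← Functor.map_comp, (hm U).w, Functor.map_comp]
          exact congr_arg (yon.map (Spec.map (supportMap β hβ U)) ≫ ·) (Category.comp_id _).symm)
      have hl : l ≫ prodMap hZ hp (yon.map i) (𝟙 _) w (s U) (s U) (𝟙 _) (by simp) = k U := by
        apply hp.rep.hom_ext
        · rw [Functor.map_comp, Category.assoc, prodMap_fst, ← Category.assoc,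
            Functor.relativelyRepresentable.lift_fst, ← hv, ← Functor.map_comp, ← Functor.map_comp,
            hi]
        · rw [Category.assoc, prodMap_snd, Category.comp_id,
            Functor.relativelyRepresentable.lift_snd, hk]
      have h3 : (k U).appTop.hom b = l.appTop.hom (functionRes hZ hp (yon.map i) w (s U) b) :=
        (congr_arg (fun g => (Scheme.Hom.appTop g).hom b) hl.symm).trans
          congr(($(Scheme.Hom.comp_appTop _ _)).hom b)
      exact h3.trans ((congr_arg l.appTop.hom hb).trans (map_zero _))
  exact ⟨Z, i, hci, hint, α, w, hα⟩

end Existence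

end GammaSpace
end

noncomputable section
open CategoryTheory Limits AlgebraicGeometry Opposite GammaAlgebra

namespace GammaSpace

/-! ### The isomorphism of functors -/

section Representability
variable {X S : Presh.{u}} {f : X ⟶ S} {d : ℕ} {hf : IsAffineMor f}

/-- Every point of `Γᵈ(X/S)` is given by a family of zero cycles. -/
theorem Family.exists_toGamma_eq {T : Scheme.{u}} {t : yon.obj T ⟶ S}
    (x : yon.obj T ⟶ gammaSpace d hf) (hx : x ≫ gammaSpace.π d hf = t) :
    ∃ ξ : Family d hf t, ξ.toGamma = x := by
  have e : x ≫ gammaSpace.π d hf = 𝟙 (yon.obj T) ≫ t := by rw [hx, Category.id_comp]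
  -- Base change to `T` turns `x` into a section of `Γᵈ(X ×_S T/T)`, whose support is a closed
  -- subscheme of `X ×_S T`.
  let β := gammaSpace.lift (isAffine_snd hf t) hf (hf.rep.isPullback t) x (𝟙 _) e
  have hβ : β ≫ gammaSpace.π d (isAffine_snd hf t) = 𝟙 _ := gammaSpace.lift_π ..
  obtain ⟨Z, i, hci, hint, α, w, hα⟩ := exists_closed_integral β hβ
  have hαπ : α ≫ gammaSpace.π d (isAffine_map (i ≫ hf.rep.snd t)) = 𝟙 _ := by
    have h := congr_arg (· ≫ gammaSpace.π d (isAffine_snd hf t)) hα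
    simp only [Category.assoc, gammaSpace.map_π, Category.comp_id] at h
    exact h.trans hβ
  let ξ : Family d hf t := ⟨Z, i, hci, hint, α, hαπ⟩
  refine ⟨ξ, ξ.toGammaSnd_map.symm.trans ?_⟩
  exact (congr_arg (· ≫ gammaSpace.map d (isAffine_snd hf t) hf (hf.rep.fst t) t (hf.rep.w t))
    hα).trans (gammaSpace.lift_map ..)

variable (d hf)

/-- The morphism to `Γᵈ(X/S)` given by an equivalence class of families. -/
def familyHom (T : CostructuredArrow yon S) (ξ : Quot (Family.Equivalent (d := d) (hf := hf)
    (t := T.hom))) :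
    (CostructuredArrow.toOver yon S).obj T ⟶ Over.mk (gammaSpace.π d hf) :=
  ξ.lift (fun ξ => Over.homMk ξ.toGamma ξ.toGamma_π)
    fun ξ₁ ξ₂ h => by ext1; exact h.toGamma_eq

lemma familyHom_bijective (T : CostructuredArrow yon S) :
    Function.Bijective (familyHom d hf T) := by
  refine ⟨?_, fun y => ?_⟩
  · rintro ⟨ξ₁⟩ ⟨ξ₂⟩ h
    -- Equal points give related families directly, so transitivity of `Equivalent` need not be
    -- known beforehand.
    exact Quot.sound (Family.equivalent_of_toGamma_eq congr(($h).left))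
  · obtain ⟨ξ, hξ⟩ := Family.exists_toGamma_eq y.left (Over.w y)
    exact ⟨Quot.mk _ ξ, by ext1; exact hξ⟩

/-- `Γᵈ(X/S)` represents the functor of families of zero cycles. -/
def familyFunctorIso : familyFunctor d hf ≅
    (CostructuredArrow.toOver yon S).op ⋙ yoneda.obj (Over.mk (gammaSpace.π d hf)) :=
  NatIso.ofComponents
    (fun T => (Equiv.ofBijective _ (familyHom_bijective d hf T.unop)).toIso)
    fun {T T'} g => by
      ext ⟨ξ⟩
      refine Over.OverMorphism.ext ?_
      exact ξ.toGamma_pullback g.unop.left (CostructuredArrow.w g.unop)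

end Representability

end GammaSpace
end

theorem mainTheorem7 (d : ℕ) {X S : Presh.{u}} (hS : IsAlgebraicSpace S) (f : X ⟶ S)
    (hf : IsAffineMor f) :
    IsAlgebraicSpace (gammaSpace d hf) ∧
    IsAffineMor (gammaSpace.π d hf) ∧
    (∀ (R : CommRingCat.{u}) (t : yon.obj (Spec R) ⟶ S),
      ∃ q : yon.obj (Spec (gamOver d hf t)) ⟶ gammaSpace d hf,
        IsPullback q (yon.map (Spec.map (gamOver.ι d hf t))) (gammaSpace.π d hf) t ∧
        ∃ h, ∀ z : GamRing d (hf.rep.snd t),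
          (toPoint q).app (yon.map (Spec.map (gamOver.ι d hf t)) ≫ t) (𝟙 _) h
            (baseMap d hf (gamOver.ι d hf t) t _ rfl z) = z) ∧
    ∃ e : familyFunctor d hf ≅
        (CostructuredArrow.toOver yon S).op ⋙ yoneda.obj (Over.mk (gammaSpace.π d hf)),
      ∀ (T : CostructuredArrow yon S) (ξ : Family d hf T.hom),
        e.hom.app (op T) (Quot.mk _ ξ) = Over.homMk ξ.toGamma ξ.toGamma_π := by
  refine ⟨hS.gammaSpace d hf, hS.isAffineMor_π d hf,
    fun R t => ⟨taut d hf t, isPullback_taut d hf t, ?_, toPoint_taut_app d hf t _⟩,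
    familyFunctorIso d hf, fun T ξ => rfl⟩
  rw [toPoint_taut]
  exact map_id_comp rfl _
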